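/- Let $K$ be a field and $\Lambda$ a finite dimensional hereditary $K$-algebra of finite representation type. Modules are finitely generated left $\Lambda$-modules. Let $P_1,\dots,P_n$ be a complete list, without repetition, of the indecomposable projective modules up to isomorphism. For a module $M$ let $\underline{\dim}\,M\in\mathbb Z^n$ be the vector with coordinates $\dim_K\operatorname{Hom}_\Lambda(P_i,M)$. The $g$-vector of $M$ is $g(M)=a-b\in\mathbb Z^n$, where $0\to\bigoplus_i P_i^{b_i}\to\bigoplus_i P_i^{a_i}\to M\to0$ is a projective resolution of $M$, and $g(P_j[1])=-e_j$. For an indecomposable module $M$ put $$D(M)=\{g\in\mathbb R^n \mid g\cdot\underline{\dim}\,M=0,\ g\cdot\underline{\dim}\,M'\le 0\ \text{ for all submodules } M'\subseteq M\}.$$ A chamber is a connected component of $\mathbb R^n\setminus\bigcup_M D(M)$, where $M$ runs over the indecomposable modules. A (basic) cluster-tilting object is $T\oplus P[1]$, where $T=T_1\oplus\dots\oplus T_k$ is a direct sum of pairwise nonisomorphic exceptional modules (bricks with $\operatorname{Ext}^1_\Lambda(T_i,T_i)=0$) with $\operatorname{Ext}^1_\Lambda(T,T)=0$, and $P$ is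 a direct sum of $n-k$ pairwise nonisomorphic indecomposable projective modules with $\operatorname{Hom}_\Lambda(P,T)=0$. A torsion class is a class of modules containing $0$ and closed under quotients and extensions. A torsion class $\mathcal T$ is said to be associated to the chamber $\mathcal U$ if there is a cluster-tilting object $T\oplus P[1]$ such that $\mathcal U$ is the interior of the cone spanned by the $g$-vectors of its $n$ components (all positive linear combinations of them) and $\mathcal T=\operatorname{Fac}T$, the class of all quotients of finite direct sums of copies of the $T_i$. **Proposition.** Each chamber $\mathcal U$ has exactly one associated torsion class $\mathcal T(\mathcal U)$, and for every $g\in\mathcal U$ $$\mathcal T(\mathcal U)=\{M \mid g\cdot\underline{\dim}\,M'>0\ \text{ for every nonzero quotient module } M' \text{ of } M\}.$$ -/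

import Mathlib

open CategoryTheory
open scoped ModuleCat

namespace WallChamber

universe w u

/-- A ring is (left) hereditary if all its left ideals are projective. -/
def IsHereditary (Λ : Type u) [Ring Λ] : Prop :=
  ∀ I : Ideal Λ, Module.Projective Λ I

/-- Finite representation type: up to isomorphism there are only finitely many indecomposable
finitely generated modules. -/
def IsOfFiniteType (Λ : Type u) [Ring Λ] : Prop :=
  ∃ s : Finset (ModuleCat.{u} Λ), ∀ M : ModuleCat.{u} Λ,
    Module.Finite Λ M → Indecomposable M → ∃ N ∈ s, Nonempty (M ≅ N)

section Basic

variable {Λ : Type u} [Ring Λ] {n : ℕ}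

/-- `P 0, …, P (n - 1)` is a complete list, without repetition, of the indecomposable finitely
generated projective modules up to isomorphism. -/
structure IsIndecProjectiveList (P : Fin n → ModuleCat.{u} Λ) : Prop where
  finite : ∀ i, Module.Finite Λ (P i)
  projective : ∀ i, Module.Projective Λ (P i)
  indecomposable : ∀ i, Indecomposable (P i)
  injective : ∀ i j, Nonempty (P i ≅ P j) → i = j
  complete : ∀ Q : ModuleCat.{u} Λ, Module.Finite Λ Q → Module.Projective Λ Q →
    Indecomposable Q → ∃ i, Nonempty (Q ≅ P i)

/-- The direct sum of `m i` copies of `X i`, for all `i`. -/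
abbrev multiSum {k : ℕ} (X : Fin k → ModuleCat.{u} Λ) (m : Fin k → ℕ) : Type u :=
  ∀ i, Fin (m i) → X i

/-- `v` is the `g`-vector of `M`: there is a projective resolution
`0 → ⨁ P i ^ b i → ⨁ P i ^ a i → M → 0` with `v = a - b`. (Over a hereditary algebra the minimal
projective presentation is such a resolution, and every such resolution gives the same `v`.) -/
def IsGVector (P : Fin n → ModuleCat.{u} Λ) (M : ModuleCat.{u} Λ) (v : Fin n → ℝ) : Prop :=
  ∃ (a b : Fin n → ℕ) (f : multiSum P b →ₗ[Λ] multiSum P a) (p : multiSum P a →ₗ[Λ] M),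
    Function.Injective f ∧ Function.Exact f p ∧ Function.Surjective p ∧
      ∀ i, v i = (a i : ℝ) - (b i : ℝ)

/-- A brick: a nonzero module all of whose nonzero endomorphisms are automorphisms. -/
def IsBrick (M : ModuleCat.{u} Λ) : Prop :=
  Nontrivial M ∧ ∀ f : M →ₗ[Λ] M, f ≠ 0 → Function.Bijective f

/-- An exceptional module: a finitely generated rigid brick. -/
structure IsExceptional (M : ModuleCat.{u} Λ) : Prop where
  finite : Module.Finite Λ M
  brick : IsBrick M
  rigid : Subsingleton (Abelian.Ext M M 1)

/-- A (basic) cluster-tilting object `T 0 ⊕ ⋯ ⊕ T (k - 1) ⊕ ⨁ j ∈ J, (P j)[1]`: a rigid module with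
`k` pairwise nonisomorphic exceptional components and `n - k` shifted indecomposable projectives
such that there are no nonzero homomorphisms from the latter projectives to the module. -/
structure ClusterTiltingObject (P : Fin n → ModuleCat.{u} Λ) where
  k : ℕ
  T : Fin k → ModuleCat.{u} Λ
  J : Finset (Fin n)
  exceptional : ∀ i, IsExceptional (T i)
  injective : ∀ i j, Nonempty (T i ≅ T j) → i = j
  ext_eq_zero : ∀ i j, Subsingleton (Abelian.Ext (T i) (T j) 1)
  hom_eq_zero : ∀ j ∈ J, ∀ i, ∀ f : P j →ₗ[Λ] T i, f = 0
  card_eq : k + J.card = n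

/-- The interior of the simplicial cone spanned by the `g`-vectors of the components of a
cluster-tilting object; the `g`-vector of `(P j)[1]` is `-e j`. -/
def ClusterTiltingObject.openCone {P : Fin n → ModuleCat.{u} Λ} (C : ClusterTiltingObject P) :
    Set (Fin n → ℝ) :=
  {g | ∃ (v : Fin C.k → Fin n → ℝ) (a : Fin C.k → ℝ) (b : Fin n → ℝ),
    (∀ i, IsGVector P (C.T i) (v i)) ∧ (∀ i, 0 < a i) ∧ (∀ j ∈ C.J, 0 < b j) ∧
      g = ∑ i, a i • v i - ∑ j ∈ C.J, b j • Pi.single j (1 : ℝ)}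

/-- `Fac T`: the finitely generated modules that are quotients of finite direct sums of copies of
the components of the module part `T` of a cluster-tilting object. -/
def ClusterTiltingObject.fac {P : Fin n → ModuleCat.{u} Λ} (C : ClusterTiltingObject P) :
    Set (ModuleCat.{u} Λ) :=
  {M | ∃ (m : Fin C.k → ℕ) (p : multiSum C.T m →ₗ[Λ] M), Function.Surjective p}

/-- A torsion class in the category of finitely generated modules: a class that contains the zero
modules and is closed under quotients and extensions. -/
structure IsTorsionClass (𝒯 : Set (ModuleCat.{u} Λ)) : Prop where
  finite : ∀ M ∈ 𝒯, Module.Finite Λ M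
  zero_mem : ∀ M : ModuleCat.{u} Λ, Subsingleton M → M ∈ 𝒯
  quotient_mem : ∀ M ∈ 𝒯, ∀ (N : ModuleCat.{u} Λ) (p : M →ₗ[Λ] N), Function.Surjective p → N ∈ 𝒯
  extension_mem : ∀ (L M N : ModuleCat.{u} Λ) (f : L →ₗ[Λ] M) (p : M →ₗ[Λ] N),
    Function.Injective f → Function.Exact f p → Function.Surjective p → L ∈ 𝒯 → N ∈ 𝒯 → M ∈ 𝒯

end Basic

section Walls

variable (K : Type w) [Field K] {Λ : Type u} [Ring Λ] [Algebra K Λ] {n : ℕ}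
  (P : Fin n → ModuleCat.{u} Λ)

/-- The dimension vector of `M`, with `i`-th coordinate `dim_K Hom_Λ(P i, M)`. For a path algebra
this is the dimension of `M` at the vertex `i`. -/
noncomputable def dimVec (M : ModuleCat.{u} Λ) : Fin n → ℝ :=
  fun i => (Module.finrank K (P i ⟶ M) : ℝ)

/-- The semi-invariant domain `D(M)`. -/
def domain (M : ModuleCat.{u} Λ) : Set (Fin n → ℝ) :=
  {g | g ⬝ᵥ dimVec K P M = 0 ∧
    ∀ N : Submodule Λ M, g ⬝ᵥ dimVec K P (ModuleCat.of Λ N) ≤ 0}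

/-- The union of the walls `D(M)`, over all indecomposable finitely generated modules `M`. -/
def walls : Set (Fin n → ℝ) :=
  {g | ∃ M : ModuleCat.{u} Λ, Module.Finite Λ M ∧ Indecomposable M ∧ g ∈ domain K P M}

/-- A chamber: a connected component of the complement of the union of the walls. -/
def IsChamber (U : Set (Fin n → ℝ)) : Prop :=
  ∃ x ∈ (walls K P)ᶜ, U = connectedComponentIn (walls K P)ᶜ x

/-- The finitely generated modules `M` such that `g · dim M' > 0` for all nonzero quotients `M'`
of `M`, including `M` itself if it is nonzero. -/
def positiveQuotientClass (g : Fin n → ℝ) : Set (ModuleCat.{u} Λ) :=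
  {M | Module.Finite Λ M ∧
    ∀ N : Submodule Λ M, N ≠ ⊤ → 0 < g ⬝ᵥ dimVec K P (ModuleCat.of Λ (M ⧸ N))}

/-- `𝒯` is the torsion class associated to `U`: it is a torsion class, and it is `Fac T` for the
module part `T` of a cluster-tilting object whose `g`-vectors span a cone with interior `U`. -/
def IsTorsionClassOf (P : Fin n → ModuleCat.{u} Λ) (U : Set (Fin n → ℝ))
    (𝒯 : Set (ModuleCat.{u} Λ)) : Prop :=
  IsTorsionClass 𝒯 ∧ ∃ C : ClusterTiltingObject P, C.openCone = U ∧ C.fac = 𝒯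

end Walls

end WallChamber

/-! Write ⟨M, N⟩ = dim Hom(M, N) - dim Ext¹(M, N). Applying Hom(-, N) to a projective resolution of
M gives g(M) · dim N = ⟨M, N⟩, while -e_j · dim N = -dim Hom(P_j, N). Hence pairings with the cone
of a cluster-tilting object T ⊕ P[1] have homological signs. If N is a nonzero quotient of a sum of
copies of the T_i, then Ext¹(T, N) = 0, Hom(P, N) = 0 and Hom(T, N) ≠ 0, so interior vectors pair
positively with N (`dot_pos_of_ext`). If Hom(T, N) = 0, they pair nonpositively
(`compVec_dot_nonpos`). Dividing a module by the trace of T shows that Fac T is the class cut out by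
any g in the open cone (`ClusterTiltingObject.fac_eq`). This gives uniqueness.

The open cone is a chamber (`ClusterTiltingObject.connectedComponentIn_eq`). For a vector inside it
only the zero module is semistable: maps from T would have images with positive pairing, and without
such maps all g-vectors pair to zero with the module. On the boundary some component has coefficient
zero, and a nonzero module perpendicular to the other components is semistable. Such a module exists
(`exists_perp`): the other g-vectors do not span, whereas a rigid family with no nonzero
perpendicular module does span (`span_eq_top_of_perp_eq_zero`), by Bongartz's universal extension.
Linear independence of the g-vectors rests on the Happel-Ringel lemma
(`IsIndec.injective_or_surjective`), which orders a rigid family so that its matrix of Hom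
dimensions is triangular.

For existence, let g lie off the walls (`exists_clusterTiltingObject`). The class in the proposition
is a torsion class 𝒯. Finite representation type provides left 𝒯-approximations of the P_i. From
these, the indecomposable Ext-projectives of 𝒯, together with the P_j[1] such that P_j has no maps
to 𝒯, form a cluster-tilting object (`IsTorsionClass.exists_rigidFamily`). Each coordinate of g is
positive: pair g with a module perpendicular to the other components or, if T has nonzero maps to
that module, with the image of one of them. -/

namespace WallChamber

universe w u

/-! ### Short exact sequences and the vanishing of Ext¹. -/

section ShortExact

variable {Λ : Type u} [Ring Λ]
variable {A B C L M N X : Type u}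
  [AddCommGroup A] [Module Λ A] [AddCommGroup B] [Module Λ B] [AddCommGroup C] [Module Λ C]
  [AddCommGroup L] [Module Λ L] [AddCommGroup M] [Module Λ M] [AddCommGroup N] [Module Λ N]
  [AddCommGroup X] [Module Λ X]

/-- A short exact sequence of modules. -/
structure IsSES (i : A →ₗ[Λ] B) (q : B →ₗ[Λ] C) : Prop where
  inj : Function.Injective i
  exact : Function.Exact i q
  surj : Function.Surjective q

theorem isSES_subtype_ker {q : B →ₗ[Λ] C} (hq : Function.Surjective q) :
    IsSES (LinearMap.ker q).subtype q :=
  ⟨Subtype.val_injective, fun y => by simp, hq⟩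

theorem isSES_subtype_mkQ (S : Submodule Λ B) : IsSES S.subtype S.mkQ :=
  ⟨Subtype.val_injective, fun y => by simp, S.mkQ_surjective⟩

theorem isSES_inl_snd : IsSES (LinearMap.inl Λ A B) (LinearMap.snd Λ A B) :=
  ⟨LinearMap.inl_injective, fun y => by
    constructor
    · intro h; exact ⟨y.1, Prod.ext rfl h.symm⟩
    · rintro ⟨x, rfl⟩; rfl, LinearMap.snd_surjective⟩

/-- The preimage of a submodule of the quotient, as an extension of that submodule. -/
theorem IsSES.comap {i : A →ₗ[Λ] B} {q : B →ₗ[Λ] C} (h : IsSES i q) (S : Submodule Λ C) :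
    IsSES (i.codRestrict (S.comap q) fun a => by
        simp [(h.exact (i a)).2 ⟨a, rfl⟩])
      ((q.comp (S.comap q).subtype).codRestrict S fun x => x.2) := by
  refine ⟨fun x y hxy => h.inj (congrArg Subtype.val hxy), fun y => ?_, fun c => ?_⟩
  · constructor
    · intro hy
      obtain ⟨a, ha⟩ := (h.exact y.1).1 (congrArg Subtype.val hy)
      exact ⟨a, Subtype.ext ha⟩
    · rintro ⟨a, rfl⟩
      exact Subtype.ext ((h.exact (i a)).2 ⟨a, rfl⟩)
  · obtain ⟨b, hb⟩ := h.surj c.1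
    exact ⟨⟨b, by simp [hb]⟩, Subtype.ext hb⟩

/-- `Hom(-, N)` is exact in the middle: a map killing the sub factors through the quotient. -/
theorem IsSES.exists_desc {i : A →ₗ[Λ] B} {q : B →ₗ[Λ] C} (h : IsSES i q) (f : B →ₗ[Λ] N)
    (hf : f ∘ₗ i = 0) : ∃ f' : C →ₗ[Λ] N, f' ∘ₗ q = f := by
  have hk : LinearMap.ker q ≤ LinearMap.ker f := by
    intro b hb
    obtain ⟨a, rfl⟩ := (h.exact b).1 hb
    exact LinearMap.congr_fun hf a
  refine ⟨(LinearMap.ker q).liftQ f hk ∘ₗ (q.quotKerEquivOfSurjective h.surj).symm, ?_⟩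
  ext b
  have : (q.quotKerEquivOfSurjective h.surj).symm (q b) = Submodule.Quotient.mk b := by
    rw [LinearEquiv.symm_apply_eq]; rfl
  simp [this]

/-- A map into the middle killed by the quotient map factors through the sub. -/
theorem IsSES.exists_lift {i : A →ₗ[Λ] B} {q : B →ₗ[Λ] C} (h : IsSES i q) (f : N →ₗ[Λ] B)
    (hf : q ∘ₗ f = 0) : ∃ f' : N →ₗ[Λ] A, i ∘ₗ f' = f := by
  have hr : ∀ x, f x ∈ LinearMap.range i := fun x =>
    (h.exact _).1 (LinearMap.congr_fun hf x)
  refine ⟨(LinearEquiv.ofInjective i h.inj).symm ∘ₗ f.codRestrict _ hr, ?_⟩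
  ext x
  have := LinearEquiv.apply_symm_apply (LinearEquiv.ofInjective i h.inj) (f.codRestrict _ hr x)
  exact congrArg Subtype.val this

variable (M N) in
/-- Vanishing of `Ext¹(M, N)`, in terms of extensions of linear maps. -/
def ExtZ (Λ : Type u) [Ring Λ] (M N : Type u) [AddCommGroup M] [Module Λ M] [AddCommGroup N]
    [Module Λ N] : Prop :=
  ∀ ⦃A B : Type u⦄ [AddCommGroup A] [AddCommGroup B] [Module Λ A] [Module Λ B]
    (i : A →ₗ[Λ] B) (q : B →ₗ[Λ] M), IsSES i q → ∀ h : A →ₗ[Λ] N, ∃ h' : B →ₗ[Λ] N, h' ∘ₗ i = h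

/-- It suffices to extend maps for one presentation with projective middle term. -/
theorem ExtZ.of_presentation {i : A →ₗ[Λ] B} {q : B →ₗ[Λ] M} (h : IsSES i q)
    [Module.Projective Λ B] (H : ∀ f : A →ₗ[Λ] N, ∃ f' : B →ₗ[Λ] N, f' ∘ₗ i = f) : ExtZ Λ M N := by
  intro A' B' _ _ _ _ i' q' h' f
  obtain ⟨u, hu⟩ := Module.projective_lifting_property q' q h'.surj
  obtain ⟨v, hv⟩ := h'.exists_lift (u ∘ₗ i) (by
    rw [← LinearMap.comp_assoc, hu]; ext a; exact (h.exact _).2 ⟨a, rfl⟩)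
  obtain ⟨e, he⟩ := H (f ∘ₗ v)
  -- `B'` is the pushout of `A'` and `B` along `A`, so `f` and the extension `e` of `f ∘ v` glue to
  -- a map on `B'`.
  have hs : IsSES ((-v).prod i) (i'.coprod u) := by
    refine ⟨fun x y hxy => h.inj (congrArg Prod.snd hxy), fun y => ⟨fun hy => ?_, ?_⟩, fun b => ?_⟩
    · have hy' : i' y.1 + u y.2 = 0 := hy
      have h1 : q y.2 = 0 := by
        rw [← hu]
        have := congrArg q' hy'
        rw [map_add, (h'.exact _).2 ⟨y.1, rfl⟩, zero_add, map_zero] at this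
        exact this
      obtain ⟨a, ha⟩ := (h.exact _).1 h1
      refine ⟨a, Prod.ext ?_ ha⟩
      apply h'.inj
      have h2 : i' (v a) = u y.2 := by rw [← ha]; exact LinearMap.congr_fun hv a
      change i' (-(v a)) = i' y.1
      rw [map_neg, h2, neg_eq_of_add_eq_zero_left hy']
    · rintro ⟨a, rfl⟩
      have h2 : i' (v a) = u (i a) := LinearMap.congr_fun hv a
      simp [h2]
    · obtain ⟨y, hy⟩ := h.surj (q' b)
      have : q' (b - u y) = 0 := by
        rw [map_sub, sub_eq_zero, ← hy, ← hu]; rfl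
      obtain ⟨a, ha⟩ := (h'.exact _).1 this
      exact ⟨(a, y), by simp [ha]⟩
  obtain ⟨d, hd⟩ := hs.exists_desc (f.coprod e) (by
    ext a
    have := LinearMap.congr_fun he a
    simp at this
    simp [this])
  refine ⟨d, ?_⟩
  ext a
  have := LinearMap.congr_fun hd (a, 0)
  simpa using this

theorem ExtZ.of_projective [Module.Projective Λ M] : ExtZ Λ M N :=
  ExtZ.of_presentation (A := PUnit.{u+1}) (B := M) (i := 0) (q := LinearMap.id)
    ⟨fun _ _ _ => Subsingleton.elim _ _, fun y => by
      constructor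
      · intro h; exact ⟨0, by simpa using h.symm⟩
      · rintro ⟨x, rfl⟩; simp, Function.surjective_id⟩
    fun f => ⟨0, LinearMap.ext fun x => by
      rw [Subsingleton.elim x 0, map_zero, map_zero]⟩

/-- Lifting maps along a surjection whose kernel has no extensions. -/
theorem ExtZ.exists_lift {i : A →ₗ[Λ] B} {q : B →ₗ[Λ] C} (h : IsSES i q) (hM : ExtZ Λ M A)
    (f : M →ₗ[Λ] C) : ∃ f' : M →ₗ[Λ] B, q ∘ₗ f' = f := by
  -- The pullback of `q` along `f` is an extension of `M` by `A`, hence has a retraction `r` onto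
  -- `A`. Subtracting `i ∘ r` from the projection to `B` makes it descend to `M`.
  let E : Submodule Λ (B × M) := LinearMap.eqLocus (q ∘ₗ LinearMap.fst Λ B M)
    (f ∘ₗ LinearMap.snd Λ B M)
  have hE : ∀ x : E, q x.1.1 = f x.1.2 := fun x => x.2
  let j : A →ₗ[Λ] E := (LinearMap.inl Λ B M ∘ₗ i).codRestrict E fun a => by
    change q (i a) = f 0
    rw [map_zero]; exact (h.exact _).2 ⟨a, rfl⟩
  let p : E →ₗ[Λ] M := LinearMap.snd Λ B M ∘ₗ E.subtype
  have hs : IsSES j p := by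
    refine ⟨fun x y hxy => h.inj (congrArg (fun z : E => z.1.1) hxy), fun y => ⟨fun hy => ?_, ?_⟩,
      fun m => ?_⟩
    · have hy' : y.1.2 = 0 := hy
      have : q y.1.1 = 0 := by rw [hE, hy', map_zero]
      obtain ⟨a, ha⟩ := (h.exact _).1 this
      exact ⟨a, Subtype.ext (Prod.ext ha hy'.symm)⟩
    · rintro ⟨a, rfl⟩; rfl
    · obtain ⟨b, hb⟩ := h.surj (f m)
      exact ⟨⟨(b, m), hb⟩, rfl⟩
  obtain ⟨r, hr⟩ := hM j p hs LinearMap.id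
  obtain ⟨g, hg⟩ := hs.exists_desc (LinearMap.fst Λ B M ∘ₗ E.subtype - i ∘ₗ r) (by
    ext a
    have : r (j a) = a := LinearMap.congr_fun hr a
    simp [this, j])
  refine ⟨g, ?_⟩
  ext m
  obtain ⟨e, rfl⟩ := hs.surj m
  have h1 : g (p e) = e.1.1 - i (r e) := LinearMap.congr_fun hg e
  have h2 : q (i (r e)) = 0 := (h.exact _).2 ⟨_, rfl⟩
  change q (g (p e)) = f e.1.2
  rw [h1, map_sub, h2, hE, sub_zero]

theorem ExtZ.exists_section {i : A →ₗ[Λ] B} {q : B →ₗ[Λ] M} (h : IsSES i q) (hM : ExtZ Λ M A) :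
    ∃ s : M →ₗ[Λ] B, q ∘ₗ s = LinearMap.id :=
  hM.exists_lift h LinearMap.id

/-- `Ext¹` vanishes as soon as all extensions split. -/
theorem ExtZ.of_sections
    (H : ∀ (E : Type u) [AddCommGroup E] [Module Λ E] (i : N →ₗ[Λ] E) (q : E →ₗ[Λ] M),
      IsSES i q → ∃ s : M →ₗ[Λ] E, q ∘ₗ s = LinearMap.id) : ExtZ Λ M N := by
  intro A B _ _ _ _ i q h f
  -- Push the sequence out along `f`. A splitting of the pushout gives a retraction onto `N`, and
  -- its restriction to `B` extends `f`.
  let S : Submodule Λ (N × B) := LinearMap.range ((-f).prod i)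
  let j : N →ₗ[Λ] (N × B) ⧸ S := S.mkQ ∘ₗ LinearMap.inl Λ N B
  let p : (N × B) ⧸ S →ₗ[Λ] M := S.liftQ (q ∘ₗ LinearMap.snd Λ N B) (by
    rintro _ ⟨a, rfl⟩
    exact (h.exact _).2 ⟨a, rfl⟩)
  have hs : IsSES j p := by
    refine ⟨(injective_iff_map_eq_zero j).2 fun x hx => ?_, fun y => ⟨fun hy => ?_, ?_⟩, fun m => ?_⟩
    · have hx' : ((x, 0) : N × B) ∈ S := (Submodule.Quotient.mk_eq_zero S).1 hx
      obtain ⟨a, ha⟩ := hx'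
      have h1 : i a = 0 := congrArg Prod.snd ha
      have h2 : -(f a) = x := congrArg Prod.fst ha
      rw [← h2, h.inj (h1.trans (map_zero i).symm)]; simp
    · obtain ⟨⟨x, b⟩, rfl⟩ := S.mkQ_surjective y
      have hb : q b = 0 := hy
      obtain ⟨a, rfl⟩ := (h.exact _).1 hb
      refine ⟨x + f a, ?_⟩
      change Submodule.Quotient.mk _ = Submodule.Quotient.mk _
      rw [Submodule.Quotient.eq]
      exact ⟨-a, by simp⟩
    · rintro ⟨x, rfl⟩
      change q 0 = 0
      simp
    · obtain ⟨b, hb⟩ := h.surj m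
      exact ⟨S.mkQ (0, b), hb⟩
  obtain ⟨s, hs'⟩ := H _ j p hs
  obtain ⟨r, hr⟩ := hs.exists_lift (LinearMap.id - s ∘ₗ p) (by
    rw [LinearMap.comp_sub, ← LinearMap.comp_assoc, hs']; simp)
  refine ⟨r ∘ₗ S.mkQ ∘ₗ LinearMap.inr Λ N B, ?_⟩
  ext a
  apply hs.inj
  have h1 : j (r (S.mkQ (0, i a))) = S.mkQ (0, i a) - s (p (S.mkQ (0, i a))) :=
    LinearMap.congr_fun hr _
  have h2 : p (S.mkQ (0, i a)) = 0 := (h.exact _).2 ⟨a, rfl⟩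
  change j (r (S.mkQ (0, i a))) = j (f a)
  rw [h1, h2, map_zero, sub_zero]
  change Submodule.Quotient.mk _ = Submodule.Quotient.mk _
  rw [Submodule.Quotient.eq]
  exact ⟨a, by simp⟩

theorem ExtZ.congr_left (e : M ≃ₗ[Λ] X) (h : ExtZ Λ M N) : ExtZ Λ X N := by
  intro A B _ _ _ _ i q hs f
  refine h i ((e.symm : X →ₗ[Λ] M) ∘ₗ q) ⟨hs.inj, fun y => ?_, e.symm.surjective.comp hs.surj⟩ f
  rw [← hs.exact y]; simp

/-- `Ext¹(-, N)` is half exact. -/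
theorem ExtZ.of_ses_left {i : A →ₗ[Λ] B} {q : B →ₗ[Λ] C} (h : IsSES i q) (hA : ExtZ Λ A N)
    (hC : ExtZ Λ C N) : ExtZ Λ B N := by
  intro A' B' _ _ _ _ i' q' h' f
  -- Extend first to the preimage of `A` in `B'`, then to all of `B'`; the successive quotients are
  -- `A` and `C`.
  obtain ⟨f₁, hf₁⟩ := (hA.congr_left (LinearEquiv.ofInjective i h.inj)) _ _
    (h'.comap (LinearMap.range i)) f
  have hs : IsSES ((LinearMap.range i).comap q').subtype (q ∘ₗ q') := by
    refine ⟨Subtype.val_injective, fun y => ?_, h.surj.comp h'.surj⟩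
    simp [h.exact (q' y)]
  obtain ⟨f₂, hf₂⟩ := hC _ _ hs f₁
  refine ⟨f₂, ?_⟩
  rw [← hf₁, ← hf₂]; rfl

theorem ExtZ.pi_right {ι : Type*} {Y : ι → Type u} [∀ i, AddCommGroup (Y i)]
    [∀ i, Module Λ (Y i)] {Z : Type u} [AddCommGroup Z] [Module Λ Z] (e : Z ≃ₗ[Λ] (∀ i, Y i))
    (h : ∀ i, ExtZ Λ M (Y i)) : ExtZ Λ M Z := by
  intro A B _ _ _ _ i q hs f
  choose g hg using fun k => h k i q hs (LinearMap.proj k ∘ₗ e.toLinearMap ∘ₗ f)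
  refine ⟨e.symm ∘ₗ LinearMap.pi g, ?_⟩
  ext a
  apply e.injective
  ext k
  simpa using LinearMap.congr_fun (hg k) a

theorem ExtZ.of_retract_left (h : ExtZ Λ M X) (s : N →ₗ[Λ] M) (r : M →ₗ[Λ] N)
    (hrs : r ∘ₗ s = LinearMap.id) : ExtZ Λ N X := by
  refine ExtZ.of_sections fun E _ _ i q hs => ?_
  obtain ⟨t, ht⟩ := h.exists_lift hs r
  exact ⟨t ∘ₗ s, by rw [← LinearMap.comp_assoc, ht, hrs]⟩

theorem ExtZ.of_retract_right (h : ExtZ Λ X M) (s : N →ₗ[Λ] M) (r : M →ₗ[Λ] N)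
    (hrs : r ∘ₗ s = LinearMap.id) : ExtZ Λ X N := by
  intro A B _ _ _ _ i q hs f
  obtain ⟨g, hg⟩ := h i q hs (s ∘ₗ f)
  exact ⟨r ∘ₗ g, by rw [LinearMap.comp_assoc, hg, ← LinearMap.comp_assoc, hrs]; rfl⟩

end ShortExact

/-! ### Comparison with the Ext groups of Mathlib. -/

section ExtGroup

variable {Λ : Type u} [Ring Λ]

variable {A B C : Type u} [AddCommGroup A] [Module Λ A] [AddCommGroup B] [Module Λ B]
  [AddCommGroup C] [Module Λ C]

/-- A short exact sequence of modules as a short complex in `ModuleCat`. -/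
def IsSES.shortComplex {i : A →ₗ[Λ] B} {q : B →ₗ[Λ] C} (h : IsSES i q) :
    ShortComplex (ModuleCat.{u} Λ) :=
  ShortComplex.mk (ModuleCat.ofHom i) (ModuleCat.ofHom q)
    (ModuleCat.hom_ext (LinearMap.ext fun a => (h.exact _).2 ⟨a, rfl⟩))

theorem IsSES.shortExact {i : A →ₗ[Λ] B} {q : B →ₗ[Λ] C} (h : IsSES i q) :
    h.shortComplex.ShortExact where
  exact := (ShortComplex.ShortExact.moduleCat_exact_iff_function_exact _).2 h.exact
  mono_f := (ModuleCat.mono_iff_injective _).2 h.inj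
  epi_g := (ModuleCat.epi_iff_surjective _).2 h.surj

/-- Both directions use the contravariant long exact sequence. A map on the kernel extends iff its
connecting image is zero; for a free middle term every class in Ext¹ is such an image. -/
theorem subsingleton_ext_iff (M N : ModuleCat.{u} Λ) :
    Subsingleton (Abelian.Ext M N 1) ↔ ExtZ Λ M N := by
  constructor
  · intro hsub A B _ _ _ _ i q h f
    obtain ⟨x₂, hx₂⟩ := Abelian.Ext.contravariant_sequence_exact₁ h.shortExact N
      (Abelian.Ext.mk₀ (ModuleCat.ofHom f : h.shortComplex.X₁ ⟶ N)) (n₁ := 1) rfl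
      (@Subsingleton.elim _ hsub _ _)
    obtain ⟨g, rfl⟩ := Abelian.Ext.homEquiv₀.symm.surjective x₂
    refine ⟨g.hom, ?_⟩
    have : h.shortComplex.f ≫ g = ModuleCat.ofHom f := by
      apply Abelian.Ext.homEquiv₀.symm.injective
      simpa [Abelian.Ext.homEquiv₀] using hx₂
    exact congrArg ModuleCat.Hom.hom this
  · intro H
    let q : (M →₀ Λ) →ₗ[Λ] M := Finsupp.linearCombination Λ id
    have hq : Function.Surjective q := fun m => ⟨Finsupp.single m 1, by simp [q]⟩
    have h := isSES_subtype_ker hq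
    have hproj : Projective h.shortComplex.X₂ :=
      (IsProjective.iff_projective (M →₀ Λ)).1 inferInstance
    suffices hz : ∀ x : Abelian.Ext M N 1, x = 0 from ⟨fun x y => by rw [hz x, hz y]⟩
    intro x
    obtain ⟨x₁, hx₁⟩ := Abelian.Ext.contravariant_sequence_exact₃ h.shortExact N x
      (Abelian.Ext.eq_zero_of_projective (P := h.shortComplex.X₂) (n := 0) _) (n₀ := 0) rfl
    obtain ⟨f, rfl⟩ := Abelian.Ext.homEquiv₀.symm.surjective x₁
    obtain ⟨g, hg⟩ := H _ _ h f.hom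
    obtain ⟨g', hg'⟩ : ∃ g' : h.shortComplex.X₂ ⟶ N, f = h.shortComplex.f ≫ g' :=
      ⟨ModuleCat.ofHom g, ModuleCat.hom_ext hg.symm⟩
    have hf : Abelian.Ext.homEquiv₀.symm f = Abelian.Ext.mk₀ f := by simp [Abelian.Ext.homEquiv₀]
    rw [← hx₁, hf, hg', ← Abelian.Ext.mk₀_comp_mk₀]
    exact h.shortExact.extClass_comp_assoc (Abelian.Ext.mk₀ g') (h := rfl)

end ExtGroup

end WallChamber

namespace WallChamber

universe w u

/-! ### Dimensions of Hom spaces and approximations. -/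

section HomDim

variable (K : Type w) [Field K] {Λ : Type u} [Ring Λ] [Algebra K Λ]
variable {A B C M N X : Type u}
  [AddCommGroup A] [Module Λ A] [AddCommGroup B] [Module Λ B] [AddCommGroup C] [Module Λ C]
  [AddCommGroup M] [Module Λ M] [AddCommGroup N] [Module Λ N] [AddCommGroup X] [Module Λ X]

/-- The `K`-dimension of `Hom_Λ(M, N)`. -/
noncomputable def homDim (Λ : Type u) [Ring Λ] [Algebra K Λ] (M N : Type u) [AddCommGroup M]
    [Module Λ M] [AddCommGroup N] [Module Λ N] : ℕ :=
  Module.finrank K (ModuleCat.of Λ M ⟶ ModuleCat.of Λ N)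

theorem finite_hom [Module.Finite K Λ] (M N : ModuleCat.{u} Λ) [Module.Finite Λ M]
    [Module.Finite Λ N] : Module.Finite K (M ⟶ N) := by
  obtain ⟨s, hs⟩ := Module.Finite.fg_top (R := Λ) (M := M)
  have : Module.Finite K N := Module.Finite.trans Λ N
  let ev : (M ⟶ N) →ₗ[K] (s → N) :=
    { toFun := fun f x => f.hom x
      map_add' := fun f g => rfl
      map_smul' := fun c f => by ext x; rfl }
  refine Module.Finite.of_injective ev fun f g hfg => ?_
  apply ModuleCat.hom_ext
  refine LinearMap.ext_on (s := (s : Set M)) hs fun x hx => ?_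
  exact congrFun hfg ⟨x, hx⟩

/-- `K`-linear precomposition. -/
noncomputable def precomp (N : Type u) [AddCommGroup N] [Module Λ N] (f : A →ₗ[Λ] B) :
    (ModuleCat.of Λ B ⟶ ModuleCat.of Λ N) →ₗ[K] (ModuleCat.of Λ A ⟶ ModuleCat.of Λ N) :=
  Linear.leftComp K _ (ModuleCat.ofHom f)

/-- `K`-linear postcomposition. -/
noncomputable def postcomp (M : Type u) [AddCommGroup M] [Module Λ M] (f : A →ₗ[Λ] B) :
    (ModuleCat.of Λ M ⟶ ModuleCat.of Λ A) →ₗ[K] (ModuleCat.of Λ M ⟶ ModuleCat.of Λ B) :=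
  Linear.rightComp K _ (ModuleCat.ofHom f)

theorem precomp_apply (f : A →ₗ[Λ] B) (h : ModuleCat.of Λ B ⟶ ModuleCat.of Λ N) :
    (precomp K N f h).hom = h.hom ∘ₗ f := rfl

theorem postcomp_apply (f : A →ₗ[Λ] B) (h : ModuleCat.of Λ M ⟶ ModuleCat.of Λ A) :
    (postcomp K M f h).hom = f ∘ₗ h.hom := rfl

theorem homDim_congr_left (e : A ≃ₗ[Λ] B) : homDim K Λ A N = homDim K Λ B N := by
  refine LinearEquiv.finrank_eq (LinearEquiv.ofLinearMap (precomp K N e.symm.toLinearMap)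
    (precomp K N e.toLinearMap) ?_ ?_) <;>
  · ext f : 1
    apply ModuleCat.hom_ext
    ext x
    simp [precomp_apply]

theorem homDim_congr_right (e : A ≃ₗ[Λ] B) : homDim K Λ M A = homDim K Λ M B := by
  refine LinearEquiv.finrank_eq (LinearEquiv.ofLinearMap (postcomp K M e.toLinearMap)
    (postcomp K M e.symm.toLinearMap) ?_ ?_) <;>
  · ext f : 1
    apply ModuleCat.hom_ext
    ext x
    simp [postcomp_apply]

theorem homDim_eq_zero_of_forall (h : ∀ f : M →ₗ[Λ] N, f = 0) : homDim K Λ M N = 0 := by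
  have : Subsingleton (ModuleCat.of Λ M ⟶ ModuleCat.of Λ N) :=
    ⟨fun f g => ModuleCat.hom_ext ((h f.hom).trans (h g.hom).symm)⟩
  exact Module.finrank_zero_of_subsingleton

variable [Module.Finite K Λ] [Module.Finite Λ A] [Module.Finite Λ B] [Module.Finite Λ C]
  [Module.Finite Λ M] [Module.Finite Λ N]

instance finite_hom_of : Module.Finite K (ModuleCat.of Λ M ⟶ ModuleCat.of Λ N) :=
  finite_hom K _ _

theorem homDim_eq_zero_iff : homDim K Λ M N = 0 ↔ ∀ f : M →ₗ[Λ] N, f = 0 := by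
  refine ⟨fun h f => ?_, homDim_eq_zero_of_forall K⟩
  have := Module.finrank_zero_iff.1 h
  exact congrArg ModuleCat.Hom.hom
    (Subsingleton.elim (ModuleCat.ofHom f : ModuleCat.of Λ M ⟶ ModuleCat.of Λ N) 0)

theorem homDim_pos_iff : 0 < homDim K Λ M N ↔ ∃ f : M →ₗ[Λ] N, f ≠ 0 := by
  rw [Nat.pos_iff_ne_zero, Ne, homDim_eq_zero_iff]; push Not; rfl

variable {i : A →ₗ[Λ] B} {q : B →ₗ[Λ] C}

theorem IsSES.homDim_left (h : IsSES i q) :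
    homDim K Λ B N = homDim K Λ C N + Module.finrank K (LinearMap.range (precomp K N i)) := by
  have h1 := LinearMap.finrank_range_add_finrank_ker (precomp K N i)
  have h2 : LinearMap.ker (precomp K N i) = LinearMap.range (precomp K N q) := by
    ext f
    constructor
    · intro hf
      obtain ⟨f', hf'⟩ := h.exists_desc f.hom (congrArg ModuleCat.Hom.hom hf)
      exact ⟨ModuleCat.ofHom f', ModuleCat.hom_ext hf'⟩
    · rintro ⟨f', rfl⟩
      apply ModuleCat.hom_ext
      ext a
      change f'.hom (q (i a)) = 0
      rw [(h.exact _).2 ⟨a, rfl⟩, map_zero]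
  have h3 : Function.Injective (precomp K N q) := by
    intro f g hfg
    apply ModuleCat.hom_ext
    ext c
    obtain ⟨b, rfl⟩ := h.surj c
    exact LinearMap.congr_fun (congrArg ModuleCat.Hom.hom hfg) b
  rw [h2, LinearMap.finrank_range_of_inj h3] at h1
  unfold homDim
  omega

theorem IsSES.homDim_left_le (h : IsSES i q) :
    homDim K Λ B N ≤ homDim K Λ C N + homDim K Λ A N := by
  rw [h.homDim_left K (N := N)]
  exact Nat.add_le_add_left (Submodule.finrank_le _) _

/-- The defect of additivity is the codimension of the image of restriction along `i`. For
projective `B` this turns Ext¹ into a number. -/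
theorem IsSES.homDim_left_eq_iff (h : IsSES i q) :
    homDim K Λ B N = homDim K Λ C N + homDim K Λ A N ↔
      ∀ f : A →ₗ[Λ] N, ∃ f' : B →ₗ[Λ] N, f' ∘ₗ i = f := by
  rw [h.homDim_left K (N := N)]
  constructor
  · intro he f
    have h1 : LinearMap.range (precomp K N i) = ⊤ :=
      Submodule.eq_top_of_finrank_eq (by unfold homDim at he; omega)
    obtain ⟨g, hg⟩ := LinearMap.range_eq_top.1 h1 (ModuleCat.ofHom f)
    exact ⟨g.hom, congrArg ModuleCat.Hom.hom hg⟩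
  · intro H
    have h1 : LinearMap.range (precomp K N i) = ⊤ := by
      refine LinearMap.range_eq_top.2 fun f => ?_
      obtain ⟨g, hg⟩ := H f.hom
      exact ⟨ModuleCat.ofHom g, ModuleCat.hom_ext hg⟩
    rw [h1, finrank_top]; rfl

theorem IsSES.homDim_right (h : IsSES i q) (hM : ExtZ Λ M A) :
    homDim K Λ M B = homDim K Λ M A + homDim K Λ M C := by
  have h1 := LinearMap.finrank_range_add_finrank_ker (postcomp K M q)
  have h2 : LinearMap.ker (postcomp K M q) = LinearMap.range (postcomp K M i) := by
    ext f
    constructor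
    · intro hf
      obtain ⟨f', hf'⟩ := h.exists_lift f.hom (congrArg ModuleCat.Hom.hom hf)
      exact ⟨ModuleCat.ofHom f', ModuleCat.hom_ext hf'⟩
    · rintro ⟨f', rfl⟩
      apply ModuleCat.hom_ext
      ext a
      exact (h.exact _).2 ⟨_, rfl⟩
  have h3 : Function.Injective (postcomp K M i) := by
    intro f g hfg
    apply ModuleCat.hom_ext
    ext c
    exact h.inj (LinearMap.congr_fun (congrArg ModuleCat.Hom.hom hfg) c)
  have h4 : LinearMap.range (postcomp K M q) = ⊤ := by
    refine LinearMap.range_eq_top.2 fun f => ?_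
    obtain ⟨g, hg⟩ := hM.exists_lift h f.hom
    exact ⟨ModuleCat.ofHom g, ModuleCat.hom_ext hg⟩
  rw [h2, LinearMap.finrank_range_of_inj h3, h4, finrank_top] at h1
  unfold homDim
  omega

theorem homDim_pi {ι : Type} [Fintype ι] [DecidableEq ι] (Y : ι → Type u) [∀ j, AddCommGroup (Y j)] [∀ j, Module Λ (Y j)]
    [∀ j, Module.Finite Λ (Y j)] :
    homDim K Λ (∀ j, Y j) N = ∑ j, homDim K Λ (Y j) N := by
  let F : (ModuleCat.of Λ (∀ j, Y j) ⟶ ModuleCat.of Λ N) ≃ₗ[K]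
      (∀ j, (ModuleCat.of Λ (Y j) ⟶ ModuleCat.of Λ N)) :=
    { toFun := fun f j => precomp K N (LinearMap.single Λ Y j) f
      map_add' := fun f g => by ext1 j; exact map_add _ _ _
      map_smul' := fun c f => by ext1 j; exact map_smul (precomp K N _) _ _
      invFun := fun f => ModuleCat.ofHom (LinearMap.lsum Λ Y ℕ fun j => (f j).hom)
      left_inv := fun f => by
        apply ModuleCat.hom_ext
        apply LinearMap.pi_ext'
        intro j
        exact LinearMap.ext fun x => LinearMap.lsum_piSingle Λ Y ℕ _ j x
      right_inv := fun f => by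
        ext1 j
        apply ModuleCat.hom_ext
        exact LinearMap.ext fun x => LinearMap.lsum_piSingle Λ Y ℕ _ j x }
  unfold homDim
  rw [F.finrank_eq, Module.finrank_pi_fintype]

/-- The map `x ↦ (c₁ x, …, c_r x)` for scalars `c_j`. -/
def diagMap (Λ : Type u) [Ring Λ] [Algebra K Λ] (M : Type u) [AddCommGroup M] [Module Λ M]
    {r : ℕ} (c : Fin r → K) : M →ₗ[Λ] (Fin r → M) where
  toFun x j := algebraMap K Λ (c j) • x
  map_add' x y := by ext j; exact smul_add _ _ _
  map_smul' a x := by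
    ext j
    change algebraMap K Λ (c j) • a • x = a • algebraMap K Λ (c j) • x
    rw [smul_smul, smul_smul, Algebra.commutes]

/-- Maps `M → N` are `K`-linear combinations of finitely many. -/
theorem exists_right_approx (M N : Type u) [AddCommGroup M] [Module Λ M] [AddCommGroup N]
    [Module Λ N] [Module.Finite Λ M] [Module.Finite Λ N] :
    ∃ (r : ℕ) (p : (Fin r → M) →ₗ[Λ] N), ∀ f : M →ₗ[Λ] N, ∃ c : Fin r → K,
      p ∘ₗ diagMap K Λ M c = f := by
  let b := Module.finBasis K (ModuleCat.of Λ M ⟶ ModuleCat.of Λ N)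
  refine ⟨_, LinearMap.lsum Λ _ ℕ fun j => (b j).hom, fun f => ?_⟩
  refine ⟨fun j => b.repr (ModuleCat.ofHom f) j, ?_⟩
  have h1 := b.sum_repr (ModuleCat.ofHom f)
  ext x
  have h2 := LinearMap.congr_fun (congrArg ModuleCat.Hom.hom h1) x
  rw [ModuleCat.hom_sum] at h2
  simp only [LinearMap.sum_apply] at h2
  change _ = f x at h2
  rw [← h2]
  simp only [LinearMap.comp_apply, LinearMap.lsum_apply, LinearMap.sum_apply, LinearMap.proj_apply]
  refine Finset.sum_congr rfl fun j _ => ?_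
  exact map_smul (b j).hom _ _

/-- Maps `M → N` factor through one map to a finite power of `N`. -/
theorem exists_left_approx (K : Type w) [Field K] [Algebra K Λ] [Module.Finite K Λ] (M N : Type u) [AddCommGroup M] [Module Λ M] [AddCommGroup N]
    [Module Λ N] [Module.Finite Λ M] [Module.Finite Λ N] :
    ∃ (r : ℕ) (p : M →ₗ[Λ] (Fin r → N)), ∀ f : M →ₗ[Λ] N, ∃ s : (Fin r → N) →ₗ[Λ] N,
      s ∘ₗ p = f := by
  let b := Module.finBasis K (ModuleCat.of Λ M ⟶ ModuleCat.of Λ N)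
  refine ⟨_, LinearMap.pi fun j => (b j).hom, fun f => ?_⟩
  refine ⟨LinearMap.lsum Λ _ ℕ fun j =>
    (b.repr (ModuleCat.ofHom f) j • 𝟙 (ModuleCat.of Λ N) : ModuleCat.of Λ N ⟶ _).hom, ?_⟩
  have h1 := b.sum_repr (ModuleCat.ofHom f)
  ext x
  have h2 := LinearMap.congr_fun (congrArg ModuleCat.Hom.hom h1) x
  rw [ModuleCat.hom_sum] at h2
  simp only [LinearMap.sum_apply] at h2
  change _ = f x at h2
  rw [← h2]
  simp only [LinearMap.comp_apply, LinearMap.lsum_apply, LinearMap.sum_apply, LinearMap.proj_apply,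
    LinearMap.pi_apply]
  refine Finset.sum_congr rfl fun j _ => ?_
  change (b j ≫ (b.repr (ModuleCat.ofHom f) j • 𝟙 (ModuleCat.of Λ N))).hom x = _
  rw [Linear.comp_smul, Category.comp_id]

end HomDim

end WallChamber

namespace WallChamber

universe w u

/-! ### Hereditary rings: submodules of projectives, and right exactness of Ext¹. -/

section HereditaryRing

variable {Λ : Type u} [Ring Λ]
variable {A B C M N X : Type u}
  [AddCommGroup A] [Module Λ A] [AddCommGroup B] [Module Λ B] [AddCommGroup C] [Module Λ C]
  [AddCommGroup M] [Module Λ M] [AddCommGroup N] [Module Λ N] [AddCommGroup X] [Module Λ X]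

/-- The decomposition given by a section of a short exact sequence. -/
noncomputable def IsSES.equivOfSection {i : A →ₗ[Λ] B} {q : B →ₗ[Λ] C} (h : IsSES i q)
    (s : C →ₗ[Λ] B) (hs : q ∘ₗ s = LinearMap.id) : (A × C) ≃ₗ[Λ] B :=
  LinearEquiv.ofBijective (i.coprod s) (by
    have hqs : ∀ c, q (s c) = c := LinearMap.congr_fun hs
    have hqi : ∀ a, q (i a) = 0 := fun a => (h.exact _).2 ⟨a, rfl⟩
    constructor
    · refine (injective_iff_map_eq_zero (i.coprod s)).2 fun x hx => ?_
      have hx' : i x.1 + s x.2 = 0 := hx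
      have h2 : x.2 = 0 := by
        have := congrArg q hx'
        rwa [map_add, hqi, hqs, zero_add, map_zero] at this
      have h1 : i x.1 = 0 := by rwa [h2, map_zero, add_zero] at hx'
      exact Prod.ext (h.inj (h1.trans (map_zero i).symm)) h2
    · intro b
      have : q (b - s (q b)) = 0 := by rw [map_sub, hqs, sub_self]
      obtain ⟨a, ha⟩ := (h.exact _).1 this
      exact ⟨(a, q b), by simp [ha]⟩)

/-- The first coordinate maps `N` onto a left ideal, which is projective. So `N` splits into this
ideal and a kernel that embeds in one copy fewer of `Λ`. -/
theorem IsHereditary.projective_of_injective_pi (hΛ : IsHereditary Λ) (m : ℕ) :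
    ∀ (N : Type u) [AddCommGroup N] [Module Λ N] (f : N →ₗ[Λ] (Fin m → Λ)),
      Function.Injective f → Module.Projective Λ N := by
  induction m with
  | zero =>
    intro N _ _ f hf
    have : Subsingleton N := hf.subsingleton
    infer_instance
  | succ m ih =>
    intro N _ _ f hf
    let φ : N →ₗ[Λ] Λ := LinearMap.proj 0 ∘ₗ f
    have hI : Module.Projective Λ (LinearMap.range φ) := hΛ _
    have hk : Module.Projective Λ (LinearMap.ker φ.rangeRestrict) := by
      refine ih _ (LinearMap.pi fun j => LinearMap.proj j.succ ∘ₗ f ∘ₗ Submodule.subtype _)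
        fun x y hxy => Subtype.ext (hf ?_)
      have h0 : ∀ z : LinearMap.ker φ.rangeRestrict, f z.1 0 = 0 := fun z =>
        congrArg Subtype.val z.2
      ext j
      refine Fin.cases ?_ (fun j => ?_) j
      · rw [h0, h0]
      · exact congrFun hxy j
    have hs := isSES_subtype_ker φ.surjective_rangeRestrict
    obtain ⟨s, hs'⟩ := (ExtZ.of_projective (Λ := Λ) (M := LinearMap.range φ)).exists_section hs
    exact Module.Projective.of_equiv (hs.equivOfSection s hs')

/-- Submodules of finitely generated projective modules are projective. -/
theorem IsHereditary.projective_of_injective (hΛ : IsHereditary Λ) [Module.Finite Λ M]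
    [Module.Projective Λ M] (f : N →ₗ[Λ] M) (hf : Function.Injective f) :
    Module.Projective Λ N := by
  obtain ⟨m, q, hq⟩ := Module.Finite.exists_fin' Λ M
  obtain ⟨s, hs⟩ := Module.projective_lifting_property q LinearMap.id hq
  refine hΛ.projective_of_injective_pi m N (s ∘ₗ f) ?_
  have hs' : ∀ x, q (s x) = x := LinearMap.congr_fun hs
  exact (Function.LeftInverse.injective hs').comp hf

theorem IsHereditary.projective_submodule (hΛ : IsHereditary Λ) [Module.Finite Λ M]
    [Module.Projective Λ M] (S : Submodule Λ M) : Module.Projective Λ S :=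
  hΛ.projective_of_injective S.subtype Subtype.val_injective

/-- The kernel of a free cover of `M` is projective, so maps from it to `X` lift to `N`, where they
extend. This is Ext² = 0. -/
theorem ExtZ.of_surjective_right (hΛ : IsHereditary Λ) [Module.Finite Λ M] (h : ExtZ Λ M N)
    (p : N →ₗ[Λ] X) (hp : Function.Surjective p) : ExtZ Λ M X := by
  obtain ⟨m, q, hq⟩ := Module.Finite.exists_fin' Λ M
  have hs := isSES_subtype_ker hq
  have := hΛ.projective_submodule (LinearMap.ker q)
  refine ExtZ.of_presentation hs fun f => ?_
  obtain ⟨g, hg⟩ := Module.projective_lifting_property p f hp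
  obtain ⟨g', hg'⟩ := h _ _ hs g
  exact ⟨p ∘ₗ g', by rw [LinearMap.comp_assoc, hg', hg]⟩

/-- Inside a free cover of `M`, the preimage of `X` is a projective cover of `X` in the weak sense,
with the same kernel. Extensions from the kernel to the whole free module restrict to it. -/
theorem ExtZ.of_injective_left (hΛ : IsHereditary Λ) [Module.Finite Λ M] (h : ExtZ Λ M N)
    (j : X →ₗ[Λ] M) (hj : Function.Injective j) : ExtZ Λ X N := by
  obtain ⟨m, q, hq⟩ := Module.Finite.exists_fin' Λ M
  have hs := isSES_subtype_ker hq
  have hs' := hs.comap (LinearMap.range j)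
  have := hΛ.projective_submodule ((LinearMap.range j).comap q)
  refine ExtZ.congr_left (LinearEquiv.ofInjective j hj).symm
    (ExtZ.of_presentation hs' fun f => ?_)
  obtain ⟨g, hg⟩ := h _ _ hs f
  exact ⟨g ∘ₗ Submodule.subtype _, by rw [← hg]; rfl⟩

/-- `Ext¹(M, -)` of a kernel vanishes if maps from `M` lift. -/
theorem ExtZ.of_lift {i : A →ₗ[Λ] B} {q : B →ₗ[Λ] C} (hs : IsSES i q) (hB : ExtZ Λ M B)
    (hl : ∀ f : M →ₗ[Λ] C, ∃ f' : M →ₗ[Λ] B, q ∘ₗ f' = f) : ExtZ Λ M A := by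
  intro A' B' _ _ _ _ i' q' h' f
  have hqi : q ∘ₗ i = 0 := LinearMap.ext fun a => (hs.exact _).2 ⟨a, rfl⟩
  have hqi' : q' ∘ₗ i' = 0 := LinearMap.ext fun a => (h'.exact _).2 ⟨a, rfl⟩
  obtain ⟨g, hg⟩ := hB _ _ h' (i ∘ₗ f)
  obtain ⟨d, hd⟩ := h'.exists_desc (q ∘ₗ g) (by
    rw [LinearMap.comp_assoc, hg, ← LinearMap.comp_assoc, hqi, LinearMap.zero_comp])
  obtain ⟨d', hd'⟩ := hl d
  obtain ⟨e, he⟩ := hs.exists_lift (g - d' ∘ₗ q') (by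
    rw [LinearMap.comp_sub, ← LinearMap.comp_assoc, hd', hd, sub_self])
  refine ⟨e, LinearMap.ext fun a => hs.inj ?_⟩
  have h1 : i (e (i' a)) = g (i' a) - d' (q' (i' a)) := LinearMap.congr_fun he _
  have h2 : q' (i' a) = 0 := LinearMap.congr_fun hqi' a
  rw [LinearMap.comp_apply, h1, h2, map_zero, sub_zero]
  exact LinearMap.congr_fun hg a

theorem ExtZ.pi_left {ι : Type} [Fintype ι] [DecidableEq ι] {Y : ι → Type u} [∀ j, AddCommGroup (Y j)]
    [∀ j, Module Λ (Y j)] [∀ j, Module.Finite Λ (Y j)] (h : ∀ j, ExtZ Λ (Y j) X) :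
    ExtZ Λ (∀ j, Y j) X := by
  choose m q hq using fun j => Module.Finite.exists_fin' Λ (Y j)
  let F : (∀ j, Fin (m j) → Λ) →ₗ[Λ] (∀ j, Y j) := LinearMap.pi fun j => q j ∘ₗ LinearMap.proj j
  have hF : Function.Surjective F := fun y => by
    choose x hx using fun j => hq j (y j)
    exact ⟨x, funext hx⟩
  let G : (∀ j, LinearMap.ker (q j)) →ₗ[Λ] (∀ j, Fin (m j) → Λ) :=
    LinearMap.pi fun j => Submodule.subtype _ ∘ₗ LinearMap.proj j
  have hs : IsSES G F := by
    refine ⟨fun x y hxy => funext fun j => Subtype.ext (congrFun hxy j), fun y => ⟨fun hy => ?_, ?_⟩,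
      hF⟩
    · exact ⟨fun j => ⟨y j, congrFun hy j⟩, rfl⟩
    · rintro ⟨x, rfl⟩
      exact funext fun j => (x j).2
  refine ExtZ.of_presentation hs fun f => ?_
  choose g hg using fun j => h j _ _ (isSES_subtype_ker (hq j)) 
    (f ∘ₗ LinearMap.single Λ (fun j => LinearMap.ker (q j)) j)
  refine ⟨LinearMap.lsum Λ _ ℕ g, LinearMap.pi_ext' fun j => LinearMap.ext fun x => ?_⟩
  have h1 : G (LinearMap.single Λ _ j x) =
      (Pi.single j x.1 : ∀ j, Fin (m j) → Λ) := by
    ext1 k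
    by_cases hk : k = j
    · subst hk; simp [G]
    · simp [G, hk]
  rw [LinearMap.comp_apply, LinearMap.comp_apply, h1, LinearMap.lsum_piSingle]
  exact LinearMap.congr_fun (hg j) x

end HereditaryRing

/-! ### The Euler form. -/

section EulerForm

variable (K : Type w) [Field K] {Λ : Type u} [Ring Λ] [Algebra K Λ]
variable {A B C A' B' M N X : Type u}
  [AddCommGroup A] [Module Λ A] [AddCommGroup B] [Module Λ B] [AddCommGroup C] [Module Λ C]
  [AddCommGroup A'] [Module Λ A'] [AddCommGroup B'] [Module Λ B']
  [AddCommGroup M] [Module Λ M] [AddCommGroup N] [Module Λ N] [AddCommGroup X] [Module Λ X]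
variable [Module.Finite K Λ] [Module.Finite Λ A] [Module.Finite Λ B] [Module.Finite Λ C]
  [Module.Finite Λ A'] [Module.Finite Λ B']
  [Module.Finite Λ M] [Module.Finite Λ N] [Module.Finite Λ X]

/-- The Euler form `dim Hom(M, N) - dim Ext¹(M, N)`, computed from a projective presentation
of `M`. -/
noncomputable def eulerForm (Λ : Type u) [Ring Λ] [Algebra K Λ] (M N : Type u) [AddCommGroup M]
    [Module Λ M] [AddCommGroup N] [Module Λ N] [Module.Finite Λ M] : ℤ :=
  (homDim K Λ (Fin (Module.Finite.exists_fin' Λ M).choose → Λ) N : ℤ) -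
    homDim K Λ (LinearMap.ker (Module.Finite.exists_fin' Λ M).choose_spec.choose) N

variable [IsNoetherianRing Λ]

/-- Schanuel's argument: the fibre product of the two covers is an extension of `B` by `A'` and of
`B'` by `A`. Since `B` and `B'` are projective, Hom into `N` is additive on both. Thus the Euler
form does not depend on the presentation. -/
theorem homDim_schanuel {i : A →ₗ[Λ] B} {q : B →ₗ[Λ] M} (h : IsSES i q)
    {i' : A' →ₗ[Λ] B'} {q' : B' →ₗ[Λ] M} (h' : IsSES i' q')
    [Module.Projective Λ B] [Module.Projective Λ B'] :
    homDim K Λ B N + homDim K Λ A' N = homDim K Λ B' N + homDim K Λ A N := by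
  let L : Submodule Λ (B × B') := LinearMap.eqLocus (q ∘ₗ LinearMap.fst Λ B B')
    (q' ∘ₗ LinearMap.snd Λ B B')
  have hL : ∀ x : L, q x.1.1 = q' x.1.2 := fun x => x.2
  let j : A' →ₗ[Λ] L := (LinearMap.inr Λ B B' ∘ₗ i').codRestrict L fun a => by
    change q 0 = q' (i' a)
    rw [map_zero, (h'.exact _).2 ⟨a, rfl⟩]
  let j' : A →ₗ[Λ] L := (LinearMap.inl Λ B B' ∘ₗ i).codRestrict L fun a => by
    change q (i a) = q' 0
    rw [map_zero, (h.exact _).2 ⟨a, rfl⟩]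
  have h1 : IsSES j (LinearMap.fst Λ B B' ∘ₗ L.subtype) := by
    refine ⟨fun x y hxy => h'.inj (congrArg (fun z : L => z.1.2) hxy), fun y => ⟨fun hy => ?_, ?_⟩,
      fun m => ?_⟩
    · have hy' : y.1.1 = 0 := hy
      obtain ⟨a, ha⟩ := (h'.exact y.1.2).1 (by rw [← hL, hy', map_zero])
      exact ⟨a, Subtype.ext (Prod.ext hy'.symm ha)⟩
    · rintro ⟨a, rfl⟩; rfl
    · obtain ⟨b, hb⟩ := h'.surj (q m)
      exact ⟨⟨(m, b), hb.symm⟩, rfl⟩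
  have h2 : IsSES j' (LinearMap.snd Λ B B' ∘ₗ L.subtype) := by
    refine ⟨fun x y hxy => h.inj (congrArg (fun z : L => z.1.1) hxy), fun y => ⟨fun hy => ?_, ?_⟩,
      fun m => ?_⟩
    · have hy' : y.1.2 = 0 := hy
      obtain ⟨a, ha⟩ := (h.exact y.1.1).1 (by rw [hL, hy', map_zero])
      exact ⟨a, Subtype.ext (Prod.ext ha hy'.symm)⟩
    · rintro ⟨a, rfl⟩; rfl
    · obtain ⟨b, hb⟩ := h.surj (q' m)
      exact ⟨⟨(b, m), hb⟩, rfl⟩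
  have e1 := (h1.homDim_left_eq_iff K (N := N)).2 (ExtZ.of_projective _ _ h1)
  have e2 := (h2.homDim_left_eq_iff K (N := N)).2 (ExtZ.of_projective _ _ h2)
  omega

theorem IsSES.eulerForm_eq {i : A →ₗ[Λ] B} {q : B →ₗ[Λ] M} (h : IsSES i q)
    [Module.Projective Λ B] :
    eulerForm K Λ M N = (homDim K Λ B N : ℤ) - homDim K Λ A N := by
  have h' := isSES_subtype_ker (Module.Finite.exists_fin' Λ M).choose_spec.choose_spec
  have := homDim_schanuel K (N := N) h h'
  unfold eulerForm
  omega

theorem eulerForm_le : eulerForm K Λ M N ≤ homDim K Λ M N := by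
  obtain ⟨m, q, hq⟩ := Module.Finite.exists_fin' Λ M
  have h := isSES_subtype_ker hq
  rw [h.eulerForm_eq K]
  have := h.homDim_left_le K (N := N)
  omega

theorem eulerForm_eq_homDim_iff : eulerForm K Λ M N = homDim K Λ M N ↔ ExtZ Λ M N := by
  obtain ⟨m, q, hq⟩ := Module.Finite.exists_fin' Λ M
  have h := isSES_subtype_ker hq
  have h2 := h.homDim_left_eq_iff K (N := N)
  rw [h.eulerForm_eq K]
  constructor
  · intro he
    exact ExtZ.of_presentation h (h2.1 (by omega))
  · intro he
    have := h2.2 (he _ _ h)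
    omega

theorem eulerForm_of_projective [Module.Projective Λ M] :
    eulerForm K Λ M N = homDim K Λ M N :=
  (eulerForm_eq_homDim_iff K).2 ExtZ.of_projective

/-- A free cover of `B` also covers `C`. The kernel of the latter cover is the preimage of `A`,
which is projective and covers `A`. The three presentations telescope. -/
theorem IsSES.eulerForm_add (hΛ : IsHereditary Λ) {i : A →ₗ[Λ] B} {q : B →ₗ[Λ] C}
    (h : IsSES i q) : eulerForm K Λ B N = eulerForm K Λ A N + eulerForm K Λ C N := by
  obtain ⟨m, p, hp⟩ := Module.Finite.exists_fin' Λ B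
  have h1 := isSES_subtype_ker hp
  have h2 := h1.comap (LinearMap.range i)
  have h3 : IsSES ((LinearMap.range i).comap p).subtype (q ∘ₗ p) := by
    refine ⟨Subtype.val_injective, fun y => ?_, h.surj.comp hp⟩
    simp [h.exact (p y)]
  have := hΛ.projective_submodule ((LinearMap.range i).comap p)
  have h4 : IsSES ((LinearMap.ker p).subtype.codRestrict ((LinearMap.range i).comap p) fun a => by
        simp) ((LinearEquiv.ofInjective i h.inj).symm.toLinearMap ∘ₗ
      (p.comp ((LinearMap.range i).comap p).subtype).codRestrict (LinearMap.range i)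
        fun x => x.2) :=
    ⟨h2.inj, fun y => by rw [← h2.exact y]; simp,
      (LinearEquiv.ofInjective i h.inj).symm.surjective.comp h2.surj⟩
  rw [h1.eulerForm_eq K, h3.eulerForm_eq K, h4.eulerForm_eq K]
  ring

theorem eulerForm_congr (e : A ≃ₗ[Λ] B) : eulerForm K Λ A N = eulerForm K Λ B N := by
  obtain ⟨m, p, hp⟩ := Module.Finite.exists_fin' Λ A
  have h1 := isSES_subtype_ker hp
  have h2 : IsSES (LinearMap.ker p).subtype (e.toLinearMap ∘ₗ p) :=
    ⟨h1.inj, fun y => by rw [← h1.exact y]; simp, e.surjective.comp hp⟩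
  rw [h1.eulerForm_eq K, h2.eulerForm_eq K]

end EulerForm

end WallChamber

namespace WallChamber

universe w u

/-! ### Indecomposable modules, Fitting's lemma and the Happel-Ringel lemma. -/

section Indecomposable

variable {Λ : Type u} [Ring Λ]
variable {A B M N X Y : Type u}
  [AddCommGroup A] [Module Λ A] [AddCommGroup B] [Module Λ B]
  [AddCommGroup M] [Module Λ M] [AddCommGroup N] [Module Λ N] [AddCommGroup X] [Module Λ X]
  [AddCommGroup Y] [Module Λ Y]

/-- A nonzero module without nontrivial idempotent endomorphisms. -/
def IsIndec (Λ : Type u) [Ring Λ] (M : Type u) [AddCommGroup M] [Module Λ M] : Prop :=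
  Nontrivial M ∧ ∀ e : M →ₗ[Λ] M, e ∘ₗ e = e → e = 0 ∨ e = LinearMap.id

theorem isZero_iff_subsingleton (M : ModuleCat.{u} Λ) : Limits.IsZero M ↔ Subsingleton M :=
  ⟨fun h => ModuleCat.subsingleton_of_isZero h, fun _ => ModuleCat.isZero_of_subsingleton M⟩

/-- An idempotent splits the module into its range and its kernel, and a biproduct decomposition
gives back the projection to one summand. -/
theorem indecomposable_iff (M : ModuleCat.{u} Λ) : Indecomposable M ↔ IsIndec Λ M := by
  constructor
  · rintro ⟨h1, h2⟩
    refine ⟨not_subsingleton_iff_nontrivial.1 fun h => h1 ((isZero_iff_subsingleton M).2 h),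
      fun e he => ?_⟩
    have hc : IsCompl (LinearMap.range e) (LinearMap.ker e) :=
      LinearMap.IsIdempotentElem.isCompl (f := e) he
    have iso : M ≅ ModuleCat.of Λ (LinearMap.range e) ⊞ ModuleCat.of Λ (LinearMap.ker e) :=
      (Submodule.prodEquivOfIsCompl _ _ hc).symm.toModuleIso ≪≫
        (ModuleCat.biprodIsoProd (ModuleCat.of Λ (LinearMap.range e))
          (ModuleCat.of Λ (LinearMap.ker e))).symm
    rcases h2 _ _ iso with h | h
    · left
      have : Subsingleton (LinearMap.range e) := (isZero_iff_subsingleton _).1 h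
      exact LinearMap.range_eq_bot.1 ((Submodule.subsingleton_iff_eq_bot).1 this)
    · right
      have : Subsingleton (LinearMap.ker e) := (isZero_iff_subsingleton _).1 h
      have hk := LinearMap.ker_eq_bot.1 ((Submodule.subsingleton_iff_eq_bot).1 this)
      ext x
      exact hk (LinearMap.congr_fun he x)
  · rintro ⟨h1, h2⟩
    refine ⟨fun h => not_subsingleton_iff_nontrivial.2 h1 ((isZero_iff_subsingleton M).1 h),
      fun Y Z iso => ?_⟩
    let L : M ≃ₗ[Λ] (Y × Z) := (iso ≪≫ ModuleCat.biprodIsoProd Y Z).toLinearEquiv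
    let e : M →ₗ[Λ] M := L.symm.toLinearMap ∘ₗ LinearMap.inl Λ Y Z ∘ₗ LinearMap.fst Λ Y Z ∘ₗ
      L.toLinearMap
    have he : e ∘ₗ e = e := by ext x; simp [e]
    rcases h2 e he with h | h
    · left
      rw [isZero_iff_subsingleton]
      refine ⟨fun y y' => ?_⟩
      have h3 : ∀ y : Y, y = 0 := fun y => by
        have := LinearMap.congr_fun h (L.symm (y, 0))
        simp only [e, LinearMap.comp_apply, LinearEquiv.coe_coe, LinearEquiv.apply_symm_apply,
          LinearMap.fst_apply, LinearMap.inl_apply, LinearMap.zero_apply,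
          LinearEquiv.map_eq_zero_iff] at this
        exact congrArg Prod.fst this
      rw [h3 y, h3 y']
    · right
      rw [isZero_iff_subsingleton]
      refine ⟨fun y y' => ?_⟩
      have h3 : ∀ y : Z, y = 0 := fun y => by
        have := LinearMap.congr_fun h (L.symm (0, y))
        simp only [e, LinearMap.comp_apply, LinearEquiv.coe_coe, LinearEquiv.apply_symm_apply,
          LinearMap.fst_apply, LinearMap.inl_apply, LinearMap.id_apply,
          EmbeddingLike.apply_eq_iff_eq] at this
        exact (congrArg Prod.snd this).symm
      rw [h3 y, h3 y']

theorem IsIndec.congr (e : M ≃ₗ[Λ] N) (h : IsIndec Λ M) : IsIndec Λ N := by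
  have := h.1
  refine ⟨e.toEquiv.symm.nontrivial, fun f hf => ?_⟩
  rcases h.2 (e.symm.toLinearMap ∘ₗ f ∘ₗ e.toLinearMap) (by
    ext x
    have := LinearMap.congr_fun hf (e x)
    simpa using this) with h' | h'
  · left
    ext x
    have := LinearMap.congr_fun h' (e.symm x)
    simpa using this
  · right
    ext x
    have := congrArg e (LinearMap.congr_fun h' (e.symm x))
    simpa using this

/-- A nonzero retract of an indecomposable module is the whole module. -/
theorem IsIndec.bijective_of_retract (h : IsIndec Λ X) [Nontrivial Y] {s : Y →ₗ[Λ] X}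
    {r : X →ₗ[Λ] Y} (hrs : r ∘ₗ s = LinearMap.id) : Function.Bijective s := by
  have hrs' : ∀ y, r (s y) = y := LinearMap.congr_fun hrs
  refine ⟨Function.LeftInverse.injective hrs', ?_⟩
  rcases h.2 (s ∘ₗ r) (by ext x; simp [hrs']) with h0 | h1
  · obtain ⟨y, hy⟩ := exists_ne (0 : Y)
    refine absurd ?_ hy
    have := congrArg r (LinearMap.congr_fun h0 (s y))
    simpa [hrs'] using this
  · exact fun x => ⟨r x, LinearMap.congr_fun h1 x⟩

theorem IsIndec.eq_bot_or_eq_bot (h : IsIndec Λ X) {S T : Submodule Λ X} (hST : IsCompl S T) :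
    S = ⊥ ∨ T = ⊥ := by
  refine or_iff_not_imp_left.2 fun hS => ?_
  have : Nontrivial S := Submodule.nontrivial_iff_ne_bot.2 hS
  have hb := h.bijective_of_retract (s := S.subtype)
    (r := LinearMap.fst Λ S T ∘ₗ (Submodule.prodEquivOfIsCompl S T hST).symm.toLinearMap)
    (by ext x; simp)
  have hS' : S = ⊤ := by
    rw [← S.range_subtype, LinearMap.range_eq_top]
    exact hb.2
  rw [hS'] at hST
  exact eq_bot_of_top_isCompl hST

/-- Fitting's lemma: the kernel and the range of a high power of `f` are complementary. -/
theorem IsIndec.bijective_or_isNilpotent [IsArtinian Λ X] [IsNoetherian Λ X] (h : IsIndec Λ X)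
    (f : Module.End Λ X) : Function.Bijective f ∨ IsNilpotent f := by
  obtain ⟨k, hk⟩ := Filter.eventually_atTop.1
    (LinearMap.eventually_isCompl_ker_pow_range_pow f)
  -- The exponent is `k + 1` because a positive power is needed to pass injectivity down to `f`.
  rcases h.eq_bot_or_eq_bot (hk (k + 1) (Nat.le_succ k)) with h1 | h1
  · left
    refine IsArtinian.bijective_of_injective_endomorphism f fun x y hxy => ?_
    refine LinearMap.ker_eq_bot.1 h1 ?_
    rw [pow_succ]
    exact congrArg (f ^ k) hxy
  · exact Or.inr ⟨k + 1, LinearMap.range_eq_bot.1 h1⟩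

theorem IsIndec.bijective_or_of_add_eq_one [IsArtinian Λ X] [IsNoetherian Λ X]
    (h : IsIndec Λ X) {a b : Module.End Λ X} (hab : a + b = 1) :
    Function.Bijective a ∨ Function.Bijective b := by
  rcases h.bijective_or_isNilpotent a with ha | ha
  · exact Or.inl ha
  · right
    have := ha.isUnit_one_sub
    rw [← hab, add_sub_cancel_left] at this
    exact (Module.End.isUnit_iff _).1 this

theorem IsBrick.isIndec {X : ModuleCat.{u} Λ} (h : IsBrick X) : IsIndec Λ X := by
  refine ⟨h.1, fun e he => or_iff_not_imp_left.2 fun h0 => ?_⟩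
  ext x
  exact (h.2 e h0).1 (LinearMap.congr_fun he x)

variable [IsNoetherianRing Λ] [IsArtinianRing Λ]

/-- A nonzero map `X → Y` of indecomposable modules with `Ext¹(Y, X) = 0` is injective or
surjective. -/
theorem IsIndec.injective_or_surjective (hΛ : IsHereditary Λ) [Module.Finite Λ X]
    [Module.Finite Λ Y] (hX : IsIndec Λ X) (hY : IsIndec Λ Y) (hYX : ExtZ Λ Y X)
    (f : X →ₗ[Λ] Y) (hf : f ≠ 0) : Function.Injective f ∨ Function.Surjective f := by
  obtain ⟨m, q, hq⟩ := Module.Finite.exists_fin' Λ Y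
  have h := isSES_subtype_ker hq
  -- The cover of the image of `f` by the projective `Q'` lifts to `u : Q' → X`. As Ext¹(Y, X) = 0,
  -- the restriction of `u` to the kernel of `q` extends to `b` on the free module. The difference
  -- of `u` and `b` descends to `r : im f → X`.
  let Q' := (LinearMap.range f).comap q
  have : Module.Projective Λ Q' := hΛ.projective_submodule Q'
  let q' : Q' →ₗ[Λ] LinearMap.range f := (q ∘ₗ Q'.subtype).codRestrict _ fun x => x.2
  obtain ⟨u, hu⟩ := Module.projective_lifting_property f.rangeRestrict q'
    f.surjective_rangeRestrict
  have hu' : ∀ x, f (u x) = q x.1 := fun x => congrArg Subtype.val (LinearMap.congr_fun hu x)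
  have h' := h.comap (LinearMap.range f)
  obtain ⟨b, hb⟩ := hYX _ _ h (u ∘ₗ (LinearMap.ker q).subtype.codRestrict Q' fun a => by
    change q a ∈ LinearMap.range f
    rw [a.2]; exact zero_mem _)
  obtain ⟨r, hr⟩ := h'.exists_desc (u - b ∘ₗ Q'.subtype) (by
    ext a
    have := LinearMap.congr_fun hb a
    simp only [LinearMap.comp_apply, LinearMap.sub_apply, LinearMap.zero_apply] at this ⊢
    rw [sub_eq_zero]
    exact this.symm)
  have hr' : ∀ x : Q', r (q' x) = u x - b x.1 := LinearMap.congr_fun hr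
  -- In the local ring End(X), either `1 - r ∘ f` or `r ∘ f` is invertible. In the second case `f`
  -- is injective. In the first, `f ∘ a⁻¹ ∘ b` descends to an idempotent `ρ` of `Y` with image in
  -- `im f` that fixes `im f`. As `f ≠ 0` and `Y` is indecomposable, `ρ` is the identity and `f` is
  -- surjective.
  rcases hX.bijective_or_of_add_eq_one (a := LinearMap.id - r ∘ₗ f.rangeRestrict)
    (b := r ∘ₗ f.rangeRestrict) (sub_add_cancel _ _) with ha | ha
  · right
    let a := LinearEquiv.ofBijective _ ha
    have haa : ∀ x, a x = x - r (f.rangeRestrict x) := fun x => rfl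
    have hb' : ∀ x : Q', f (a.symm (b x.1)) = q x.1 := fun x => by
      have h1 : a (u x) = b x.1 := by
        have : f.rangeRestrict (u x) = q' x := LinearMap.congr_fun hu x
        rw [haa, this, hr' x]; abel
      rw [← h1, LinearEquiv.symm_apply_apply, hu']
    obtain ⟨ρ, hρ⟩ := h.exists_desc (f ∘ₗ a.symm.toLinearMap ∘ₗ b) (by
      ext x
      have hx : q x.1 = 0 := x.2
      have hx' : x.1 ∈ Q' := by
        change q x.1 ∈ LinearMap.range f
        rw [hx]; exact zero_mem _
      exact (hb' ⟨x.1, hx'⟩).trans hx)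
    have hρq : ∀ t, ρ (q t) = f (a.symm (b t)) := LinearMap.congr_fun hρ
    have hρf : ∀ x, ρ (f x) = f x := fun x => by
      obtain ⟨t, ht⟩ := hq (f x)
      have ht' : t ∈ Q' := by
        change q t ∈ LinearMap.range f
        rw [ht]; exact ⟨x, rfl⟩
      rw [← ht, hρq]
      exact hb' ⟨t, ht'⟩
    rcases hY.2 ρ (by
      ext y
      obtain ⟨t, rfl⟩ := hq y
      rw [LinearMap.comp_apply, hρq, hρf]) with h0 | h1
    · exfalso
      apply hf
      ext x
      rw [← hρf, h0]; rfl
    · intro y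
      obtain ⟨t, rfl⟩ := hq y
      exact ⟨_, (hρq t).symm.trans (LinearMap.congr_fun h1 (q t))⟩
  · left
    intro x y hxy
    apply ha.1
    have : f.rangeRestrict x = f.rangeRestrict y := Subtype.ext hxy
    rw [LinearMap.comp_apply, LinearMap.comp_apply, this]

theorem IsIndec.isBrick (hΛ : IsHereditary Λ) [Module.Finite Λ X] (hX : IsIndec Λ X)
    (h : ExtZ Λ X X) : IsBrick (ModuleCat.of Λ X) := by
  refine ⟨hX.1, fun f hf => ?_⟩
  rcases hX.injective_or_surjective hΛ hX h f hf with h1 | h1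
  · exact IsArtinian.bijective_of_injective_endomorphism f h1
  · exact IsNoetherian.bijective_of_surjective_endomorphism f h1

end Indecomposable

/-! ### The dimension of Hom(Λ, M) as a measure of size, and induction on it. -/

section Size

variable (K : Type w) [Field K] {Λ : Type u} [Ring Λ] [Algebra K Λ] [Module.Finite K Λ]
variable {A B C M N : Type u}
  [AddCommGroup A] [Module Λ A] [AddCommGroup B] [Module Λ B] [AddCommGroup C] [Module Λ C]
  [AddCommGroup M] [Module Λ M] [AddCommGroup N] [Module Λ N]
  [Module.Finite Λ A] [Module.Finite Λ B] [Module.Finite Λ C]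
  [Module.Finite Λ M] [Module.Finite Λ N]

theorem homDim_self_pos [Nontrivial M] : 0 < homDim K Λ Λ M := by
  rw [homDim_pos_iff]
  obtain ⟨x, hx⟩ := exists_ne (0 : M)
  exact ⟨LinearMap.toSpanSingleton Λ M x, fun h => hx (by
    simpa using LinearMap.congr_fun h 1)⟩

theorem homDim_self_submodule_lt [IsNoetherianRing Λ] {S : Submodule Λ M} (hS : S ≠ ⊤) :
    homDim K Λ Λ S < homDim K Λ Λ M := by
  have := (isSES_subtype_mkQ S).homDim_right K (M := Λ) ExtZ.of_projective
  have : Nontrivial (M ⧸ S) := Submodule.Quotient.nontrivial_iff.2 hS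
  have := homDim_self_pos K (Λ := Λ) (M := M ⧸ S)
  omega

theorem bijective_of_injective_of_homDim_le [IsNoetherianRing Λ] (f : M →ₗ[Λ] N) (hf : Function.Injective f)
    (h : homDim K Λ Λ N ≤ homDim K Λ Λ M) : Function.Bijective f := by
  refine ⟨hf, LinearMap.range_eq_top.1 ?_⟩
  by_contra hr
  have h1 := homDim_self_submodule_lt K hr
  have h2 := homDim_congr_right K (M := Λ) (LinearEquiv.ofInjective f hf)
  omega

theorem bijective_of_surjective_of_homDim_le [IsNoetherianRing Λ] (f : M →ₗ[Λ] N) (hf : Function.Surjective f)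
    (h : homDim K Λ Λ M ≤ homDim K Λ Λ N) : Function.Bijective f := by
  refine ⟨LinearMap.ker_eq_bot.1 ?_, hf⟩
  by_contra hr
  have : Nontrivial (LinearMap.ker f) := (Submodule.nontrivial_iff_ne_bot).2 hr
  have h1 := (isSES_subtype_ker hf).homDim_right K (M := Λ) ExtZ.of_projective
  have h2 := homDim_self_pos K (Λ := Λ) (M := LinearMap.ker f)
  omega

/-- Induction along decompositions of finitely generated modules into indecomposables. -/
theorem indec_induction (K : Type w) [Field K] [Algebra K Λ] [Module.Finite K Λ]
    [IsNoetherianRing Λ] {p : ModuleCat.{u} Λ → Prop}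
    (zero : ∀ M : ModuleCat.{u} Λ, Subsingleton M → p M)
    (indec : ∀ M : ModuleCat.{u} Λ, Module.Finite Λ M → IsIndec Λ M → p M)
    (sum : ∀ M : ModuleCat.{u} Λ, Module.Finite Λ M → ∀ A B : Submodule Λ M, IsCompl A B →
      p (ModuleCat.of Λ A) → p (ModuleCat.of Λ B) → p M) :
    ∀ M : ModuleCat.{u} Λ, Module.Finite Λ M → p M := by
  suffices H : ∀ (d : ℕ) (M : ModuleCat.{u} Λ), Module.Finite Λ M → homDim K Λ Λ M = d → p M from
    fun M hM => H _ M hM rfl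
  intro d
  induction d using Nat.strong_induction_on with
  | _ d ih =>
    intro M hM hd
    by_cases h0 : Subsingleton M
    · exact zero M h0
    by_cases h1 : IsIndec Λ M
    · exact indec M hM h1
    have h2 : ¬ ∀ e : M →ₗ[Λ] M, e ∘ₗ e = e → e = 0 ∨ e = LinearMap.id :=
      fun h => h1 ⟨not_subsingleton_iff_nontrivial.1 h0, h⟩
    push Not at h2
    obtain ⟨e, he, he0, he1⟩ := h2
    have hc : IsCompl (LinearMap.range e) (LinearMap.ker e) :=
      LinearMap.IsIdempotentElem.isCompl (f := e) he
    have hr : LinearMap.range e ≠ ⊤ := fun h => he1 (by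
      ext x
      obtain ⟨y, rfl⟩ := LinearMap.range_eq_top.1 h x
      exact LinearMap.congr_fun he y)
    have hk : LinearMap.ker e ≠ ⊤ := fun h => he0 (LinearMap.ker_eq_top.1 h)
    exact sum M hM _ _ hc
      (ih _ (hd ▸ homDim_self_submodule_lt K hr) _ (inferInstanceAs (Module.Finite Λ _)) rfl)
      (ih _ (hd ▸ homDim_self_submodule_lt K hk) _ (inferInstanceAs (Module.Finite Λ _)) rfl)

end Size

end WallChamber

namespace WallChamber

universe w u

/-! ### Rigid families and their matrix of Hom dimensions. -/

section RigidFamily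

variable {Λ : Type u} [Ring Λ]

/-- A family of pairwise nonisomorphic bricks without extensions among each other. -/
structure IsRigidFamily {ι : Type*} (T : ι → ModuleCat.{u} Λ) : Prop where
  finite : ∀ i, Module.Finite Λ (T i)
  brick : ∀ i, IsBrick (T i)
  injective : ∀ i j, Nonempty (T i ≅ T j) → i = j
  ext : ∀ i j, ExtZ Λ (T i) (T j)

variable {ι : Type*} {T : ι → ModuleCat.{u} Λ}

theorem IsRigidFamily.eq_of_bijective (hT : IsRigidFamily T) {i j : ι} (f : T i →ₗ[Λ] T j)
    (hf : Function.Bijective f) : i = j :=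
  hT.injective i j ⟨(LinearEquiv.ofBijective f hf).toModuleIso⟩

theorem IsRigidFamily.comp (hT : IsRigidFamily T) {κ : Type*} (φ : κ → ι)
    (hφ : Function.Injective φ) : IsRigidFamily (T ∘ φ) :=
  ⟨fun _ => hT.finite _, fun _ => hT.brick _, fun _ _ h => hφ (hT.injective _ _ h),
    fun _ _ => hT.ext _ _⟩

variable [IsNoetherianRing Λ] [IsArtinianRing Λ]

theorem IsRigidFamily.injective_or_surjective (hΛ : IsHereditary Λ) (hT : IsRigidFamily T)
    {i j : ι} (f : T i →ₗ[Λ] T j) (hf : f ≠ 0) : Function.Injective f ∨ Function.Surjective f :=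
  have := hT.finite
  (hT.brick i).isIndec.injective_or_surjective hΛ (hT.brick j).isIndec (hT.ext j i) f hf

/-- In a rigid family, a proper surjection is never followed by a proper injection. -/
theorem IsRigidFamily.not_surjective_injective (hΛ : IsHereditary Λ) (hT : IsRigidFamily T)
    {i j k : ι} (hij : i ≠ j) (hjk : j ≠ k) (f : T i →ₗ[Λ] T j) (hf : Function.Surjective f)
    (g : T j →ₗ[Λ] T k) (hg : Function.Injective g) : False := by
  have hfi : ¬ Function.Injective f := fun h => hij (hT.eq_of_bijective f ⟨h, hf⟩)
  have hgs : ¬ Function.Surjective g := fun h => hjk (hT.eq_of_bijective g ⟨hg, h⟩)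
  have h0 : g ∘ₗ f ≠ 0 := fun h => by
    have := (hT.brick j).1
    obtain ⟨y, hy⟩ := exists_ne (0 : T j)
    obtain ⟨x, rfl⟩ := hf y
    exact hy (hg ((LinearMap.congr_fun h x).trans (map_zero g).symm))
  rcases hT.injective_or_surjective hΛ _ h0 with h | h
  · exact hfi (Function.Injective.of_comp h)
  · exact hgs (Function.Surjective.of_comp h)

/-- Every finite part of a rigid family has a member that receives no maps from the others. -/
theorem IsRigidFamily.exists_source (K : Type w) [Field K] [Algebra K Λ] [Module.Finite K Λ]
    (hΛ : IsHereditary Λ) (hT : IsRigidFamily T) (S : Finset ι) (hS : S.Nonempty) :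
    ∃ l ∈ S, ∀ i ∈ S, i ≠ l → ∀ f : T i →ₗ[Λ] T l, f = 0 := by
  classical
  have := hT.finite
  -- If some member embeds in another one, take the smallest such member: it receives no injection
  -- by minimality, and no surjection since none may precede its embedding. Otherwise all nonzero
  -- maps between distinct members are surjective, and a largest member receives none.
  let S' := S.filter fun j => ∃ k ∈ S, j ≠ k ∧ ∃ f : T j →ₗ[Λ] T k, Function.Injective f
  by_cases hS' : S'.Nonempty
  · obtain ⟨l, hl, hmin⟩ := S'.exists_min_image (fun j => homDim K Λ Λ (T j)) hS'
    obtain ⟨hlS, k, hk, hlk, g, hg⟩ := Finset.mem_filter.1 hl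
    refine ⟨l, hlS, fun i hi hil f => ?_⟩
    by_contra hf
    rcases hT.injective_or_surjective hΛ f hf with h | h
    · have hi' : i ∈ S' := Finset.mem_filter.2 ⟨hi, l, hlS, hil, f, h⟩
      exact hil (hT.eq_of_bijective f
        (bijective_of_injective_of_homDim_le K f h (hmin i hi')))
    · exact hT.not_surjective_injective hΛ hil hlk f h g hg
  · obtain ⟨l, hl, hmax⟩ := S.exists_max_image (fun j => homDim K Λ Λ (T j)) hS
    refine ⟨l, hl, fun i hi hil f => ?_⟩
    by_contra hf
    rcases hT.injective_or_surjective hΛ f hf with h | h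
    · exact hS' ⟨i, Finset.mem_filter.2 ⟨hi, l, hl, hil, f, h⟩⟩
    · exact hil (hT.eq_of_bijective f
        (bijective_of_surjective_of_homDim_le K f h (hmax i hi)))

/-- The matrix of dimensions of homomorphisms within a rigid family is nonsingular. -/
theorem IsRigidFamily.eq_zero_of_sum_homDim (K : Type w) [Field K] [Algebra K Λ]
    [Module.Finite K Λ] (hΛ : IsHereditary Λ) (hT : IsRigidFamily T) [Fintype ι] (c : ι → ℝ)
    (hc : ∀ l, ∑ i, c i * homDim K Λ (T i) (T l) = 0) : c = 0 := by
  classical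
  have := hT.finite
  by_contra hne
  obtain ⟨i₀, hi₀⟩ := Function.ne_iff.1 hne
  -- At a member of the support of `c` that receives no maps from the rest of the support, the
  -- relation reduces to `c l * dim End(T l) = 0`.
  obtain ⟨l, hl, h⟩ := hT.exists_source K hΛ (Finset.univ.filter fun i => c i ≠ 0)
    ⟨i₀, by simpa using hi₀⟩
  have hl' : c l ≠ 0 := by simpa using hl
  have h1 := hc l
  rw [Finset.sum_eq_single l] at h1
  · rcases mul_eq_zero.1 h1 with h2 | h2
    · exact hl' h2
    · have h3 := (homDim_eq_zero_iff K).1 (Nat.cast_eq_zero.1 h2) LinearMap.id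
      have := (hT.brick l).1
      obtain ⟨x, hx⟩ := exists_ne (0 : T l)
      exact hx (LinearMap.congr_fun h3 x)
  · intro i _ hi
    by_cases hci : c i = 0
    · simp [hci]
    · rw [homDim_eq_zero_of_forall K (h i (by simpa using hci) hi)]; simp
  · simp

end RigidFamily

/-! ### g-vectors and their pairing with dimension vectors. -/

section GVector

variable (K : Type w) [Field K] {Λ : Type u} [Ring Λ] [Algebra K Λ] [Module.Finite K Λ]
  [IsNoetherianRing Λ]
  {n : ℕ} {P : Fin n → ModuleCat.{u} Λ}
variable {A B C M N X : Type u}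
  [AddCommGroup A] [Module Λ A] [AddCommGroup B] [Module Λ B] [AddCommGroup C] [Module Λ C]
  [AddCommGroup M] [Module Λ M] [AddCommGroup N] [Module Λ N] [AddCommGroup X] [Module Λ X]
  [Module.Finite Λ A] [Module.Finite Λ B] [Module.Finite Λ C]
  [Module.Finite Λ M] [Module.Finite Λ N]

theorem dimVec_apply (M : ModuleCat.{u} Λ) (i : Fin n) :
    dimVec K P M i = (homDim K Λ (P i) M : ℝ) := rfl

theorem IsIndecProjectiveList.isRigidFamily [IsArtinianRing Λ] (hΛ : IsHereditary Λ)
    (hP : IsIndecProjectiveList P) :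
    IsRigidFamily P where
  finite := hP.finite
  brick i := by
    have := hP.finite i
    have := hP.projective i
    exact ((indecomposable_iff _).1 (hP.indecomposable i)).isBrick hΛ ExtZ.of_projective
  injective := hP.injective
  ext i j := by
    have := hP.projective i
    exact ExtZ.of_projective

theorem IsSES.dot_dimVec (hP : IsIndecProjectiveList P) {i : A →ₗ[Λ] B} {q : B →ₗ[Λ] C}
    (h : IsSES i q) (g : Fin n → ℝ) :
    g ⬝ᵥ dimVec K P (ModuleCat.of Λ B) =
      g ⬝ᵥ dimVec K P (ModuleCat.of Λ A) + g ⬝ᵥ dimVec K P (ModuleCat.of Λ C) := by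
  have := hP.finite
  have := hP.projective
  rw [← dotProduct_add]
  congr 1
  ext s
  have := h.homDim_right K (M := P s) ExtZ.of_projective
  rw [Pi.add_apply, dimVec_apply, dimVec_apply, dimVec_apply]
  exact_mod_cast this

theorem dimVec_congr (e : A ≃ₗ[Λ] B) :
    dimVec K P (ModuleCat.of Λ A) = dimVec K P (ModuleCat.of Λ B) := by
  ext s
  rw [dimVec_apply, dimVec_apply]
  exact_mod_cast homDim_congr_right K e

theorem dimVec_of_subsingleton [Subsingleton M] : dimVec K P (ModuleCat.of Λ M) = 0 := by
  ext s
  rw [dimVec_apply, homDim_eq_zero_of_forall K fun f =>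
    LinearMap.ext fun x => (Subsingleton.elim (α := M) _ _)]
  simp

/-- The indecomposable projectives form a rigid family, so their Cartan matrix is nonsingular. This
makes g-vectors unique and additive. -/
theorem IsIndecProjectiveList.eq_of_dot [IsArtinianRing Λ] (hΛ : IsHereditary Λ)
    (hP : IsIndecProjectiveList P) {v v' : Fin n → ℝ}
    (h : ∀ l, v ⬝ᵥ dimVec K P (P l) = v' ⬝ᵥ dimVec K P (P l)) : v = v' := by
  refine sub_eq_zero.1 ((hP.isRigidFamily hΛ).eq_zero_of_sum_homDim K hΛ (v - v') fun l => ?_)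
  have := h l
  rw [← sub_eq_zero, ← sub_dotProduct] at this
  exact this

/-- A finitely generated projective module is a finite direct sum of the `P i`. -/
theorem IsIndecProjectiveList.exists_equiv_pi (K : Type w) [Field K] [Algebra K Λ]
    [Module.Finite K Λ] (hP : IsIndecProjectiveList P) :
    ∀ Q : ModuleCat.{u} Λ, Module.Finite Λ Q → Module.Projective Λ Q →
    ∃ (κ : Type) (_ : Fintype κ) (φ : κ → Fin n), Nonempty (Q ≃ₗ[Λ] ∀ x, P (φ x)) := by
  refine indec_induction K (p := fun Q => Module.Projective Λ Q →
    ∃ (κ : Type) (_ : Fintype κ) (φ : κ → Fin n), Nonempty (Q ≃ₗ[Λ] ∀ x, P (φ x))) ?_ ?_ ?_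
  · intro M hM _
    refine ⟨Empty, inferInstance, Empty.elim, ⟨⟨0, 0, fun x => Subsingleton.elim _ _,
      fun x => funext fun e => e.elim⟩⟩⟩
  · intro M hM hi hp
    obtain ⟨i, ⟨e⟩⟩ := hP.complete M hM hp ((indecomposable_iff M).2 hi)
    exact ⟨Unit, inferInstance, fun _ => i,
      ⟨e.toLinearEquiv.trans (LinearEquiv.funUnique Unit Λ (P i)).symm⟩⟩
  · intro M hM A B hAB hA hB hp
    have e := Submodule.prodEquivOfIsCompl A B hAB
    have hpA : Module.Projective Λ A := Module.Projective.of_split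
      (e.toLinearMap ∘ₗ LinearMap.inl Λ A B) (LinearMap.fst Λ A B ∘ₗ e.symm.toLinearMap)
      (by ext x; simp)
    have hpB : Module.Projective Λ B := Module.Projective.of_split
      (e.toLinearMap ∘ₗ LinearMap.inr Λ A B) (LinearMap.snd Λ A B ∘ₗ e.symm.toLinearMap)
      (by ext x; simp)
    obtain ⟨κ, _, φ, ⟨eA⟩⟩ := hA hpA
    obtain ⟨κ', _, φ', ⟨eB⟩⟩ := hB hpB
    exact ⟨κ ⊕ κ', inferInstance, Sum.elim φ φ', ⟨e.symm.trans ((eA.prodCongr eB).trans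
      (LinearEquiv.sumPiEquivProdPi Λ κ κ' (fun x => P (Sum.elim φ φ' x))).symm)⟩⟩

theorem IsIndecProjectiveList.exists_equiv_multiSum (K : Type w) [Field K] [Algebra K Λ]
    [Module.Finite K Λ] (hP : IsIndecProjectiveList P) (Q : Type u) [AddCommGroup Q] [Module Λ Q]
    [Module.Finite Λ Q] [Module.Projective Λ Q] :
    ∃ a : Fin n → ℕ, Nonempty (Q ≃ₗ[Λ] multiSum P a) := by
  classical
  obtain ⟨κ, _, φ, ⟨e⟩⟩ := hP.exists_equiv_pi K (ModuleCat.of Λ Q) ‹_› ‹_›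
  -- The multiplicity of `P i` is the size of the fibre of `φ` over `i`.
  let a : Fin n → ℕ := fun i => Fintype.card {x // φ x = i}
  let ε : (Σ i, Fin (a i)) ≃ κ :=
    (Equiv.sigmaCongrRight fun i => (Fintype.equivFin {x // φ x = i}).symm).trans
      (Equiv.sigmaFiberEquiv φ)
  have hε : ∀ s, φ (ε s) = s.1 := fun s => ((Fintype.equivFin {x // φ x = s.1}).symm s.2).2
  have c : ∀ {i j : Fin n}, i = j → (P i ≃ₗ[Λ] P j) := fun h => by subst h; exact LinearEquiv.refl _ _
  let e₁ := (LinearEquiv.piCongrLeft Λ (fun x => P (φ x)) ε).symm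
  let e₂ : (∀ s, P (φ (ε s))) ≃ₗ[Λ] (∀ s : Σ i, Fin (a i), P s.1) :=
    LinearEquiv.piCongrRight fun s => c (hε s)
  exact ⟨a, ⟨e.trans (e₁.trans (e₂.trans
    (LinearEquiv.piCurry Λ (fun i (_ : Fin (a i)) => P i))))⟩⟩

variable (M) in
theorem IsIndecProjectiveList.exists_isGVector (K : Type w) [Field K] [Algebra K Λ]
    [Module.Finite K Λ] (hΛ : IsHereditary Λ) (hP : IsIndecProjectiveList P) :
    ∃ v, IsGVector P (ModuleCat.of Λ M) v := by
  obtain ⟨m, q, hq⟩ := Module.Finite.exists_fin' Λ M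
  have h := isSES_subtype_ker hq
  have := hΛ.projective_submodule (LinearMap.ker q)
  obtain ⟨a, ⟨e⟩⟩ := hP.exists_equiv_multiSum K (Fin m → Λ)
  obtain ⟨b, ⟨e'⟩⟩ := hP.exists_equiv_multiSum K (LinearMap.ker q)
  refine ⟨fun i => a i - b i, a, b, e.toLinearMap ∘ₗ (LinearMap.ker q).subtype ∘ₗ
    e'.symm.toLinearMap, q ∘ₗ e.symm.toLinearMap, ?_, ?_, ?_, fun i => rfl⟩
  · exact e.injective.comp (h.inj.comp e'.symm.injective)
  · intro y
    obtain ⟨x, rfl⟩ := e.surjective y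
    have := h.exact x
    simp only [LinearMap.comp_apply, LinearEquiv.coe_coe, LinearEquiv.symm_apply_apply]
    rw [this]
    constructor
    · rintro ⟨z, rfl⟩
      exact ⟨e' z, by simp⟩
    · rintro ⟨z, hz⟩
      exact ⟨e'.symm z, e.injective hz⟩
  · exact h.surj.comp e.symm.surjective

theorem projective_multiSum {k : ℕ} {T : Fin k → ModuleCat.{u} Λ}
    (hT : ∀ i, Module.Projective Λ (T i)) (m : Fin k → ℕ) :
    Module.Projective Λ (multiSum T m) := by
  have : ∀ i, Module.Projective Λ (Fin (m i) → T i) := fun i =>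
    Module.Projective.of_equiv (DFinsupp.linearEquivFunOnFintype (M := fun _ : Fin (m i) => T i))
  exact Module.Projective.of_equiv
    (DFinsupp.linearEquivFunOnFintype (M := fun i => (Fin (m i) → T i)))

theorem homDim_multiSum {k : ℕ} {T : Fin k → ModuleCat.{u} Λ} (hT : ∀ i, Module.Finite Λ (T i))
    (m : Fin k → ℕ) :
    homDim K Λ (multiSum T m) N = ∑ i, m i * homDim K Λ (T i) N := by
  rw [homDim_pi K (fun i => Fin (m i) → T i)]
  refine Finset.sum_congr rfl fun i _ => ?_
  rw [homDim_pi K (fun _ => T i)]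
  simp

/-- The resolution in the definition of the g-vector also computes the Euler form, and Hom(P i, N)
has the dimension recorded in the dimension vector. All later sign arguments pass through this
identity. -/
theorem IsGVector.dot_dimVec (hP : IsIndecProjectiveList P) {v : Fin n → ℝ}
    (h : IsGVector P (ModuleCat.of Λ M) v) :
    v ⬝ᵥ dimVec K P (ModuleCat.of Λ N) = eulerForm K Λ M N := by
  obtain ⟨a, b, f, p, h1, h2, h3, h4⟩ := h
  have := hP.finite
  have := hP.projective
  have h : IsSES f p := ⟨h1, h2, h3⟩
  have := projective_multiSum hP.projective a
  have e := h.eulerForm_eq K (M := M) (N := N)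
  rw [homDim_multiSum K hP.finite, homDim_multiSum K hP.finite] at e
  rw [e]
  push_cast
  rw [← Finset.sum_sub_distrib]
  refine Finset.sum_congr rfl fun i _ => ?_
  rw [h4, dimVec_apply, sub_mul]

open Classical in
/-- The `g`-vector of a finitely generated module. -/
noncomputable def gVec (P : Fin n → ModuleCat.{u} Λ) (M : Type u) [AddCommGroup M] [Module Λ M] :
    Fin n → ℝ :=
  if h : ∃ v, IsGVector P (ModuleCat.of Λ M) v then h.choose else 0

variable (M) in
theorem isGVector_gVec (K : Type w) [Field K] [Algebra K Λ]
    [Module.Finite K Λ] (hΛ : IsHereditary Λ) (hP : IsIndecProjectiveList P) :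
    IsGVector P (ModuleCat.of Λ M) (gVec P M) := by
  have h := hP.exists_isGVector M K hΛ
  rw [gVec, dif_pos h]
  exact h.choose_spec

theorem gVec_dot (hΛ : IsHereditary Λ) (hP : IsIndecProjectiveList P) :
    gVec P M ⬝ᵥ dimVec K P (ModuleCat.of Λ N) = eulerForm K Λ M N :=
  (isGVector_gVec M K hΛ hP).dot_dimVec K hP

/-- A finitely generated module that receives no maps from the `P i` is zero. -/
theorem IsIndecProjectiveList.subsingleton (K : Type w) [Field K] [Algebra K Λ]
    [Module.Finite K Λ] (hP : IsIndecProjectiveList P)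
    (h : ∀ i, ∀ f : P i →ₗ[Λ] M, f = 0) : Subsingleton M := by
  obtain ⟨a, ⟨e⟩⟩ := hP.exists_equiv_multiSum K Λ
  have h1 : homDim K Λ Λ M = 0 := by
    rw [homDim_congr_left K e, homDim_multiSum K hP.finite]
    refine Finset.sum_eq_zero fun i _ => ?_
    rw [homDim_eq_zero_of_forall K (h i), mul_zero]
  by_contra hM
  have := not_subsingleton_iff_nontrivial.1 hM
  exact (homDim_self_pos K (Λ := Λ) (M := M)).ne' h1

variable [IsArtinianRing Λ]

theorem eq_gVec_of_dot (hΛ : IsHereditary Λ) (hP : IsIndecProjectiveList P) {v : Fin n → ℝ}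
    (h : ∀ l, v ⬝ᵥ dimVec K P (P l) = eulerForm K Λ M (P l)) : v = gVec P M := by
  have := hP.finite
  refine hP.eq_of_dot K hΛ fun l => ?_
  rw [h]
  exact (gVec_dot K (N := P l) hΛ hP).symm

theorem IsGVector.eq_gVec (K : Type w) [Field K] [Algebra K Λ]
    [Module.Finite K Λ] (hΛ : IsHereditary Λ) (hP : IsIndecProjectiveList P)
    {v : Fin n → ℝ} (h : IsGVector P (ModuleCat.of Λ M) v) : v = gVec P M := by
  have := hP.finite
  exact eq_gVec_of_dot K hΛ hP fun l => h.dot_dimVec K (N := P l) hP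

theorem IsSES.gVec_add (K : Type w) [Field K] [Algebra K Λ]
    [Module.Finite K Λ] (hΛ : IsHereditary Λ) (hP : IsIndecProjectiveList P)
    {i : A →ₗ[Λ] B} {q : B →ₗ[Λ] C} (h : IsSES i q) : gVec P B = gVec P A + gVec P C := by
  have := hP.finite
  refine (eq_gVec_of_dot K hΛ hP fun l => ?_).symm
  rw [add_dotProduct]
  refine (congrArg₂ (· + ·) (gVec_dot K (N := P l) hΛ hP) (gVec_dot K (N := P l) hΛ hP)).trans ?_
  rw [h.eulerForm_add K hΛ]
  push_cast; rfl

theorem gVec_congr (K : Type w) [Field K] [Algebra K Λ]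
    [Module.Finite K Λ] (hΛ : IsHereditary Λ) (hP : IsIndecProjectiveList P)
    (e : A ≃ₗ[Λ] B) : gVec P A = gVec P B := by
  have := hP.finite
  refine eq_gVec_of_dot K hΛ hP fun l => ?_
  rw [← eulerForm_congr K e]
  exact gVec_dot K (N := P l) hΛ hP

theorem gVec_projective (K : Type w) [Field K] [Algebra K Λ]
    [Module.Finite K Λ] (hΛ : IsHereditary Λ) (hP : IsIndecProjectiveList P) (s : Fin n) :
    gVec P (P s) = Pi.single s 1 := by
  have := hP.finite
  have := hP.projective
  refine (eq_gVec_of_dot K hΛ hP fun l => ?_).symm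
  rw [eulerForm_of_projective, single_dotProduct, one_mul, dimVec_apply]
  simp

theorem gVec_of_subsingleton (K : Type w) [Field K] [Algebra K Λ]
    [Module.Finite K Λ] (hΛ : IsHereditary Λ) (hP : IsIndecProjectiveList P) [Subsingleton M] :
    gVec P M = 0 := by
  have := isSES_inl_snd (Λ := Λ) (A := M) (B := M)
  have h := this.gVec_add K hΛ hP
  have e : (M × M) ≃ₗ[Λ] M := ⟨LinearMap.fst Λ M M, 0, fun x => Subsingleton.elim _ _,
    fun x => Subsingleton.elim _ _⟩
  rw [gVec_congr K hΛ hP e] at h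
  exact left_eq_add.1 h

end GVector

end WallChamber

namespace WallChamber

universe w u

/-! ### Perpendicular modules and Bongartz's argument. -/

section Perpendicular

variable (K : Type w) [Field K] {Λ : Type u} [Ring Λ] [Algebra K Λ] [Module.Finite K Λ]
  [IsNoetherianRing Λ]
variable {X Y T : Type u} [AddCommGroup X] [Module Λ X] [AddCommGroup Y] [Module Λ Y]
  [AddCommGroup T] [Module Λ T] [Module.Finite Λ X] [Module.Finite Λ Y] [Module.Finite Λ T]

theorem eq_zero_of_comp_proj {Λ : Type u} [Ring Λ] {ι : Type*} [DecidableEq ι] {F : ι → Type*}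
    [∀ i, AddCommGroup (F i)] [∀ i, Module Λ (F i)] {X : Type*} [AddCommGroup X] [Module Λ X]
    (i : ι) (f : F i →ₗ[Λ] X) (h : f ∘ₗ LinearMap.proj i = 0) : f = 0 := by
  ext x
  have := LinearMap.congr_fun h (Pi.single i x)
  simpa using this

/-- There are no maps from `T` to the quotient of `Y` by the trace of `T`. -/
theorem hom_quotient_range_eq_zero {r : ℕ} {p : (Fin r → T) →ₗ[Λ] Y}
    (hp : ∀ f : T →ₗ[Λ] Y, ∃ c : Fin r → K, p ∘ₗ diagMap K Λ T c = f)
    (h : ExtZ Λ T (LinearMap.range p)) (f : T →ₗ[Λ] Y ⧸ LinearMap.range p) : f = 0 := by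
  obtain ⟨g, rfl⟩ := h.exists_lift (isSES_subtype_mkQ _) f
  obtain ⟨c, rfl⟩ := hp g
  ext x
  simp

/-- Bongartz's universal extension. -/
theorem exists_universal_extension (K : Type w) [Field K] [Algebra K Λ]
    [Module.Finite K Λ] (hTT : ExtZ Λ T T) :
    ∃ (E : Type u) (_ : AddCommGroup E) (_ : Module Λ E) (r : ℕ) (i : Y →ₗ[Λ] E)
      (q : E →ₗ[Λ] (Fin r → T)), Module.Finite Λ E ∧ IsSES i q ∧ ExtZ Λ T E := by
  obtain ⟨m, p, hp⟩ := Module.Finite.exists_fin' Λ T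
  have h := isSES_subtype_ker hp
  -- Every map from the kernel of `p` to `Y` is a combination of the components of `σ`. The pushout
  -- along `σ` of `r` copies of the presentation of `T` therefore absorbs all of Ext¹(T, Y).
  obtain ⟨r, σ, hσ⟩ := exists_right_approx (Λ := Λ) K (LinearMap.ker p) Y
  let ι₀ : (Fin r → LinearMap.ker p) →ₗ[Λ] (Fin r → Fin m → Λ) :=
    LinearMap.pi fun j => (LinearMap.ker p).subtype ∘ₗ LinearMap.proj j
  let p₀ : (Fin r → Fin m → Λ) →ₗ[Λ] (Fin r → T) := LinearMap.pi fun j => p ∘ₗ LinearMap.proj j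
  let S : Submodule Λ (Y × (Fin r → Fin m → Λ)) := LinearMap.range ((-σ).prod ι₀)
  have hS : S ≤ LinearMap.ker (p₀ ∘ₗ LinearMap.snd Λ Y (Fin r → Fin m → Λ)) := by
    rintro _ ⟨a, rfl⟩
    exact funext fun j => (a j).2
  let i : Y →ₗ[Λ] (Y × (Fin r → Fin m → Λ)) ⧸ S := S.mkQ ∘ₗ LinearMap.inl Λ _ _
  let q : (Y × (Fin r → Fin m → Λ)) ⧸ S →ₗ[Λ] (Fin r → T) := S.liftQ _ hS
  let w : (Fin r → Fin m → Λ) →ₗ[Λ] (Y × (Fin r → Fin m → Λ)) ⧸ S :=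
    S.mkQ ∘ₗ LinearMap.inr Λ _ _
  have hw : ∀ a, w (ι₀ a) = i (σ a) := fun a => by
    change Submodule.Quotient.mk _ = Submodule.Quotient.mk _
    rw [Submodule.Quotient.eq]
    exact ⟨a, by simp⟩
  have hs : IsSES i q := by
    refine ⟨(injective_iff_map_eq_zero i).2 fun x hx => ?_, fun y => ⟨fun hy => ?_, ?_⟩, fun t => ?_⟩
    · have hx' : ((x, 0) : Y × (Fin r → Fin m → Λ)) ∈ S := (Submodule.Quotient.mk_eq_zero S).1 hx
      obtain ⟨a, ha⟩ := hx'
      have h1 : ι₀ a = 0 := congrArg Prod.snd ha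
      have h2 : -(σ a) = x := congrArg Prod.fst ha
      have h3 : a = 0 := funext fun j => Subtype.ext (congrFun h1 j)
      rw [← h2, h3]; simp
    · obtain ⟨⟨x, b⟩, rfl⟩ := S.mkQ_surjective y
      have hb : p₀ b = 0 := hy
      let a : Fin r → LinearMap.ker p := fun j => ⟨b j, congrFun hb j⟩
      refine ⟨x + σ a, ?_⟩
      have h1 := hw a
      have h2 : S.mkQ (x, b) = i x + w b := by
        change _ = S.mkQ (x, 0) + S.mkQ (0, b)
        rw [← map_add]; simp
      rw [map_add, ← h1, h2]; rfl
    · rintro ⟨x, rfl⟩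
      change p₀ 0 = 0
      simp
    · choose b hb using fun j => hp (t j)
      exact ⟨S.mkQ (0, b), funext hb⟩
  refine ⟨_, _, _, r, i, q, inferInstance, hs, ExtZ.of_presentation h fun f => ?_⟩
  have hTr : ExtZ Λ T (Fin r → T) := ExtZ.pi_right (LinearEquiv.refl _ _) fun _ => hTT
  -- Rigidity of `T` extends the component of `f` in `T ^ r`; after subtracting a lift of this
  -- extension, `f` takes values in `Y`, where `σ` controls it.
  obtain ⟨g, hg⟩ := hTr _ _ h (q ∘ₗ f)
  obtain ⟨l, hl⟩ := Module.projective_lifting_property q g hs.surj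
  obtain ⟨f₁, hf₁⟩ := hs.exists_lift (f - l ∘ₗ (LinearMap.ker p).subtype) (by
    rw [LinearMap.comp_sub, ← LinearMap.comp_assoc, hl, hg, sub_self])
  obtain ⟨c, hc⟩ := hσ f₁
  refine ⟨w ∘ₗ diagMap K Λ _ c + l, LinearMap.ext fun a => ?_⟩
  have h1 : w (diagMap K Λ _ c a.1) = i (f₁ a) := by
    rw [← hc]
    exact hw (diagMap K Λ _ c a)
  have h2 : i (f₁ a) = f a - l a.1 := LinearMap.congr_fun hf₁ a
  change w (diagMap K Λ _ c a.1) + l a.1 = f a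
  rw [h1, h2, sub_add_cancel]

variable [IsArtinianRing Λ]

/-- The `g`-vector of a direct summand of a sum of members of a rigid family lies in the span of
the `g`-vectors of the members. -/
theorem gVec_mem_of_retract (K : Type w) [Field K] [Algebra K Λ]
    [Module.Finite K Λ] (hΛ : IsHereditary Λ) {n : ℕ} {P : Fin n → ModuleCat.{u} Λ}
    (hP : IsIndecProjectiveList P) {ι : Type*} {F : ι → ModuleCat.{u} Λ} (hF : IsRigidFamily F)
    {κ : Type} [Fintype κ] [DecidableEq κ] (φ : κ → ι) (W : Submodule ℝ (Fin n → ℝ))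
    (hW : ∀ x, gVec P (F (φ x)) ∈ W) :
    ∀ X : ModuleCat.{u} Λ, Module.Finite Λ X →
      (∃ (s : X →ₗ[Λ] ∀ x, F (φ x)) (r : (∀ x, F (φ x)) →ₗ[Λ] X), r ∘ₗ s = LinearMap.id) →
      gVec P X ∈ W := by
  have hfin := hF.finite
  refine indec_induction K (p := fun X => (∃ (s : X →ₗ[Λ] ∀ x, F (φ x))
    (r : (∀ x, F (φ x)) →ₗ[Λ] X), r ∘ₗ s = LinearMap.id) → gVec P X ∈ W) ?_ ?_ ?_
  · intro M hM _
    have : Module.Finite Λ M := inferInstance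
    rw [gVec_of_subsingleton K hΛ hP]
    exact W.zero_mem
  · rintro M hM hi ⟨s, r, hrs⟩
    have hext : ExtZ Λ M M := by
      refine ExtZ.of_retract_left (ExtZ.pi_left fun x => ?_) s r hrs
      exact ExtZ.of_retract_right (ExtZ.pi_right (LinearEquiv.refl _ _) fun y => hF.ext _ _) s r hrs
    have hb := hi.isBrick hΛ hext
    -- The identity of `M` is the sum of these endomorphisms. As `M` is a brick, a nonzero one is
    -- invertible, so `M` is a nonzero retract of the indecomposable `F (φ x)` and hence isomorphic
    -- to it.
    obtain ⟨x, hx⟩ : ∃ x, r ∘ₗ LinearMap.single Λ (fun x => F (φ x)) x ∘ₗ LinearMap.proj x ∘ₗ s ≠ 0 := by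
      by_contra! hall
      have := hi.1
      obtain ⟨m, hm⟩ := exists_ne (0 : M)
      refine hm ?_
      have h1 : r (s m) = m := LinearMap.congr_fun hrs m
      rw [← h1, ← Finset.univ_sum_single (s m), map_sum]
      exact Finset.sum_eq_zero fun x _ => LinearMap.congr_fun (hall x) m
    let b := LinearEquiv.ofBijective _ (hb.2 _ hx)
    have hM1 := hi.1
    have hbij := (hF.brick (φ x)).isIndec.bijective_of_retract (Y := M)
      (s := LinearMap.proj x ∘ₗ s) (r := b.symm.toLinearMap ∘ₗ r ∘ₗ LinearMap.single Λ (fun x => F (φ x)) x)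
      (by
        ext m
        change b.symm (b m) = m
        simp)
    rw [gVec_congr K hΛ hP (LinearEquiv.ofBijective _ hbij)]
    exact hW x
  · rintro M hM A B hAB hA hB ⟨s, r, hrs⟩
    have e := Submodule.prodEquivOfIsCompl A B hAB
    have hrs' : ∀ m, r (s m) = m := LinearMap.congr_fun hrs
    rw [← gVec_congr K hΛ hP e, isSES_inl_snd.gVec_add K hΛ hP]
    refine W.add_mem
      (hA ⟨s ∘ₗ e.toLinearMap ∘ₗ LinearMap.inl Λ A B,
        LinearMap.fst Λ A B ∘ₗ e.symm.toLinearMap ∘ₗ r, ?_⟩)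
      (hB ⟨s ∘ₗ e.toLinearMap ∘ₗ LinearMap.inr Λ A B,
        LinearMap.snd Λ A B ∘ₗ e.symm.toLinearMap ∘ₗ r, ?_⟩)
    · ext x; simp [hrs']
    · ext x; simp [hrs']

theorem gVec_mem_of_retract_pow (K : Type w) [Field K] [Algebra K Λ]
    [Module.Finite K Λ] (hΛ : IsHereditary Λ) {n : ℕ} {P : Fin n → ModuleCat.{u} Λ}
    (hP : IsIndecProjectiveList P) {ι : Type} [Fintype ι] [DecidableEq ι]
    {F : ι → ModuleCat.{u} Λ} (hF : IsRigidFamily F) (W : Submodule ℝ (Fin n → ℝ))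
    (hW : ∀ x, gVec P (F x) ∈ W) {N : ℕ} (s : X →ₗ[Λ] (Fin N → ∀ x, F x))
    (r : (Fin N → ∀ x, F x) →ₗ[Λ] X) (hrs : r ∘ₗ s = LinearMap.id) : gVec P X ∈ W := by
  let c := LinearEquiv.piCurry Λ (fun (_ : Fin N) (x : ι) => F x)
  refine gVec_mem_of_retract K hΛ hP hF (fun x : Σ _ : Fin N, ι => x.2) W (fun x => hW _)
    (ModuleCat.of Λ X) ‹_› ⟨c.symm.toLinearMap ∘ₗ s, r ∘ₗ c.toLinearMap, ?_⟩
  rw [← hrs]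
  ext x
  change r (c (c.symm (s x))) = r (s x)
  rw [LinearEquiv.apply_symm_apply]

/-- If only the zero module is perpendicular to a rigid family together with some shifted
projectives, then the `g`-vectors span everything. -/
theorem span_eq_top_of_perp_eq_zero (K : Type w) [Field K] [Algebra K Λ]
    [Module.Finite K Λ] (hΛ : IsHereditary Λ) {n : ℕ} {P : Fin n → ModuleCat.{u} Λ}
    (hP : IsIndecProjectiveList P) {ι : Type} [Fintype ι]
    {F : ι → ModuleCat.{u} Λ} (hF : IsRigidFamily F) (J : Finset (Fin n))
    (hJ : ∀ j ∈ J, ∀ i, ∀ f : P j →ₗ[Λ] F i, f = 0)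
    (hperp : ∀ X : ModuleCat.{u} Λ, Module.Finite Λ X → (∀ i, ∀ f : F i →ₗ[Λ] X, f = 0) →
      (∀ i, ExtZ Λ (F i) X) → (∀ j ∈ J, ∀ f : P j →ₗ[Λ] X, f = 0) → Subsingleton X)
    (W : Submodule ℝ (Fin n → ℝ)) (hWF : ∀ i, gVec P (F i) ∈ W)
    (hWJ : ∀ j ∈ J, Pi.single j 1 ∈ W) : W = ⊤ := by
  classical
  have hFf := hF.finite
  have hPf := hP.finite
  have hPp := hP.projective
  let T := ∀ i, F i
  have hTT : ExtZ Λ T T := ExtZ.pi_left fun i =>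
    ExtZ.pi_right (LinearEquiv.refl _ _) fun j => hF.ext _ _
  have hTpow : ∀ N : ℕ, ExtZ Λ T (Fin N → T) := fun N =>
    ExtZ.pi_right (LinearEquiv.refl _ _) fun _ => hTT
  have hTi : ∀ {X : Type u} [AddCommGroup X] [Module Λ X], ExtZ Λ T X → ∀ i, ExtZ Λ (F i) X :=
    fun h i => h.of_retract_left (LinearMap.single Λ (fun i => F i) i) (LinearMap.proj i)
      (LinearMap.ext fun x => Pi.single_eq_same (M := fun i => F i) i x)
  -- The cokernel of the right `T`-approximation of `Y` is perpendicular to everything, hence zero.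
  have key : ∀ (Y : Type u) [AddCommGroup Y] [Module Λ Y] [Module.Finite Λ Y], ExtZ Λ T Y →
      (∀ j ∈ J, ∀ f : P j →ₗ[Λ] Y, f = 0) → ∃ (N : ℕ) (p : (Fin N → T) →ₗ[Λ] Y),
        Function.Surjective p ∧ ∀ f : T →ₗ[Λ] Y, ∃ c : Fin N → K, p ∘ₗ diagMap K Λ T c = f := by
    intro Y _ _ _ hY hYJ
    obtain ⟨N, p, hp⟩ := exists_right_approx (Λ := Λ) K T Y
    refine ⟨N, p, ?_, hp⟩
    have h1 : ExtZ Λ T (LinearMap.range p) :=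
      (hTpow N).of_surjective_right hΛ p.rangeRestrict p.surjective_rangeRestrict
    have h2 := hom_quotient_range_eq_zero K hp h1
    have h3 : Subsingleton (Y ⧸ LinearMap.range p) := by
      refine hperp (ModuleCat.of Λ (Y ⧸ LinearMap.range p))
        (inferInstanceAs (Module.Finite Λ (Y ⧸ LinearMap.range p))) (fun i f => ?_)
        (hTi (hY.of_surjective_right hΛ _ (Submodule.mkQ_surjective _))) (fun j hj f => ?_)
      · have h4 := h2 (f ∘ₗ LinearMap.proj i)
        exact eq_zero_of_comp_proj (F := fun i => F i) i f h4
      · obtain ⟨g, rfl⟩ := Module.projective_lifting_property (LinearMap.range p).mkQ f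
          (Submodule.mkQ_surjective _)
        rw [hYJ j hj g, LinearMap.comp_zero]
    exact LinearMap.range_eq_top.1 (Submodule.Quotient.subsingleton_iff.1 h3)
  suffices H : ∀ s, (Pi.single s 1 : Fin n → ℝ) ∈ W by
    rw [eq_top_iff]
    intro v _
    rw [pi_eq_sum_univ' v]
    refine W.sum_mem fun s _ => W.smul_mem _ ?_
    convert H s using 1
  intro s
  -- the trace of the shifted projectives
  let R := ∀ j : J, P j
  have hRp : Module.Projective Λ R :=
    Module.Projective.of_equiv (DFinsupp.linearEquivFunOnFintype (M := fun j : J => P j))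
  have hRhom : ∀ {X : Type u} [AddCommGroup X] [Module Λ X],
      (∀ f : R →ₗ[Λ] X, f = 0) ↔ ∀ j ∈ J, ∀ f : P j →ₗ[Λ] X, f = 0 := by
    intro X _ _
    constructor
    · intro h j hj f
      have h4 := h (f ∘ₗ LinearMap.proj (φ := fun j : J => P j) ⟨j, hj⟩)
      exact eq_zero_of_comp_proj (F := fun j : J => P j) ⟨j, hj⟩ f h4
    · intro h f
      exact LinearMap.pi_ext' fun j => h j.1 j.2 _
  obtain ⟨r₁, p₁, hp₁⟩ := exists_right_approx (Λ := Λ) K R (P s)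
  have hY₁ : ∀ f : R →ₗ[Λ] P s ⧸ LinearMap.range p₁, f = 0 :=
    hom_quotient_range_eq_zero K hp₁ ExtZ.of_projective
  have htp : Module.Projective Λ (LinearMap.range p₁) := hΛ.projective_submodule _
  -- The trace of `R` in `P s` is a quotient of a power of `R`, which has no maps to `T`. So
  -- dividing by the trace creates no extensions with `T`.
  have ht0 : ∀ f : LinearMap.range p₁ →ₗ[Λ] T, f = 0 := by
    intro f
    have h1 : f ∘ₗ p₁.rangeRestrict = 0 := by
      refine LinearMap.pi_ext' fun a => hRhom.2 (fun j hj g => ?_) _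
      ext x i
      exact LinearMap.congr_fun (hJ j hj i (LinearMap.proj i ∘ₗ g)) x
    ext x
    obtain ⟨y, rfl⟩ := p₁.surjective_rangeRestrict x
    exact congrFun (LinearMap.congr_fun h1 y) _
  have hY₁T : ExtZ Λ (P s ⧸ LinearMap.range p₁) T :=
    ExtZ.of_presentation (isSES_subtype_mkQ _) fun f => ⟨0, by rw [ht0 f, LinearMap.zero_comp]⟩
  obtain ⟨E, _, _, r, i, q, hEf, hs, hTE⟩ :=
    exists_universal_extension K (Y := P s ⧸ LinearMap.range p₁) hTT
  have hEJ : ∀ j ∈ J, ∀ f : P j →ₗ[Λ] E, f = 0 := by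
    intro j hj f
    obtain ⟨f', rfl⟩ := hs.exists_lift f (by
      ext x a i
      exact LinearMap.congr_fun (hJ j hj i (LinearMap.proj i ∘ₗ LinearMap.proj a ∘ₗ q ∘ₗ f)) x)
    rw [hRhom.1 hY₁ j hj f', LinearMap.comp_zero]
  obtain ⟨N, p, hp, hpl⟩ := key E hTE hEJ
  have hsp := isSES_subtype_ker hp
  -- The kernel of the approximation of `E` is again generated by `T`, whence Ext¹(E, ker p) = 0 and
  -- `E` is a summand of a power of `T`.
  have hTZ : ExtZ Λ T (LinearMap.ker p) := ExtZ.of_lift hsp (hTpow N) fun f => by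
    obtain ⟨c, hc⟩ := hpl f
    exact ⟨_, hc⟩
  obtain ⟨N', p', hp', -⟩ := key (LinearMap.ker p) hTZ (fun j hj f => by
    ext x a i
    exact LinearMap.congr_fun (hJ j hj i (LinearMap.proj i ∘ₗ LinearMap.proj a ∘ₗ
      (LinearMap.ker p).subtype ∘ₗ f)) x)
  have hET : ExtZ Λ E T := ExtZ.of_ses_left hs hY₁T (ExtZ.pi_left fun _ => hTT)
  have hEZ : ExtZ Λ E (LinearMap.ker p) :=
    ExtZ.of_surjective_right hΛ (N := Fin N' → T)
      (ExtZ.pi_right (LinearEquiv.refl _ _) fun _ => hET) p' hp'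
  obtain ⟨σ, hσ⟩ := hEZ.exists_section hsp
  have hE : gVec P E ∈ W := gVec_mem_of_retract_pow K hΛ hP hF W hWF σ p hσ
  have hTr : gVec P (Fin r → T) ∈ W :=
    gVec_mem_of_retract_pow K hΛ hP hF W hWF LinearMap.id LinearMap.id rfl
  have hY : gVec P (P s ⧸ LinearMap.range p₁) ∈ W := by
    rw [hs.gVec_add K hΛ hP] at hE
    exact (W.add_mem_iff_left hTr).1 hE
  -- The trace is projective, hence a summand of a power of `R`, so its g-vector is a combination of
  -- the `e j` with `j ∈ J`.
  obtain ⟨σ', hσ'⟩ := Module.projective_lifting_property p₁.rangeRestrict LinearMap.id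
    p₁.surjective_rangeRestrict
  have ht : gVec P (LinearMap.range p₁) ∈ W := by
    refine gVec_mem_of_retract_pow K hΛ hP ((hP.isRigidFamily hΛ).comp _ Subtype.val_injective) W
      (fun j : J => ?_) σ' p₁.rangeRestrict hσ'
    rw [Function.comp_apply, gVec_projective K hΛ hP]
    exact hWJ j.1 j.2
  rw [← gVec_projective K hΛ hP, (isSES_subtype_mkQ (LinearMap.range p₁)).gVec_add K hΛ hP]
  exact W.add_mem ht hY

end Perpendicular

end WallChamber

namespace WallChamber

universe w u

/-! ### Signs of the pairing on a cone of g-vectors. -/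

section Cones

variable {Λ : Type u} [Ring Λ]
  {n : ℕ} {P : Fin n → ModuleCat.{u} Λ}

/-- The `g`-vectors of the members of a family of modules and of shifted projectives. -/
noncomputable def compVec (P : Fin n → ModuleCat.{u} Λ) {ι : Type} (F : ι → ModuleCat.{u} Λ)
    (J : Finset (Fin n)) : ι ⊕ J → Fin n → ℝ :=
  Sum.elim (fun i => gVec P (F i)) fun j => -Pi.single j.1 1

theorem hom_eq_zero_of_surjective {Q Y N : Type u} [AddCommGroup Q] [Module Λ Q] [AddCommGroup Y]
    [Module Λ Y] [AddCommGroup N] [Module Λ N] [Module.Projective Λ Q] (p : Y →ₗ[Λ] N)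
    (hp : Function.Surjective p) (h : ∀ f : Q →ₗ[Λ] Y, f = 0) (f : Q →ₗ[Λ] N) : f = 0 := by
  obtain ⟨g, rfl⟩ := Module.projective_lifting_property p f hp
  rw [h g, LinearMap.comp_zero]

variable (K : Type w) [Field K] [Algebra K Λ] [Module.Finite K Λ] [IsNoetherianRing Λ]
variable {ι : Type} {F : ι → ModuleCat.{u} Λ} {J : Finset (Fin n)}
  {X : Type u} [AddCommGroup X] [Module Λ X] [Module.Finite Λ X]

theorem compVec_inl_dot (hΛ : IsHereditary Λ) (hP : IsIndecProjectiveList P) (i : ι)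
    (hF : Module.Finite Λ (F i)) :
    compVec P F J (Sum.inl i) ⬝ᵥ dimVec K P (ModuleCat.of Λ X) = eulerForm K Λ (F i) X :=
  gVec_dot K hΛ hP

theorem compVec_inr_dot (j : J) :
    compVec P F J (Sum.inr j) ⬝ᵥ dimVec K P (ModuleCat.of Λ X) = -(homDim K Λ (P j) X : ℝ) := by
  rw [compVec, Sum.elim_inr, neg_dotProduct, single_dotProduct, one_mul, dimVec_apply]

theorem sum_smul_dot {κ : Type*} [Fintype κ] (a : κ → ℝ) (v : κ → Fin n → ℝ) (d : Fin n → ℝ) :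
    (∑ x, a x • v x) ⬝ᵥ d = ∑ x, a x * (v x ⬝ᵥ d) := by
  rw [sum_dotProduct]
  exact Finset.sum_congr rfl fun x _ => smul_dotProduct _ _ _

/-- Pairing a relation with the dimension vector of `F l` removes the shifted projectives and leaves
the nonsingular matrix of dim Hom(F i, F l). What then remains is a relation among distinct standard
basis vectors. -/
theorem compVec_linearIndependent (K : Type w) [Field K] [Algebra K Λ]
    [Module.Finite K Λ] [IsArtinianRing Λ] [Fintype ι] (hΛ : IsHereditary Λ)
    (hP : IsIndecProjectiveList P) (hF : IsRigidFamily F)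
    (hJ : ∀ j ∈ J, ∀ i, ∀ f : P j →ₗ[Λ] F i, f = 0) :
    LinearIndependent ℝ (compVec P F J) := by
  have hfin := hF.finite
  rw [Fintype.linearIndependent_iff]
  intro a ha
  have h1 : (fun i => a (Sum.inl i)) = 0 := by
    refine hF.eq_zero_of_sum_homDim K hΛ _ fun l => ?_
    have h2 := congrArg (fun v => v ⬝ᵥ dimVec K P (ModuleCat.of Λ (F l))) ha
    simp only [sum_smul_dot, zero_dotProduct] at h2
    rw [Fintype.sum_sum_type] at h2
    rw [Finset.sum_eq_zero (s := (Finset.univ : Finset J)), add_zero] at h2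
    · rw [← h2]
      refine Finset.sum_congr rfl fun i _ => ?_
      rw [compVec_inl_dot K hΛ hP i (hfin i), (eulerForm_eq_homDim_iff K).2 (hF.ext i l)]
      simp
    · intro j _
      rw [compVec_inr_dot, homDim_eq_zero_of_forall K (hJ j.1 j.2 l)]
      simp
  rintro (i | j)
  · exact congrFun h1 i
  · rw [Fintype.sum_sum_type, Finset.sum_eq_zero (s := (Finset.univ : Finset ι)), zero_add] at ha
    · have h2 := congrFun ha j.1
      rw [Finset.sum_apply, Finset.sum_eq_single j] at h2
      · simpa [compVec] using h2
      · intro j' _ hj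
        have : j.1 ≠ j'.1 := fun h => hj (Subtype.ext h.symm)
        simp [compVec, this]
      · simp
    · intro i _
      rw [congrFun h1 i]; simp

/-- Removing one component leaves room for a perpendicular module. -/
theorem exists_perp (K : Type w) [Field K] [Algebra K Λ]
    [Module.Finite K Λ] [IsArtinianRing Λ] [Fintype ι] (hΛ : IsHereditary Λ)
    (hP : IsIndecProjectiveList P) (hF : IsRigidFamily F)
    (hJ : ∀ j ∈ J, ∀ i, ∀ f : P j →ₗ[Λ] F i, f = 0) (x₀ : ι ⊕ J) :
    ∃ X : ModuleCat.{u} Λ, Module.Finite Λ X ∧ Nontrivial X ∧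
      (∀ i, Sum.inl i ≠ x₀ → (∀ f : F i →ₗ[Λ] X, f = 0) ∧ ExtZ Λ (F i) X) ∧
      ∀ j, Sum.inr j ≠ x₀ → ∀ f : P j →ₗ[Λ] X, f = 0 := by
  classical
  by_contra! hcon
  have hli := compVec_linearIndependent K hΛ hP hF hJ
  -- By independence the vector of `x₀` lies outside the span `W` of the others; without a nonzero
  -- perpendicular module, `W` would be everything.
  let W := Submodule.span ℝ (compVec P F J '' {x | x ≠ x₀})
  have hW : ∀ x, x ≠ x₀ → compVec P F J x ∈ W := fun x hx =>
    Submodule.subset_span ⟨x, hx, rfl⟩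
  have hnot : compVec P F J x₀ ∉ W := by
    refine hli.notMem_span_image ?_
    simp
  have htop : W = ⊤ := by
    refine span_eq_top_of_perp_eq_zero K hΛ hP
      (hF.comp (Subtype.val : {i : ι // Sum.inl i ≠ x₀} → ι) Subtype.val_injective)
      (J.filter fun j => ∀ h : j ∈ J, (Sum.inr ⟨j, h⟩ : ι ⊕ J) ≠ x₀)
      (fun j hj i f => hJ j (Finset.mem_filter.1 hj).1 i.1 f) ?_ W (fun i => hW _ i.2) ?_
    · intro X hX h1 h2 h3
      by_contra hX'
      obtain ⟨j, hj, f, hf⟩ := hcon X hX (not_subsingleton_iff_nontrivial.1 hX')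
        fun i hi => ⟨h1 ⟨i, hi⟩, h2 ⟨i, hi⟩⟩
      exact hf (h3 j.1 (Finset.mem_filter.2 ⟨j.2, fun _ => hj⟩) f)
    · intro j hj
      obtain ⟨hj1, hj2⟩ := Finset.mem_filter.1 hj
      have := W.neg_mem (hW _ (hj2 hj1))
      simpa [compVec] using this
  exact hnot (htop ▸ Submodule.mem_top)

variable [Fintype ι]

/-- Pairing of the cone with modules in the torsion part. -/
theorem dot_eq_of_ext (hΛ : IsHereditary Λ) (hP : IsIndecProjectiveList P)
    (hF : ∀ i, Module.Finite Λ (F i))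
    (a : ι ⊕ J → ℝ) (hext : ∀ i, a (Sum.inl i) ≠ 0 → ExtZ Λ (F i) X)
    (hPX : ∀ j, a (Sum.inr j) ≠ 0 → ∀ f : P j →ₗ[Λ] X, f = 0) :
    (∑ x, a x • compVec P F J x) ⬝ᵥ dimVec K P (ModuleCat.of Λ X) =
      ∑ i, a (Sum.inl i) * homDim K Λ (F i) X := by
  rw [sum_smul_dot, Fintype.sum_sum_type, Finset.sum_eq_zero (s := (Finset.univ : Finset J)),
    add_zero]
  · refine Finset.sum_congr rfl fun i _ => ?_
    by_cases h : a (Sum.inl i) = 0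
    · simp [h]
    · rw [compVec_inl_dot K hΛ hP i (hF i), (eulerForm_eq_homDim_iff K).2 (hext i h)]
      simp
  · intro j _
    by_cases h : a (Sum.inr j) = 0
    · simp [h]
    · rw [compVec_inr_dot, homDim_eq_zero_of_forall K (hPX j h)]; simp

/-- Only -dim Ext¹(F i, X) or -dim Hom(P j, X) remains. -/
theorem compVec_dot_nonpos (hΛ : IsHereditary Λ) (hP : IsIndecProjectiveList P)
    (hF : ∀ i, Module.Finite Λ (F i))
    (hhom : ∀ i, ∀ f : F i →ₗ[Λ] X, f = 0) (x : ι ⊕ J) :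
    compVec P F J x ⬝ᵥ dimVec K P (ModuleCat.of Λ X) ≤ 0 := by
  rcases x with i | j
  · have := hF i
    rw [compVec_inl_dot K hΛ hP i (hF i)]
    have h1 := eulerForm_le K (Λ := Λ) (M := F i) (N := X)
    rw [homDim_eq_zero_of_forall K (hhom i)] at h1
    exact_mod_cast h1
  · rw [compVec_inr_dot]
    simp

theorem dot_pos_of_ext (hΛ : IsHereditary Λ) (hP : IsIndecProjectiveList P)
    (hF : ∀ i, Module.Finite Λ (F i))
    (a : ι ⊕ J → ℝ) (ha : ∀ x, 0 < a x) (hext : ∀ i, ExtZ Λ (F i) X)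
    (hPX : ∀ j ∈ J, ∀ f : P j →ₗ[Λ] X, f = 0) {i : ι} {f : F i →ₗ[Λ] X} (hf : f ≠ 0) :
    0 < (∑ x, a x • compVec P F J x) ⬝ᵥ dimVec K P (ModuleCat.of Λ X) := by
  have := hF
  rw [dot_eq_of_ext K hΛ hP hF a (fun i _ => hext i) fun j _ => hPX j.1 j.2]
  refine Finset.sum_pos' (fun i _ => mul_nonneg (ha _).le (Nat.cast_nonneg _))
    ⟨i, Finset.mem_univ i, mul_pos (ha _) ?_⟩
  exact_mod_cast (homDim_pos_iff K).2 ⟨f, hf⟩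

/-- No nonzero module is semistable for a vector in the interior of the cone. -/
theorem subsingleton_of_semistable (hΛ : IsHereditary Λ) (hP : IsIndecProjectiveList P)
    (hF : ∀ i, Module.Finite Λ (F i))
    (hrig : IsRigidFamily F)
    (hJ : ∀ j ∈ J, ∀ i, ∀ f : P j →ₗ[Λ] F i, f = 0)
    (hspan : Submodule.span ℝ (Set.range (compVec P F J)) = ⊤)
    (a : ι ⊕ J → ℝ) (ha : ∀ x, 0 < a x)
    (h0 : (∑ x, a x • compVec P F J x) ⬝ᵥ dimVec K P (ModuleCat.of Λ X) = 0)
    (hN : ∀ N : Submodule Λ X,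
      (∑ x, a x • compVec P F J x) ⬝ᵥ dimVec K P (ModuleCat.of Λ N) ≤ 0) : Subsingleton X := by
  have hPf := hP.finite
  have hPp := hP.projective
  -- The image of a nonzero map is a quotient of `F i`, so it inherits the vanishing of Ext¹ from
  -- the `F l` and of Hom from the `P j`. It would be a submodule with positive pairing.
  have hhom : ∀ i, ∀ f : F i →ₗ[Λ] X, f = 0 := by
    intro i f
    by_contra hf
    refine (hN (LinearMap.range f)).not_gt ?_
    refine dot_pos_of_ext K hΛ hP hF a ha
      (fun l => (hrig.ext l i).of_surjective_right hΛ f.rangeRestrict f.surjective_rangeRestrict)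
      (fun j hj => hom_eq_zero_of_surjective f.rangeRestrict f.surjective_rangeRestrict (hJ j hj i))
      (f := f.rangeRestrict) fun h => hf ?_
    ext x
    exact congrArg Subtype.val (LinearMap.congr_fun h x)
  -- A sum of nonpositive terms with positive weights is zero only if every term is.
  have hw : ∀ x, compVec P F J x ⬝ᵥ dimVec K P (ModuleCat.of Λ X) = 0 := by
    rw [sum_smul_dot] at h0
    have h1 := (Finset.sum_eq_zero_iff_of_nonpos fun x _ =>
      mul_nonpos_of_nonneg_of_nonpos (ha x).le (compVec_dot_nonpos K hΛ hP hF hhom x)).1 h0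
    exact fun x => (mul_eq_zero.1 (h1 x (Finset.mem_univ x))).resolve_left (ha x).ne'
  have hall : ∀ v : Fin n → ℝ, v ⬝ᵥ dimVec K P (ModuleCat.of Λ X) = 0 := by
    intro v
    have hv : v ∈ Submodule.span ℝ (Set.range (compVec P F J)) := hspan ▸ Submodule.mem_top
    induction hv using Submodule.span_induction with
    | mem x hx =>
      obtain ⟨y, rfl⟩ := hx
      exact hw y
    | zero => exact zero_dotProduct _
    | add x y _ _ hx hy => rw [add_dotProduct, hx, hy, add_zero]
    | smul c x _ hx => rw [smul_dotProduct, hx, smul_zero]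
  refine hP.subsingleton K fun i f => ?_
  refine (homDim_eq_zero_iff K (N := X)).1 ?_ f
  have := hall (Pi.single i 1)
  rw [single_dotProduct, one_mul, dimVec_apply] at this
  exact_mod_cast this

end Cones

/-! ### Walls meet the closed cone exactly in its boundary. -/

section WallsAndCones

variable {Λ : Type u} [Ring Λ]
  {n : ℕ} {P : Fin n → ModuleCat.{u} Λ}
variable (K : Type w) [Field K] [Algebra K Λ] [Module.Finite K Λ] [IsNoetherianRing Λ]

/-- A vector with a nonzero semistable module lies on a wall. -/
theorem mem_walls_of_semistable (hP : IsIndecProjectiveList P) (g : Fin n → ℝ) :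
    ∀ X : ModuleCat.{u} Λ, Module.Finite Λ X → Nontrivial X → g ∈ domain K P X →
      g ∈ walls K P := by
  refine indec_induction K (p := fun X => Nontrivial X → g ∈ domain K P X → g ∈ walls K P)
    ?_ ?_ ?_
  · intro X h1 h2
    exact absurd h1 (not_subsingleton_iff_nontrivial.2 h2)
  · intro X hX hi _ hg
    exact ⟨X, hX, (indecomposable_iff X).2 hi, hg⟩
  · rintro X hX A B hAB hA hB hnt ⟨h0, hN⟩
    have e := Submodule.prodEquivOfIsCompl A B hAB
    -- Both pairings are nonpositive with sum zero, so both vanish and each summand is semistable.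
    have hsum : g ⬝ᵥ dimVec K P (ModuleCat.of Λ A) + g ⬝ᵥ dimVec K P (ModuleCat.of Λ B) = 0 := by
      rw [← isSES_inl_snd.dot_dimVec K hP, dimVec_congr K e]
      exact h0
    have hA0 := hN A
    have hB0 := hN B
    have hsub : ∀ (S : Submodule Λ X) (N : Submodule Λ S),
        g ⬝ᵥ dimVec K P (ModuleCat.of Λ N) ≤ 0 := fun S N => by
      rw [dimVec_congr K (Submodule.equivMapOfInjective S.subtype S.injective_subtype N)]
      exact hN _
    by_cases hA' : Nontrivial A
    · exact hA hA' ⟨by linarith, hsub A⟩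
    · have : Nontrivial B := by
        rw [Submodule.nontrivial_iff_ne_bot]
        rintro rfl
        have hAt : A = ⊤ := eq_top_of_isCompl_bot hAB
        subst hAt
        exact hA' (Submodule.nontrivial_iff_ne_bot.2 top_ne_bot)
      exact hB this ⟨by linarith, hsub B⟩

theorem not_mem_walls_of_pos {ι : Type} [Fintype ι] {F : ι → ModuleCat.{u} Λ}
    {J : Finset (Fin n)} (hΛ : IsHereditary Λ) (hP : IsIndecProjectiveList P)
    (hF : IsRigidFamily F) (hJ : ∀ j ∈ J, ∀ i, ∀ f : P j →ₗ[Λ] F i, f = 0)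
    (hspan : Submodule.span ℝ (Set.range (compVec P F J)) = ⊤)
    (a : ι ⊕ J → ℝ) (ha : ∀ x, 0 < a x) : ∑ x, a x • compVec P F J x ∉ walls K P := by
  rintro ⟨M, hM, hi, h0, hN⟩
  have h1 := subsingleton_of_semistable K hΛ hP hF.finite hF hJ hspan a ha h0 hN
  exact not_subsingleton_iff_nontrivial.2 ((indecomposable_iff M).1 hi).1 h1

/-- Let `X` be perpendicular to all components but `x₀`. On the face where `x₀` has coefficient
zero, `X` pairs to zero. Its quotients still have no extensions from the other `F i` and no maps
from the other `P j`, so they pair nonnegatively and submodules of `X` pair nonpositively. -/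
theorem mem_walls_of_eq_zero [IsArtinianRing Λ] {ι : Type} [Fintype ι] {F : ι → ModuleCat.{u} Λ}
    {J : Finset (Fin n)} (hΛ : IsHereditary Λ) (hP : IsIndecProjectiveList P)
    (hF : IsRigidFamily F) (hJ : ∀ j ∈ J, ∀ i, ∀ f : P j →ₗ[Λ] F i, f = 0)
    (a : ι ⊕ J → ℝ) (ha : ∀ x, 0 ≤ a x) (x₀ : ι ⊕ J) (hx₀ : a x₀ = 0) :
    ∑ x, a x • compVec P F J x ∈ walls K P := by
  obtain ⟨X, hX, hnt, h1, h2⟩ := exists_perp K hΛ hP hF hJ x₀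
  have hFf := hF.finite
  have hPp := hP.projective
  have hne : ∀ {x}, a x ≠ 0 → x ≠ x₀ := fun h h' => h (h' ▸ hx₀)
  have h0 : (∑ x, a x • compVec P F J x) ⬝ᵥ dimVec K P (ModuleCat.of Λ X) = 0 := by
    rw [dot_eq_of_ext K hΛ hP hFf a (fun i h => (h1 i (hne h)).2) fun j h => h2 j (hne h)]
    refine Finset.sum_eq_zero fun i _ => ?_
    by_cases h : a (Sum.inl i) = 0
    · rw [h, zero_mul]
    · rw [homDim_eq_zero_of_forall K (h1 i (hne h)).1]; simp
  refine mem_walls_of_semistable K hP _ X hX hnt ⟨h0, fun N => ?_⟩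
  have h3 := (isSES_subtype_mkQ N).dot_dimVec K hP (∑ x, a x • compVec P F J x)
  have h4 : 0 ≤ (∑ x, a x • compVec P F J x) ⬝ᵥ dimVec K P (ModuleCat.of Λ (X ⧸ N)) := by
    rw [dot_eq_of_ext K hΛ hP hFf a
      (fun i h => (h1 i (hne h)).2.of_surjective_right hΛ N.mkQ N.mkQ_surjective)
      fun j h => hom_eq_zero_of_surjective N.mkQ N.mkQ_surjective (h2 j (hne h))]
    exact Finset.sum_nonneg fun i _ => mul_nonneg (ha _) (Nat.cast_nonneg _)
  have h5 : (∑ x, a x • compVec P F J x) ⬝ᵥ dimVec K P (ModuleCat.of Λ X) =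
    _ + _ := h3
  linarith

/-- A simplicial cone whose interior avoids `W` and whose boundary lies in `W` is a connected
component of the complement of `W`. -/
theorem connectedComponentIn_eq_of_cone {κ E : Type*} [Fintype κ] [NormedAddCommGroup E]
    [NormedSpace ℝ E] [FiniteDimensional ℝ E] (b : Module.Basis κ ℝ E) (W : Set E)
    (hpos : ∀ a : κ → ℝ, (∀ x, 0 < a x) → ∑ x, a x • b x ∉ W)
    (hbd : ∀ a : κ → ℝ, (∀ x, 0 ≤ a x) → ∀ x₀, a x₀ = 0 → ∑ x, a x • b x ∈ W)
    {g : E} (hg : ∀ x, 0 < b.repr g x) :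
    connectedComponentIn Wᶜ g = {v | ∀ x, 0 < b.repr v x} := by
  have hcont : ∀ x, Continuous fun v => b.repr v x := fun x =>
    (LinearMap.continuous_of_finiteDimensional (b.coord x))
  have hmem : g ∈ Wᶜ := by
    have := hpos _ hg
    rwa [b.sum_repr] at this
  apply Set.Subset.antisymm
  · have hopen : IsOpen {v | ∀ x, 0 < b.repr v x} := by
      simp only [Set.ofPred_forall]
      exact isOpen_iInter_of_finite fun x => isOpen_lt continuous_const (hcont x)
    have hclosed : IsClosed {v | ∀ x, 0 ≤ b.repr v x} := by
      simp only [Set.ofPred_forall]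
      exact isClosed_iInter fun x => isClosed_le continuous_const (hcont x)
    have hpre := isPreconnected_connectedComponentIn (x := g) (F := Wᶜ)
    -- Off `W` the closed cone equals the open one. The cone is thus both open and closed relative
    -- to the complement of `W`, so a connected set meeting it cannot leave it.
    have hcover : ∀ v ∈ Wᶜ, (∀ x, 0 ≤ b.repr v x) → ∀ x, 0 < b.repr v x := by
      intro v hv h x
      refine lt_of_le_of_ne (h x) fun h0 => hv ?_
      have := hbd _ h x h0.symm
      rwa [b.sum_repr] at this
    intro v hv
    by_contra hv'
    obtain ⟨z, -, hz1, hz2⟩ := hpre _ _ hopen hclosed.isOpen_compl (fun y hy => by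
      by_cases h : ∀ x, 0 ≤ b.repr y x
      · exact Or.inl (hcover y (connectedComponentIn_subset _ _ hy) h)
      · exact Or.inr h) ⟨g, mem_connectedComponentIn hmem, hg⟩
      ⟨v, hv, fun h => hv' (hcover v (connectedComponentIn_subset _ _ hv) h)⟩
    exact hz2 fun x => (hz1 x).le
  · refine IsPreconnected.subset_connectedComponentIn ?_ hg fun v hv => ?_
    · refine Convex.isPreconnected fun v hv v' hv' s t hs ht hst x => ?_
      rw [map_add, map_smul, map_smul, Finsupp.add_apply, Finsupp.smul_apply, Finsupp.smul_apply]
      have h1 : 0 < b.repr v x := hv x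
      have h2 : 0 < b.repr v' x := hv' x
      simp only [smul_eq_mul]
      rcases hs.eq_or_lt with rfl | hs'
      · have : t = 1 := by linarith
        subst this; linarith
      · have := mul_pos hs' h1
        have := mul_nonneg ht h2.le
        linarith
    · have := hpos _ hv
      rwa [b.sum_repr] at this

end WallsAndCones

/-! ### The cone and the class Fac of a cluster-tilting object. -/

section ClusterTilting

variable {Λ : Type u} [Ring Λ]
  {n : ℕ} {P : Fin n → ModuleCat.{u} Λ}

theorem ClusterTiltingObject.isRigidFamily (C : ClusterTiltingObject P) : IsRigidFamily C.T :=
  ⟨fun i => (C.exceptional i).finite, fun i => (C.exceptional i).brick, C.injective,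
    fun i j => (subsingleton_ext_iff _ _).1 (C.ext_eq_zero i j)⟩

variable [IsNoetherianRing Λ] [IsArtinianRing Λ]

theorem ClusterTiltingObject.linearIndependent (K : Type w) [Field K] [Algebra K Λ]
    [Module.Finite K Λ] (hΛ : IsHereditary Λ)
    (hP : IsIndecProjectiveList P) (C : ClusterTiltingObject P) :
    LinearIndependent ℝ (compVec P C.T C.J) :=
  compVec_linearIndependent K hΛ hP C.isRigidFamily C.hom_eq_zero

theorem ClusterTiltingObject.span_eq_top (K : Type w) [Field K] [Algebra K Λ]
    [Module.Finite K Λ] (hΛ : IsHereditary Λ)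
    (hP : IsIndecProjectiveList P) (C : ClusterTiltingObject P) :
    Submodule.span ℝ (Set.range (compVec P C.T C.J)) = ⊤ := by
  refine (C.linearIndependent K hΛ hP).span_eq_top_of_card_eq_finrank' ?_
  simp [C.card_eq]

theorem ClusterTiltingObject.mem_openCone_iff (K : Type w) [Field K] [Algebra K Λ]
    [Module.Finite K Λ] (hΛ : IsHereditary Λ)
    (hP : IsIndecProjectiveList P) (C : ClusterTiltingObject P) (g : Fin n → ℝ) :
    g ∈ C.openCone ↔ ∃ a : Fin C.k ⊕ C.J → ℝ, (∀ x, 0 < a x) ∧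
      g = ∑ x, a x • compVec P C.T C.J x := by
  have hfin := C.isRigidFamily.finite
  have hsum : ∀ a : Fin C.k ⊕ C.J → ℝ, ∑ x, a x • compVec P C.T C.J x =
      ∑ i, a (Sum.inl i) • gVec P (C.T i) -
        ∑ j : C.J, a (Sum.inr j) • Pi.single j.1 (1 : ℝ) := by
    intro a
    rw [Fintype.sum_sum_type, sub_eq_add_neg, ← Finset.sum_neg_distrib]
    simp [compVec]
  constructor
  · rintro ⟨v, a, b, hv, ha, hb, rfl⟩
    refine ⟨Sum.elim a fun j => b j.1, ?_, ?_⟩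
    · rintro (i | j)
      · exact ha i
      · exact hb j.1 j.2
    · rw [hsum]
      congr 1
      · refine Finset.sum_congr rfl fun i _ => ?_
        rw [IsGVector.eq_gVec (M := C.T i) K hΛ hP (hv i)]; rfl
      · exact (Finset.sum_coe_sort C.J fun j => b j • Pi.single j (1 : ℝ)).symm
  · rintro ⟨a, ha, rfl⟩
    classical
    -- The value `0` outside `C.J` is arbitrary; only indices in `C.J` occur in the sum.
    refine ⟨fun i => gVec P (C.T i), fun i => a (Sum.inl i),
      fun j => if h : j ∈ C.J then a (Sum.inr ⟨j, h⟩) else 0,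
      fun i => isGVector_gVec (C.T i) K hΛ hP, fun i => ha _, fun j hj => ?_, ?_⟩
    · simp only [hj, dif_pos]
      exact ha _
    · rw [hsum]
      congr 1
      rw [← Finset.sum_coe_sort C.J]
      refine Finset.sum_congr rfl fun j _ => ?_
      simp

theorem ClusterTiltingObject.connectedComponentIn_eq (K : Type w) [Field K] [Algebra K Λ]
    [Module.Finite K Λ] (hΛ : IsHereditary Λ)
    (hP : IsIndecProjectiveList P) (C : ClusterTiltingObject P) {g : Fin n → ℝ} (hg : g ∈ C.openCone) :
    connectedComponentIn (walls K P)ᶜ g = C.openCone := by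
  let b := Module.Basis.mk (C.linearIndependent K hΛ hP) (C.span_eq_top K hΛ hP).ge
  have hb : ∀ x, b x = compVec P C.T C.J x := fun x => Module.Basis.mk_apply _ _ x
  have hrepr : ∀ v, v ∈ C.openCone ↔ ∀ x, 0 < b.repr v x := by
    intro v
    rw [C.mem_openCone_iff K hΛ hP]
    simp only [← hb]
    constructor
    · rintro ⟨a, ha, rfl⟩ x
      rw [b.repr_sum_self]
      exact ha x
    · intro h
      exact ⟨_, h, (b.sum_repr v).symm⟩
  rw [connectedComponentIn_eq_of_cone b (walls K P) ?_ ?_ ((hrepr g).1 hg)]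
  · ext v
    exact (hrepr v).symm
  · intro a ha
    simp only [hb]
    exact not_mem_walls_of_pos K hΛ hP C.isRigidFamily C.hom_eq_zero (C.span_eq_top K hΛ hP) a ha
  · intro a ha x₀ hx₀
    simp only [hb]
    exact mem_walls_of_eq_zero K hΛ hP C.isRigidFamily C.hom_eq_zero a ha x₀ hx₀

theorem ClusterTiltingObject.fac_eq (K : Type w) [Field K] [Algebra K Λ]
    [Module.Finite K Λ] (hΛ : IsHereditary Λ)
    (hP : IsIndecProjectiveList P) (C : ClusterTiltingObject P) {g : Fin n → ℝ} (hg : g ∈ C.openCone) :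
    C.fac = positiveQuotientClass K P g := by
  obtain ⟨a, ha, rfl⟩ := (C.mem_openCone_iff K hΛ hP g).1 hg
  have hfin := C.isRigidFamily.finite
  have hPp := hP.projective
  ext M
  constructor
  · rintro ⟨m, p, hp⟩
    have hM : Module.Finite Λ M := Module.Finite.of_surjective p hp
    refine ⟨hM, fun N hN => ?_⟩
    have hq : Function.Surjective (N.mkQ ∘ₗ p) := N.mkQ_surjective.comp hp
    -- Since `M ⧸ N` is nonzero, some copy of some `C.T i` maps to it nontrivially, which makes the
    -- pairing strictly positive.
    obtain ⟨i, c, hic⟩ : ∃ i c, (N.mkQ ∘ₗ p) ∘ₗ LinearMap.single Λ _ i ∘ₗ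
        LinearMap.single Λ (fun _ : Fin (m i) => C.T i) c ≠ 0 := by
      by_contra! h
      have h0 : N.mkQ ∘ₗ p = 0 := LinearMap.pi_ext' fun i => LinearMap.pi_ext' fun c => by
        rw [LinearMap.comp_assoc, h i c]; rfl
      refine hN (Submodule.Quotient.subsingleton_iff.1 ⟨fun x y => ?_⟩)
      obtain ⟨x, rfl⟩ := hq x
      obtain ⟨y, rfl⟩ := hq y
      rw [h0]; rfl
    refine dot_pos_of_ext K hΛ hP hfin a ha (fun l => ?_) (fun j hj => ?_) hic
    · refine ExtZ.of_surjective_right hΛ ?_ _ hq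
      exact ExtZ.pi_right (LinearEquiv.refl _ _) fun i =>
        ExtZ.pi_right (LinearEquiv.refl _ _) fun _ => C.isRigidFamily.ext l i
    · refine hom_eq_zero_of_surjective _ hq fun f => ?_
      ext x i c
      exact LinearMap.congr_fun (C.hom_eq_zero j hj i
        (LinearMap.proj c ∘ₗ LinearMap.proj i ∘ₗ f)) x
  · rintro ⟨hM, hpos⟩
    let T := ∀ i, C.T i
    obtain ⟨r, p, hp⟩ := exists_right_approx (Λ := Λ) K T M
    have hTT : ExtZ Λ T (Fin r → T) := ExtZ.pi_right (LinearEquiv.refl _ _) fun _ =>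
      ExtZ.pi_left fun i => ExtZ.pi_right (LinearEquiv.refl _ _) fun j => C.isRigidFamily.ext i j
    have h0 := hom_quotient_range_eq_zero K hp
      (hTT.of_surjective_right hΛ p.rangeRestrict p.surjective_rangeRestrict)
    -- The quotient by the trace of `T` receives no maps from `T`, so it pairs nonpositively with
    -- `g`; the hypothesis then forces it to be zero.
    have htop : LinearMap.range p = ⊤ := by
      by_contra hne
      refine (hpos _ hne).not_ge ?_
      rw [sum_smul_dot]
      refine Finset.sum_nonpos fun x _ => mul_nonpos_of_nonneg_of_nonpos (ha x).le
        (compVec_dot_nonpos K hΛ hP hfin (fun i f => ?_) x)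
      exact eq_zero_of_comp_proj (F := fun i => C.T i) i f (h0 (f ∘ₗ LinearMap.proj i))
    let σ : multiSum C.T (fun _ => r) →ₗ[Λ] (Fin r → T) :=
      LinearMap.pi fun c => LinearMap.pi fun i => LinearMap.proj c ∘ₗ LinearMap.proj i
    exact ⟨fun _ => r, p ∘ₗ σ, (LinearMap.range_eq_top.1 htop).comp fun y =>
      ⟨fun i c => y c i, rfl⟩⟩

end ClusterTilting

end WallChamber

namespace WallChamber

universe w u

/-! ### Approximations by a torsion class and its Ext-projectives. -/

section TorsionClass

variable {Λ : Type u} [Ring Λ] {𝒯 : Set (ModuleCat.{u} Λ)}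
variable {A B C M N X : Type u}
  [AddCommGroup A] [Module Λ A] [AddCommGroup B] [Module Λ B] [AddCommGroup C] [Module Λ C]
  [AddCommGroup M] [Module Λ M] [AddCommGroup N] [Module Λ N] [AddCommGroup X] [Module Λ X]

theorem IsTorsionClass.of_surjective (h𝒯 : IsTorsionClass 𝒯) (hM : ModuleCat.of Λ M ∈ 𝒯)
    (p : M →ₗ[Λ] N) (hp : Function.Surjective p) : ModuleCat.of Λ N ∈ 𝒯 :=
  h𝒯.quotient_mem _ hM (ModuleCat.of Λ N) p hp

theorem IsTorsionClass.of_ses (h𝒯 : IsTorsionClass 𝒯) {i : A →ₗ[Λ] B} {q : B →ₗ[Λ] C}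
    (h : IsSES i q) (hA : ModuleCat.of Λ A ∈ 𝒯) (hC : ModuleCat.of Λ C ∈ 𝒯) :
    ModuleCat.of Λ B ∈ 𝒯 :=
  h𝒯.extension_mem (ModuleCat.of Λ A) (ModuleCat.of Λ B) (ModuleCat.of Λ C) i q h.inj h.exact
    h.surj hA hC

theorem IsTorsionClass.pi_mem (h𝒯 : IsTorsionClass 𝒯) (m : ℕ) :
    ∀ (Y : Fin m → Type u) [∀ a, AddCommGroup (Y a)] [∀ a, Module Λ (Y a)],
      (∀ a, ModuleCat.of Λ (Y a) ∈ 𝒯) → ModuleCat.of Λ (∀ a, Y a) ∈ 𝒯 := by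
  induction m with
  | zero =>
    intro Y _ _ _
    exact h𝒯.zero_mem _ (inferInstanceAs (Subsingleton (∀ a, Y a)))
  | succ m ih =>
    intro Y _ _ hY
    have hs : IsSES (LinearMap.single Λ Y 0)
        (LinearMap.pi fun a : Fin m => LinearMap.proj (R := Λ) (φ := Y) a.succ) := by
      refine ⟨Pi.single_injective _, fun y => ⟨fun hy => ⟨y 0, ?_⟩, ?_⟩, fun y => ?_⟩
      · ext a
        refine Fin.cases ?_ (fun a => ?_) a
        · simp
        · have h1 : y a.succ = 0 := congrFun hy a
          simp [h1]
      · rintro ⟨x, rfl⟩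
        ext a
        simp
      · exact ⟨Fin.cons 0 y, rfl⟩
    exact h𝒯.of_ses hs (hY 0) (ih _ fun a => hY a.succ)

theorem exists_equiv_of_isCompl {S T : Submodule Λ M} (h : IsCompl S T) :
    ∃ (s : S →ₗ[Λ] M) (r : M →ₗ[Λ] S) (s' : T →ₗ[Λ] M) (r' : M →ₗ[Λ] T),
      r ∘ₗ s = LinearMap.id ∧ r' ∘ₗ s' = LinearMap.id ∧ s ∘ₗ r + s' ∘ₗ r' = LinearMap.id := by
  let e := Submodule.prodEquivOfIsCompl S T h
  refine ⟨e.toLinearMap ∘ₗ LinearMap.inl Λ S T, LinearMap.fst Λ S T ∘ₗ e.symm.toLinearMap,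
    e.toLinearMap ∘ₗ LinearMap.inr Λ S T, LinearMap.snd Λ S T ∘ₗ e.symm.toLinearMap, ?_, ?_, ?_⟩
  · ext x; simp
  · ext x; simp
  · ext x
    simp only [LinearMap.add_apply, LinearMap.comp_apply, LinearEquiv.coe_coe, ← map_add]
    rw [LinearMap.inl_apply, LinearMap.inr_apply]
    simp

theorem surjective_of_comp_eq_id {r : M →ₗ[Λ] N} {s : N →ₗ[Λ] M} (h : r ∘ₗ s = LinearMap.id) :
    Function.Surjective r := fun x => ⟨s x, LinearMap.congr_fun h x⟩

/-- `Ext¹(-, N)` of a cokernel vanishes if maps to `N` extend. -/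
theorem ExtZ.of_extend [Module.Finite Λ B] {i : A →ₗ[Λ] B} {q : B →ₗ[Λ] C} (hs : IsSES i q)
    (hB : ExtZ Λ B N) (hl : ∀ f : A →ₗ[Λ] N, ∃ f' : B →ₗ[Λ] N, f' ∘ₗ i = f) : ExtZ Λ C N := by
  obtain ⟨m, p, hp⟩ := Module.Finite.exists_fin' Λ B
  have h1 := isSES_subtype_ker hp
  have h2 := h1.comap (LinearMap.range i)
  have h3 : IsSES ((LinearMap.range i).comap p).subtype (q ∘ₗ p) := by
    refine ⟨Subtype.val_injective, fun y => ?_, hs.surj.comp hp⟩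
    simp [hs.exact (p y)]
  refine ExtZ.of_presentation h3 fun f => ?_
  obtain ⟨g, hg⟩ := hB _ _ h1 (f ∘ₗ (LinearMap.ker p).subtype.codRestrict
    ((LinearMap.range i).comap p) fun a => by simp)
  -- After subtracting `g`, which agrees with `f` on the kernel of `p`, the map lives on the image
  -- of `A`; there the hypothesis extends it to `B`.
  obtain ⟨k, hk⟩ := h2.exists_desc (f - g ∘ₗ ((LinearMap.range i).comap p).subtype) (by
    ext a
    have := LinearMap.congr_fun hg a
    simp only [LinearMap.comp_apply, LinearMap.sub_apply, LinearMap.zero_apply] at this ⊢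
    rw [sub_eq_zero]
    exact this.symm)
  obtain ⟨k', hk'⟩ := hl (k ∘ₗ (LinearEquiv.ofInjective i hs.inj).toLinearMap)
  refine ⟨g + k' ∘ₗ p, LinearMap.ext fun x => ?_⟩
  have h4 : k ⟨p x.1, x.2⟩ = f x - g x.1 := LinearMap.congr_fun hk x
  obtain ⟨a, ha⟩ := x.2
  have h5 : k' (i a) = k ⟨i a, ⟨a, rfl⟩⟩ := LinearMap.congr_fun hk' a
  have ha' : i a = p x.1 := ha
  have h6 : k' (p x.1) = f x - g x.1 :=
    (congrArg k' ha'.symm).trans (h5.trans ((congrArg k (Subtype.ext ha')).trans h4))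
  change g x.1 + k' (p x.1) = f x
  rw [h6, add_sub_cancel]

/-- Representatives of finitely many isomorphism classes. -/
theorem exists_representatives (G : ModuleCat.{u} Λ → Prop)
    (hG : ∀ X Y : ModuleCat.{u} Λ, Nonempty (X ≅ Y) → G X → G Y) (s : Finset (ModuleCat.{u} Λ))
    (hs : ∀ X, G X → ∃ N ∈ s, Nonempty (X ≅ N)) :
    ∃ (m : ℕ) (F : Fin m → ModuleCat.{u} Λ), (∀ a, G (F a)) ∧
      (∀ a b, Nonempty (F a ≅ F b) → a = b) ∧ ∀ X, G X → ∃ a, Nonempty (X ≅ F a) := by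
  classical
  let q : ModuleCat.{u} Λ → Quotient (isIsomorphicSetoid (ModuleCat.{u} Λ)) := fun X => ⟦X⟧
  have hq : ∀ X Y, q X = q Y ↔ Nonempty (X ≅ Y) := fun X Y => Quotient.eq
  let t := (s.filter G).image q
  have hout : ∀ x, q (Quotient.out x) = x := fun x => Quotient.out_eq x
  refine ⟨t.card, fun a => (t.equivFin.symm a).1.out, fun a => ?_, fun a b hab => ?_, fun X hX => ?_⟩
  · obtain ⟨N, hN, hNa⟩ := Finset.mem_image.1 (t.equivFin.symm a).2
    rw [← hout (t.equivFin.symm a).1] at hNa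
    exact hG _ _ ((hq _ _).1 hNa) (Finset.mem_filter.1 hN).2
  · have := (hq _ _).2 hab
    rw [hout, hout] at this
    exact t.equivFin.symm.injective (Subtype.ext this)
  · obtain ⟨N, hN, hXN⟩ := hs X hX
    have hNt : q X ∈ t := by
      rw [(hq _ _).2 hXN]
      exact Finset.mem_image_of_mem _ (Finset.mem_filter.2 ⟨hN, hG _ _ hXN hX⟩)
    refine ⟨t.equivFin ⟨q X, hNt⟩, (hq _ _).1 ?_⟩
    rw [hout, Equiv.symm_apply_apply]

variable [IsNoetherianRing Λ]

/-- Left approximations by a torsion class over a ring of finite representation type. -/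
theorem IsTorsionClass.exists_left_approx (K : Type w) [Field K] [Algebra K Λ] [Module.Finite K Λ]
    (h𝒯 : IsTorsionClass 𝒯) (hfin : IsOfFiniteType Λ) (Q : Type u) [AddCommGroup Q] [Module Λ Q]
    [Module.Finite Λ Q] :
    ∃ T : ModuleCat.{u} Λ, T ∈ 𝒯 ∧ ∃ α : Q →ₗ[Λ] T,
      ∀ X ∈ 𝒯, ∀ f : Q →ₗ[Λ] X, ∃ s : T →ₗ[Λ] X, s ∘ₗ α = f := by
  classical
  obtain ⟨s, hs⟩ := hfin
  let t := s.filter (· ∈ 𝒯)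
  let F : Fin t.card → ModuleCat.{u} Λ := fun a => (t.equivFin.symm a).1
  have hF : ∀ a, F a ∈ 𝒯 := fun a => (Finset.mem_filter.1 (t.equivFin.symm a).2).2
  have hFf : ∀ a, Module.Finite Λ (F a) := fun a => h𝒯.finite _ (hF a)
  choose r p hp using fun a => WallChamber.exists_left_approx (Λ := Λ) K Q (F a)
  refine ⟨ModuleCat.of Λ (∀ a, Fin (r a) → F a), h𝒯.pi_mem _ _ fun a => h𝒯.pi_mem _ _ fun _ => hF a,
    LinearMap.pi p, fun X hX => ?_⟩
  refine indec_induction K (p := fun X => X ∈ 𝒯 → ∀ f : Q →ₗ[Λ] X,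
    ∃ s : (∀ a, Fin (r a) → F a) →ₗ[Λ] X, s ∘ₗ LinearMap.pi p = f) ?_ ?_ ?_ X (h𝒯.finite X hX) hX
  · intro M hM _ f
    exact ⟨0, LinearMap.ext fun x => Subsingleton.elim _ _⟩
  · intro M hM hi hM𝒯 f
    obtain ⟨N, hN, ⟨e⟩⟩ := hs M hM ((indecomposable_iff M).2 hi)
    have hN𝒯 : N ∈ 𝒯 := h𝒯.quotient_mem M hM𝒯 N e.toLinearEquiv.toLinearMap
      e.toLinearEquiv.surjective
    have hNt : N ∈ t := Finset.mem_filter.2 ⟨hN, hN𝒯⟩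
    have haN : F (t.equivFin ⟨N, hNt⟩) = N := by simp [F]
    have ⟨e'⟩ : Nonempty (M ≅ F (t.equivFin ⟨N, hNt⟩)) := by rw [haN]; exact ⟨e⟩
    obtain ⟨σ, hσ⟩ := hp _ (e'.toLinearEquiv.toLinearMap ∘ₗ f)
    refine ⟨e'.toLinearEquiv.symm.toLinearMap ∘ₗ σ ∘ₗ LinearMap.proj _, LinearMap.ext fun x => ?_⟩
    have := LinearMap.congr_fun hσ x
    apply e'.toLinearEquiv.injective
    simpa using this
  · intro M hM S T hST hS hT hM𝒯 f
    obtain ⟨i, π, i', π', h1, h2, h3⟩ := exists_equiv_of_isCompl hST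
    obtain ⟨σ, hσ⟩ := hS (h𝒯.of_surjective hM𝒯 π (surjective_of_comp_eq_id h1)) (π ∘ₗ f)
    obtain ⟨σ', hσ'⟩ := hT (h𝒯.of_surjective hM𝒯 π' (surjective_of_comp_eq_id h2)) (π' ∘ₗ f)
    refine ⟨i ∘ₗ σ + i' ∘ₗ σ', ?_⟩
    rw [LinearMap.add_comp, LinearMap.comp_assoc, LinearMap.comp_assoc]
    refine (congrArg₂ (fun a b => i ∘ₗ a + i' ∘ₗ b) hσ hσ').trans ?_
    rw [← LinearMap.comp_assoc, ← LinearMap.comp_assoc, ← LinearMap.add_comp, h3, LinearMap.id_comp]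

/-- Left minimal approximations. -/
theorem IsTorsionClass.exists_minimal_left_approx (K : Type w) [Field K] [Algebra K Λ]
    [Module.Finite K Λ] (h𝒯 : IsTorsionClass 𝒯) (hfin : IsOfFiniteType Λ) (Q : Type u)
    [AddCommGroup Q] [Module Λ Q] [Module.Finite Λ Q] :
    ∃ T : ModuleCat.{u} Λ, T ∈ 𝒯 ∧ ∃ α : Q →ₗ[Λ] T,
      (∀ X ∈ 𝒯, ∀ f : Q →ₗ[Λ] X, ∃ s : T →ₗ[Λ] X, s ∘ₗ α = f) ∧
      ∀ h : T →ₗ[Λ] T, h ∘ₗ α = α → Function.Bijective h := by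
  classical
  -- Choose an approximation of least size. If `h ∘ α = α` and `h` were not surjective, its range
  -- would give a smaller one.
  have hex : ∃ d : ℕ, ∃ T : ModuleCat.{u} Λ, homDim K Λ Λ T = d ∧ T ∈ 𝒯 ∧ ∃ α : Q →ₗ[Λ] T,
      ∀ X ∈ 𝒯, ∀ f : Q →ₗ[Λ] X, ∃ s : T →ₗ[Λ] X, s ∘ₗ α = f := by
    obtain ⟨T, h1, h2⟩ := h𝒯.exists_left_approx K hfin Q
    exact ⟨_, T, rfl, h1, h2⟩
  obtain ⟨T, hT, hT𝒯, α, hα⟩ := Nat.find_spec hex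
  have hTf := h𝒯.finite T hT𝒯
  refine ⟨T, hT𝒯, α, hα, fun h hh => ?_⟩
  have hsurj : Function.Surjective h := by
    rw [← LinearMap.range_eq_top]
    by_contra hne
    have hlt := homDim_self_submodule_lt K hne
    rw [hT] at hlt
    refine Nat.find_min hex hlt ⟨ModuleCat.of Λ (LinearMap.range h), rfl,
      h𝒯.of_surjective (M := T) hT𝒯 h.rangeRestrict h.surjective_rangeRestrict,
      h.rangeRestrict ∘ₗ α, fun X hX f => ?_⟩
    obtain ⟨s, rfl⟩ := hα X hX f
    refine ⟨s ∘ₗ (LinearMap.range h).subtype, LinearMap.ext fun x => ?_⟩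
    exact congrArg s (LinearMap.congr_fun hh x)
  exact IsNoetherian.bijective_of_surjective_endomorphism h hsurj

/-- The approximation sequence of a projective module: its middle and right term are
`Ext`-projective in the torsion class, and its kernel has no maps to the torsion class. -/
theorem IsTorsionClass.exists_ext_projective (K : Type w) [Field K] [Algebra K Λ]
    [Module.Finite K Λ] (hΛ : IsHereditary Λ) (h𝒯 : IsTorsionClass 𝒯) (hfin : IsOfFiniteType Λ)
    (Q : Type u) [AddCommGroup Q] [Module Λ Q] [Module.Finite Λ Q] [Module.Projective Λ Q] :
    ∃ T : ModuleCat.{u} Λ, T ∈ 𝒯 ∧ ∃ α : Q →ₗ[Λ] T,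
      (∀ X ∈ 𝒯, ∀ f : Q →ₗ[Λ] X, ∃ s : T →ₗ[Λ] X, s ∘ₗ α = f) ∧
      (∀ Y ∈ 𝒯, ExtZ Λ T Y) ∧
      (∀ Y ∈ 𝒯, ExtZ Λ (T ⧸ LinearMap.range α) Y) ∧
      ∀ Y ∈ 𝒯, ∀ f : LinearMap.ker α →ₗ[Λ] Y, f = 0 := by
  obtain ⟨T, hT, α, hα, hmin⟩ := h𝒯.exists_minimal_left_approx K hfin Q
  have hTf := h𝒯.finite T hT
  -- The middle term `E` of an extension lies in `𝒯`. Projectivity lifts `α` to `E`, and this lift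
  -- factors through `α` as `t ∘ α`. Since `q ∘ t` fixes `α`, it is invertible by minimality, and
  -- the extension splits.
  have hext : ∀ Y ∈ 𝒯, ExtZ Λ T Y := by
    intro Y hY
    refine ExtZ.of_sections fun E _ _ i q hs => ?_
    have hE : ModuleCat.of Λ E ∈ 𝒯 := h𝒯.of_ses (A := Y) (C := T) hs hY hT
    obtain ⟨β, hβ⟩ := Module.projective_lifting_property q α hs.surj
    obtain ⟨t, ht⟩ := hα _ hE β
    have hb := hmin (q ∘ₗ t) (by rw [LinearMap.comp_assoc]; exact (congrArg (q ∘ₗ ·) ht).trans hβ)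
    let e := LinearEquiv.ofBijective _ hb
    refine ⟨t ∘ₗ e.symm.toLinearMap, LinearMap.ext fun x => ?_⟩
    exact e.apply_symm_apply x
  have hsur := α.surjective_rangeRestrict
  refine ⟨T, hT, α, hα, hext, fun Y hY => ?_, fun Y hY f => ?_⟩
  · refine ExtZ.of_extend (isSES_subtype_mkQ _) (hext Y hY) fun f => ?_
    obtain ⟨s, hs⟩ := hα Y hY (f ∘ₗ α.rangeRestrict)
    refine ⟨s, LinearMap.ext fun x => ?_⟩
    obtain ⟨x, rfl⟩ := hsur x
    exact LinearMap.congr_fun hs x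
  -- The image of `α` embeds in `T`, so it has no extensions by `Y`. A map from the kernel to `Y`
  -- then extends to `Q`, hence factors through `α`, and so is zero on the kernel.
  · have h1 : ExtZ Λ (LinearMap.range α) Y :=
      (hext Y hY).of_injective_left hΛ (LinearMap.range α).subtype Subtype.val_injective
    have h2 := isSES_subtype_ker hsur
    have hk : ∀ x : LinearMap.ker α, x.1 ∈ LinearMap.ker α.rangeRestrict := fun x =>
      (LinearMap.ker_rangeRestrict α).ge x.2
    have hk' : ∀ x : LinearMap.ker α.rangeRestrict, x.1 ∈ LinearMap.ker α := fun x =>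
      (LinearMap.ker_rangeRestrict α).le x.2
    obtain ⟨f', hf'⟩ := h1 _ _ h2 (f ∘ₗ (LinearMap.ker α.rangeRestrict).subtype.codRestrict _ hk')
    obtain ⟨s, rfl⟩ := hα Y hY f'
    ext x
    have h3 : s (α x.1) = f x := LinearMap.congr_fun hf' ⟨x.1, hk x⟩
    have h4 : α x.1 = 0 := x.2
    rw [← h3, h4, map_zero]; rfl

variable [IsArtinianRing Λ]

/-- The support tilting object of a torsion class. -/
theorem IsTorsionClass.exists_rigidFamily (K : Type w) [Field K] [Algebra K Λ]
    [Module.Finite K Λ] (hΛ : IsHereditary Λ) (h𝒯 : IsTorsionClass 𝒯) (hfin : IsOfFiniteType Λ)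
    {n : ℕ} {P : Fin n → ModuleCat.{u} Λ} (hP : IsIndecProjectiveList P) :
    ∃ (m : ℕ) (F : Fin m → ModuleCat.{u} Λ) (J : Finset (Fin n)), IsRigidFamily F ∧
      (∀ i, F i ∈ 𝒯) ∧ (∀ i, ∀ Y ∈ 𝒯, ExtZ Λ (F i) Y) ∧
      (∀ j ∈ J, ∀ Y ∈ 𝒯, ∀ f : P j →ₗ[Λ] Y, f = 0) ∧
      (∀ X ∈ 𝒯, (∀ i, ∀ f : F i →ₗ[Λ] X, f = 0) → Subsingleton X) ∧
      Submodule.span ℝ (Set.range (compVec P F J)) = ⊤ := by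
  classical
  have hPf := hP.finite
  have hPp := hP.projective
  obtain ⟨s, hs⟩ := id hfin
  -- `F` represents the indecomposable Ext-projectives of `𝒯`; finite type makes the list finite.
  obtain ⟨m, F, hF, hinj, hcomp⟩ := exists_representatives
    (fun X => X ∈ 𝒯 ∧ IsIndec Λ X ∧ ∀ Y ∈ 𝒯, ExtZ Λ X Y)
    (fun X Y ⟨e⟩ ⟨h1, h2, h3⟩ => ⟨h𝒯.quotient_mem X h1 Y e.toLinearEquiv.toLinearMap
      e.toLinearEquiv.surjective, h2.congr e.toLinearEquiv,
      fun Z hZ => (h3 Z hZ).congr_left e.toLinearEquiv⟩) s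
    (fun X ⟨h1, h2, _⟩ => hs X (h𝒯.finite X h1) ((indecomposable_iff X).2 h2))
  have hFf : ∀ i, Module.Finite Λ (F i) := fun i => h𝒯.finite _ (hF i).1
  let J : Finset (Fin n) := Finset.univ.filter fun j => ∀ Y ∈ 𝒯, ∀ f : P j →ₗ[Λ] Y, f = 0
  have hJ : ∀ j ∈ J, ∀ Y ∈ 𝒯, ∀ f : P j →ₗ[Λ] Y, f = 0 := fun j hj => (Finset.mem_filter.1 hj).2
  have hrig : IsRigidFamily F :=
    ⟨hFf, fun i => (hF i).2.1.isBrick hΛ ((hF i).2.2 _ (hF i).1), hinj,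
      fun i j => (hF i).2.2 _ (hF j).1⟩
  choose T hT α hα hT0 hT1 hker using fun i => h𝒯.exists_ext_projective K hΛ hfin (P i)
  have hTf : ∀ i, Module.Finite Λ (T i) := fun i => h𝒯.finite _ (hT i)
  let W := Submodule.span ℝ (Set.range (compVec P F J))
  have hWF : ∀ i, gVec P (F i) ∈ W := fun i => Submodule.subset_span ⟨Sum.inl i, rfl⟩
  have hWJ : ∀ j ∈ J, (Pi.single j 1 : Fin n → ℝ) ∈ W := fun j hj => by
    have h1 : compVec P F J (Sum.inr ⟨j, hj⟩) ∈ W := Submodule.subset_span ⟨_, rfl⟩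
    simpa [compVec] using W.neg_mem h1
  have hmem : ∀ X : ModuleCat.{u} Λ, Module.Finite Λ X → X ∈ 𝒯 ∧ (∀ Y ∈ 𝒯, ExtZ Λ X Y) →
      gVec P X ∈ W := by
    refine indec_induction K (p := fun X => X ∈ 𝒯 ∧ (∀ Y ∈ 𝒯, ExtZ Λ X Y) → gVec P X ∈ W) ?_ ?_ ?_
    · intro X hX _
      rw [gVec_of_subsingleton K hΛ hP]
      exact W.zero_mem
    · rintro X hX hi ⟨h1, h2⟩
      obtain ⟨a, ⟨e⟩⟩ := hcomp X ⟨h1, hi, h2⟩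
      rw [gVec_congr K hΛ hP e.toLinearEquiv]
      exact hWF a
    · rintro X hX A B hAB hA hB ⟨h1, h2⟩
      obtain ⟨i, π, i', π', e1, e2, e3⟩ := exists_equiv_of_isCompl hAB
      rw [← gVec_congr K hΛ hP (Submodule.prodEquivOfIsCompl A B hAB),
        isSES_inl_snd.gVec_add K hΛ hP]
      exact W.add_mem
        (hA ⟨h𝒯.of_surjective h1 π (surjective_of_comp_eq_id e1),
          fun Y hY => (h2 Y hY).of_retract_left i π e1⟩)
        (hB ⟨h𝒯.of_surjective h1 π' (surjective_of_comp_eq_id e2),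
          fun Y hY => (h2 Y hY).of_retract_left i' π' e2⟩)
  have hmemJ : ∀ X : ModuleCat.{u} Λ, Module.Finite Λ X → Module.Projective Λ X ∧
      (∀ Y ∈ 𝒯, ∀ f : X →ₗ[Λ] Y, f = 0) → gVec P X ∈ W := by
    refine indec_induction K (p := fun X => Module.Projective Λ X ∧
      (∀ Y ∈ 𝒯, ∀ f : X →ₗ[Λ] Y, f = 0) → gVec P X ∈ W) ?_ ?_ ?_
    · intro X hX _
      rw [gVec_of_subsingleton K hΛ hP]
      exact W.zero_mem
    · rintro X hX hi ⟨h1, h2⟩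
      obtain ⟨j, ⟨e⟩⟩ := hP.complete X hX h1 ((indecomposable_iff X).2 hi)
      rw [gVec_congr K hΛ hP e.toLinearEquiv, gVec_projective K hΛ hP]
      refine hWJ j (Finset.mem_filter.2 ⟨Finset.mem_univ j, fun Y hY f => ?_⟩)
      have h3 := h2 Y hY (f ∘ₗ e.toLinearEquiv.toLinearMap)
      ext x
      obtain ⟨y, rfl⟩ := e.toLinearEquiv.surjective x
      exact LinearMap.congr_fun h3 y
    · rintro X hX A B hAB hA hB ⟨h1, h2⟩
      obtain ⟨i, π, i', π', e1, e2, e3⟩ := exists_equiv_of_isCompl hAB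
      rw [← gVec_congr K hΛ hP (Submodule.prodEquivOfIsCompl A B hAB),
        isSES_inl_snd.gVec_add K hΛ hP]
      have hzero : ∀ {S : Type u} [AddCommGroup S] [Module Λ S] (j : S →ₗ[Λ] X) (ρ : X →ₗ[Λ] S),
          ρ ∘ₗ j = LinearMap.id → ∀ Y ∈ 𝒯, ∀ f : S →ₗ[Λ] Y, f = 0 := by
        intro S _ _ j ρ hρ Y hY f
        have h3 := h2 Y hY (f ∘ₗ ρ)
        ext x
        have h4 : ρ (j x) = x := LinearMap.congr_fun hρ x
        have := LinearMap.congr_fun h3 (j x)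
        rwa [LinearMap.comp_apply, h4] at this
      exact W.add_mem
        (hA ⟨Module.Projective.of_split i π e1, hzero i π e1⟩)
        (hB ⟨Module.Projective.of_split i' π' e2, hzero i' π' e2⟩)
  refine ⟨m, F, J, hrig, fun i => (hF i).1, fun i => (hF i).2.2, hJ, fun X hX h0 => ?_, ?_⟩
  · have hXf := h𝒯.finite X hX
    have hzero : ∀ Y : ModuleCat.{u} Λ, Module.Finite Λ Y → Y ∈ 𝒯 ∧ (∀ Z ∈ 𝒯, ExtZ Λ Y Z) →
        ∀ f : Y →ₗ[Λ] X, f = 0 := by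
      refine indec_induction K (p := fun Y => Y ∈ 𝒯 ∧ (∀ Z ∈ 𝒯, ExtZ Λ Y Z) →
        ∀ f : Y →ₗ[Λ] X, f = 0) ?_ ?_ ?_
      · intro Y hY _ f
        ext x
        rw [Subsingleton.elim x 0, map_zero, map_zero]
      · rintro Y hY hi ⟨h1, h2⟩ f
        obtain ⟨a, ⟨e⟩⟩ := hcomp Y ⟨h1, hi, h2⟩
        have h3 := h0 a (f ∘ₗ e.toLinearEquiv.symm.toLinearMap)
        ext x
        obtain ⟨y, rfl⟩ := e.toLinearEquiv.symm.surjective x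
        exact LinearMap.congr_fun h3 y
      · rintro Y hY A B hAB hA hB ⟨h1, h2⟩ f
        obtain ⟨i, π, i', π', e1, e2, e3⟩ := exists_equiv_of_isCompl hAB
        have hA' := hA ⟨h𝒯.of_surjective h1 π (surjective_of_comp_eq_id e1),
          fun Z hZ => (h2 Z hZ).of_retract_left i π e1⟩ (f ∘ₗ i)
        have hB' := hB ⟨h𝒯.of_surjective h1 π' (surjective_of_comp_eq_id e2),
          fun Z hZ => (h2 Z hZ).of_retract_left i' π' e2⟩ (f ∘ₗ i')
        ext x
        have h3 : i (π x) + i' (π' x) = x := LinearMap.congr_fun e3 x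
        have h4 : f (i (π x)) = 0 := LinearMap.congr_fun hA' (π x)
        have h5 : f (i' (π' x)) = 0 := LinearMap.congr_fun hB' (π' x)
        rw [← h3, map_add, h4, h5, add_zero]; rfl
    -- Any map from `P i` to `X` factors through the approximation `T i`, a sum of members of `F`,
    -- and so vanishes.
    refine hP.subsingleton K fun i f => ?_
    obtain ⟨t, rfl⟩ := hα i X hX f
    rw [hzero _ (hTf i) ⟨hT i, hT0 i⟩ t, LinearMap.zero_comp]
  · change W = ⊤
    rw [eq_top_iff]
    intro v _
    rw [pi_eq_sum_univ' v]
    refine W.sum_mem fun i _ => W.smul_mem _ ?_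
    -- In Grothendieck-group terms, `e i = g(ker α) + g(T) - g(T / im α)`. The kernel is projective
    -- without maps to `𝒯`, and the other two modules are Ext-projective.
    have h1 := (isSES_subtype_ker (α i).surjective_rangeRestrict).gVec_add K hΛ hP
    have h2 := (isSES_subtype_mkQ (LinearMap.range (α i))).gVec_add K hΛ hP
    have h3 : gVec P (T i) ∈ W := hmem (T i) (hTf i) ⟨hT i, hT0 i⟩
    have h4 : gVec P (T i ⧸ LinearMap.range (α i)) ∈ W :=
      hmem (ModuleCat.of Λ (T i ⧸ LinearMap.range (α i)))
        (inferInstanceAs (Module.Finite Λ (T i ⧸ LinearMap.range (α i))))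
        ⟨h𝒯.of_surjective (M := T i) (hT i) _ (Submodule.mkQ_surjective _), hT1 i⟩
    have h5 : gVec P (LinearMap.ker (α i)) ∈ W :=
      hmemJ (ModuleCat.of Λ (LinearMap.ker (α i)))
        (inferInstanceAs (Module.Finite Λ (LinearMap.ker (α i))))
        ⟨hΛ.projective_submodule _, hker i⟩
    rw [LinearMap.ker_rangeRestrict, gVec_projective K hΛ hP] at h1
    rw [h2] at h3
    have h6 : (Pi.single i 1 : Fin n → ℝ) ∈ W := by
      rw [h1]
      exact W.add_mem h5 ((W.add_mem_iff_left h4).1 h3)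
    convert h6 using 1

end TorsionClass

end WallChamber

namespace WallChamber

universe w u

/-! ### Every vector off the walls lies in the cone of a cluster-tilting object. -/

section Existence

variable {Λ : Type u} [Ring Λ] {n : ℕ} {P : Fin n → ModuleCat.{u} Λ}

theorem mem_positiveQuotientClass_iff (K : Type w) [Field K] [Algebra K Λ] [Module.Finite K Λ]
    [IsNoetherianRing Λ]
    (g : Fin n → ℝ) (M : ModuleCat.{u} Λ) :
    M ∈ positiveQuotientClass K P g ↔ Module.Finite Λ M ∧
      ∀ (Y : Type u) [AddCommGroup Y] [Module Λ Y] [Nontrivial Y] (p : M →ₗ[Λ] Y),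
        Function.Surjective p → 0 < g ⬝ᵥ dimVec K P (ModuleCat.of Λ Y) := by
  refine and_congr_right fun hM => ⟨fun h Y _ _ _ p hp => ?_, fun h N hN => ?_⟩
  · have hY : Module.Finite Λ Y := Module.Finite.of_surjective p hp
    rw [← dimVec_congr K (p.quotKerEquivOfSurjective hp)]
    refine h _ fun hk => ?_
    obtain ⟨y, hy⟩ := exists_ne (0 : Y)
    obtain ⟨x, rfl⟩ := hp y
    exact hy (LinearMap.congr_fun (LinearMap.ker_eq_top.1 hk) x)
  · have : Nontrivial (M ⧸ N) := Submodule.Quotient.nontrivial_iff.2 hN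
    exact h (M ⧸ N) N.mkQ N.mkQ_surjective

theorem isTorsionClass_positiveQuotientClass (K : Type w) [Field K] [Algebra K Λ]
    [Module.Finite K Λ] [IsNoetherianRing Λ] (hP : IsIndecProjectiveList P) (g : Fin n → ℝ) :
    IsTorsionClass (positiveQuotientClass K P g) where
  finite M hM := hM.1
  zero_mem M hM := ⟨inferInstance, fun N hN => (hN (Subsingleton.elim _ _)).elim⟩
  quotient_mem M hM N p hp := by
    rw [mem_positiveQuotientClass_iff] at hM ⊢
    have := hM.1
    exact ⟨Module.Finite.of_surjective p hp, fun Y _ _ _ q hq => hM.2 Y (q ∘ₗ p) (hq.comp hp)⟩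
  extension_mem L M N f p h1 h2 h3 hL hN := by
    rw [mem_positiveQuotientClass_iff] at hL hN ⊢
    have := hL.1
    have := hN.1
    have hs : IsSES f p := ⟨h1, h2, h3⟩
    have hM : Module.Finite Λ M := by
      have hr : Module.Finite Λ (LinearMap.range f) := inferInstance
      have hq : Module.Finite Λ (M ⧸ LinearMap.range f) := by
        have e : LinearMap.range f = LinearMap.ker p := by
          ext y; exact ((h2 y).symm)
        rw [e]
        exact Module.Finite.equiv (p.quotKerEquivOfSurjective h3).symm
      exact Module.Finite.of_submodule_quotient (LinearMap.range f)
    refine ⟨hM, fun Y _ _ _ q hq => ?_⟩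
    have hY : Module.Finite Λ Y := Module.Finite.of_surjective q hq
    -- A quotient `Y` of `M` is an extension of a quotient of `N` by the quotient `S` of `L`, and at
    -- least one of the two is nonzero.
    let S := LinearMap.range (q ∘ₗ f)
    obtain ⟨q', hq'⟩ := hs.exists_desc (S.mkQ ∘ₗ q) (by
      ext x
      exact (Submodule.Quotient.mk_eq_zero S).2 ⟨x, rfl⟩)
    have hq's : Function.Surjective q' := by
      have : Function.Surjective (q' ∘ₗ p) := by
        rw [hq']; exact S.mkQ_surjective.comp hq
      exact Function.Surjective.of_comp this
    rw [(isSES_subtype_mkQ S).dot_dimVec K hP]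
    have hS : Nontrivial S → 0 < g ⬝ᵥ dimVec K P (ModuleCat.of Λ S) := fun _ =>
      hL.2 S (q ∘ₗ f).rangeRestrict (q ∘ₗ f).surjective_rangeRestrict
    have hQ : Nontrivial (Y ⧸ S) → 0 < g ⬝ᵥ dimVec K P (ModuleCat.of Λ (Y ⧸ S)) := fun _ =>
      hN.2 (Y ⧸ S) q' hq's
    by_cases h : Nontrivial S
    · by_cases h' : Nontrivial (Y ⧸ S)
      · exact add_pos (hS h) (hQ h')
      · have := not_nontrivial_iff_subsingleton.1 h'
        rw [dimVec_of_subsingleton K (M := Y ⧸ S), dotProduct_zero, add_zero]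
        exact hS h
    · have := not_nontrivial_iff_subsingleton.1 h
      rw [dimVec_of_subsingleton K (M := S), dotProduct_zero, zero_add]
      refine hQ (Submodule.Quotient.nontrivial_iff.2 ?_)
      rintro hS'
      have h0 : S = ⊥ := Submodule.subsingleton_iff_eq_bot.1 this
      have : (⊤ : Submodule Λ Y) = ⊥ := hS'.symm.trans h0
      exact top_ne_bot this

variable [IsNoetherianRing Λ]

/-- Off the walls, a nonzero module with nonnegative pairing contains a nonzero submodule from
the torsion class. -/
theorem exists_mem_positiveQuotientClass (K : Type w) [Field K] [Algebra K Λ] [Module.Finite K Λ]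
    (hP : IsIndecProjectiveList P) {g : Fin n → ℝ} (hg : g ∉ walls K P) (d : ℕ) :
    ∀ X : ModuleCat.{u} Λ, Module.Finite Λ X → Nontrivial X → homDim K Λ Λ X = d →
      0 ≤ g ⬝ᵥ dimVec K P X →
      ∃ N ∈ positiveQuotientClass K P g, Nontrivial N ∧
        ∃ j : N →ₗ[Λ] X, Function.Injective j := by
  induction d using Nat.strong_induction_on with
  | _ d ih =>
    intro X hX hnt hd hgX
    -- If all quotients pair nonnegatively, a nonzero one with pairing zero would be semistable and
    -- put `g` on a wall. Otherwise a quotient with negative pairing leaves a smaller submodule with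
    -- positive pairing.
    by_cases hall : ∀ N : Submodule Λ X, 0 ≤ g ⬝ᵥ dimVec K P (ModuleCat.of Λ (X ⧸ N))
    · refine ⟨X, ⟨hX, fun N hN => lt_of_le_of_ne (hall N) fun h0 => hg ?_⟩, hnt,
        LinearMap.id, Function.injective_id⟩
      refine mem_walls_of_semistable K hP g (ModuleCat.of Λ (X ⧸ N))
        (inferInstanceAs (Module.Finite Λ (X ⧸ N))) (Submodule.Quotient.nontrivial_iff.2 hN)
        ⟨h0.symm, fun S => ?_⟩
      let S' : Submodule Λ (X ⧸ N) := S
      have h1 := (isSES_subtype_mkQ S').dot_dimVec K hP g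
      have h2 : 0 ≤ g ⬝ᵥ dimVec K P (ModuleCat.of Λ ((X ⧸ N) ⧸ S')) := by
        have hsurj : Function.Surjective (S'.mkQ ∘ₗ N.mkQ) :=
          S'.mkQ_surjective.comp N.mkQ_surjective
        rw [← dimVec_congr K ((S'.mkQ ∘ₗ N.mkQ).quotKerEquivOfSurjective hsurj)]
        exact hall _
      change g ⬝ᵥ dimVec K P (ModuleCat.of Λ S') ≤ 0
      linarith
    · push Not at hall
      obtain ⟨N, hN⟩ := hall
      have h1 : g ⬝ᵥ dimVec K P X = _ + _ := (isSES_subtype_mkQ N).dot_dimVec K hP g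
      have hNpos : 0 < g ⬝ᵥ dimVec K P (ModuleCat.of Λ N) := by linarith
      have hNtop : N ≠ ⊤ := by
        intro h
        have : Subsingleton (X ⧸ N) := Submodule.Quotient.subsingleton_iff.2 h
        rw [dimVec_of_subsingleton K (M := X ⧸ N), dotProduct_zero] at hN
        exact lt_irrefl _ hN
      have hNnt : Nontrivial N := by
        by_contra h
        have := not_nontrivial_iff_subsingleton.1 h
        rw [dimVec_of_subsingleton K (M := N), dotProduct_zero] at hNpos
        exact lt_irrefl _ hNpos
      obtain ⟨N', hN', hnt', j, hj⟩ := ih _ (hd ▸ homDim_self_submodule_lt K hNtop)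
        (ModuleCat.of Λ N) (inferInstanceAs (Module.Finite Λ N)) hNnt rfl hNpos.le
      exact ⟨N', hN', hnt', N.subtype ∘ₗ j, Subtype.val_injective.comp hj⟩

variable [IsArtinianRing Λ]

/-- Every vector off the walls lies in the cone of a cluster-tilting object. -/
theorem exists_clusterTiltingObject (K : Type w) [Field K] [Algebra K Λ] [Module.Finite K Λ]
    (hΛ : IsHereditary Λ) (hfin : IsOfFiniteType Λ) (hP : IsIndecProjectiveList P)
    {g : Fin n → ℝ} (hg : g ∉ walls K P) : ∃ C : ClusterTiltingObject P, g ∈ C.openCone := by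
  have h𝒯 := isTorsionClass_positiveQuotientClass K hP g
  obtain ⟨m, F, J, hF, hF𝒯, hext, hJ𝒯, hgen, hspan⟩ := h𝒯.exists_rigidFamily K hΛ hfin hP
  have hFf := hF.finite
  have hPf := hP.finite
  have hPp := hP.projective
  have hJ : ∀ j ∈ J, ∀ i, ∀ f : P j →ₗ[Λ] F i, f = 0 := fun j hj i => hJ𝒯 j hj _ (hF𝒯 i)
  let b := Module.Basis.mk (compVec_linearIndependent K hΛ hP hF hJ) hspan.ge
  have hb : ∀ x, b x = compVec P F J x := fun x => Module.Basis.mk_apply _ _ x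
  have hcard : m + J.card = n := by
    have := Module.finrank_eq_card_basis b
    simpa using this.symm
  -- If the pairing were nonnegative, `X` would contain a nonzero module of the torsion class, which
  -- receives a nonzero map from some `F i`.
  have hneg : ∀ X : ModuleCat.{u} Λ, Module.Finite Λ X → Nontrivial X →
      (∀ i, ∀ f : F i →ₗ[Λ] X, f = 0) → g ⬝ᵥ dimVec K P X < 0 := by
    intro X hX hnt h0
    by_contra hge
    obtain ⟨N, hN, hNnt, j, hj⟩ :=
      exists_mem_positiveQuotientClass K hP hg _ X hX hnt rfl (not_lt.1 hge)
    refine not_subsingleton_iff_nontrivial.2 hNnt (hgen N hN fun i f => ?_)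
    ext x
    apply hj
    rw [LinearMap.zero_apply, map_zero]
    exact LinearMap.congr_fun (h0 i (j ∘ₗ f)) x
  have hpos : ∀ X ∈ positiveQuotientClass K P g, Nontrivial X → 0 < g ⬝ᵥ dimVec K P X :=
    fun X hX _ => ((mem_positiveQuotientClass_iff K g X).1 hX).2 X LinearMap.id
      Function.surjective_id
  have hrepr : g = ∑ x, b.repr g x • compVec P F J x := by
    simp only [← hb]
    exact (b.sum_repr g).symm
  have hcoef : ∀ x, 0 < b.repr g x := by
    intro x₀
    obtain ⟨X, hX, hnt, h1, h2⟩ := exists_perp K hΛ hP hF hJ x₀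
    have hdot : ∀ (Y : Type u) [AddCommGroup Y] [Module Λ Y] [Module.Finite Λ Y],
        (∀ x, x ≠ x₀ → compVec P F J x ⬝ᵥ dimVec K P (ModuleCat.of Λ Y) = 0) →
        g ⬝ᵥ dimVec K P (ModuleCat.of Λ Y) =
          b.repr g x₀ * (compVec P F J x₀ ⬝ᵥ dimVec K P (ModuleCat.of Λ Y)) := by
      intro Y _ _ _ h0
      conv_lhs => rw [hrepr]
      rw [sum_smul_dot, Finset.sum_eq_single x₀]
      · intro x _ hx
        rw [h0 x hx, mul_zero]
      · simp
    -- Only `x₀` contributes to the pairing of `g` with the chosen test module. Without maps from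
    -- `F`, the test module is `X`, and both `g` and the vector of `x₀` pair with it with negative
    -- sign. Otherwise `x₀` is some `F l`, and the image of a nonzero map `F l → X` lies in the
    -- torsion class and gives two positive pairings.
    by_cases hhom : ∀ i, ∀ f : F i →ₗ[Λ] X, f = 0
    · have h3 := hneg X hX hnt hhom
      have h4 : g ⬝ᵥ dimVec K P X = _ := hdot X fun x hx => by
        rcases x with i | j
        · rw [compVec_inl_dot K hΛ hP i (hFf i), (eulerForm_eq_homDim_iff K).2 (h1 i hx).2,
            homDim_eq_zero_of_forall K (hhom i)]
          simp
        · rw [compVec_inr_dot, homDim_eq_zero_of_forall K (h2 j hx)]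
          simp
      rw [h4] at h3
      exact pos_of_mul_neg_left h3 (compVec_dot_nonpos K hΛ hP hFf hhom x₀)
    · push Not at hhom
      obtain ⟨l, f, hf⟩ := hhom
      have hl : Sum.inl l = x₀ := by
        by_contra hne
        exact hf ((h1 l hne).1 f)
      let Y := LinearMap.range f
      have hY𝒯 : ModuleCat.of Λ Y ∈ positiveQuotientClass K P g :=
        h𝒯.of_surjective (M := F l) (hF𝒯 l) f.rangeRestrict f.surjective_rangeRestrict
      have hYnt : Nontrivial Y :=
        Submodule.nontrivial_iff_ne_bot.2 fun h => hf (LinearMap.range_eq_bot.1 h)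
      have h3 := hpos _ hY𝒯 hYnt
      have h4 := hdot Y fun x hx => by
        rcases x with i | j
        · rw [compVec_inl_dot K hΛ hP i (hFf i),
            (eulerForm_eq_homDim_iff K).2 (hext i _ hY𝒯), homDim_eq_zero_of_forall K fun φ => ?_]
          · simp
          · ext x
            exact LinearMap.congr_fun ((h1 i hx).1 (Y.subtype ∘ₗ φ)) x
        · rw [compVec_inr_dot, homDim_eq_zero_of_forall K fun φ => ?_]
          · simp
          · exact hJ𝒯 j.1 j.2 _ hY𝒯 φ
      rw [h4] at h3
      refine pos_of_mul_pos_left h3 ?_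
      rw [← hl, compVec_inl_dot K hΛ hP l (hFf l),
        (eulerForm_eq_homDim_iff K).2 (hext l _ hY𝒯)]
      simp
  let C : ClusterTiltingObject P :=
    { k := m
      T := F
      J := J
      exceptional := fun i => ⟨hF.finite i, hF.brick i, (subsingleton_ext_iff _ _).2 (hF.ext i i)⟩
      injective := hF.injective
      ext_eq_zero := fun i j => (subsingleton_ext_iff _ _).2 (hF.ext i j)
      hom_eq_zero := hJ
      card_eq := hcard }
  exact ⟨C, (C.mem_openCone_iff K hΛ hP g).2 ⟨_, hcoef, hrepr⟩⟩

end Existence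

end WallChamber

/-! ### The proposition. -/

theorem mainTheorem6 {K : Type*} [Field K] {Λ : Type*} [Ring Λ] [Algebra K Λ] [Module.Finite K Λ]
    (hΛ : WallChamber.IsHereditary Λ) (hfin : WallChamber.IsOfFiniteType Λ)
    {n : ℕ} (P : Fin n → ModuleCat Λ) (hP : WallChamber.IsIndecProjectiveList P)
    (U : Set (Fin n → ℝ)) (hU : WallChamber.IsChamber K P U) (g : Fin n → ℝ) (hg : g ∈ U) :
    ∀ 𝒯 : Set (ModuleCat Λ),
      WallChamber.IsTorsionClassOf P U 𝒯 ↔ 𝒯 = WallChamber.positiveQuotientClass K P g := by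
  have hN : IsNoetherianRing Λ := IsNoetherianRing.of_finite K Λ
  have hA : IsArtinianRing Λ := IsArtinianRing.of_finite K Λ
  intro 𝒯
  constructor
  · rintro ⟨-, C, rfl, rfl⟩
    exact C.fac_eq K hΛ hP hg
  · rintro rfl
    obtain ⟨x, -, rfl⟩ := hU
    have hgw : g ∉ WallChamber.walls K P := connectedComponentIn_subset _ _ hg
    obtain ⟨C, hC⟩ := WallChamber.exists_clusterTiltingObject K hΛ hfin hP hgw
    refine ⟨WallChamber.isTorsionClass_positiveQuotientClass K hP g, C, ?_, C.fac_eq K hΛ hP hC⟩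
    -- The chamber is also the component of `g`, which the cone containing `g` fills out.
    rw [connectedComponentIn_eq hg]
    exact (C.connectedComponentIn_eq K hΛ hP hC).symm
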